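/- A closed flat folded ribbon of width $w>0$ with $n\ge 3$ folds is given by a closed polygonal centre line in the plane with $n$ vertices (no vertex lies on an edge that it does not bound), folded at every vertex along the line whose reflection exchanges the incoming and the outgoing direction of the centre line. Consecutive fold lines are disjoint, so that the ribbon is cut into $n$ quadrilateral pieces. These pieces carry layering information: over each point the pieces whose interior contains it are linearly ordered, and no piece passes through a fold. The ribbon may be a Möbius band. The ribbon is called a $(p,q)$ torus knot if its centre line, lifted to space according to the layering, is isotopic to the standard $(p,q)$ torus knot. It is said to form a regular $n$-gon $P$ if it lies in $P$ and its $n$ fold lines are exactly the $n$ sides of $P$; a hole in the middle is allowed. We say that the $(p,q)$ torus knot realises the regular $n$-gon if, for every regular $n$-gon $P$ in the plane, some closed flat folded ribbon with $n$ folds is a $(p,q)$ torus knot and forms $P$. Then: 1. for every $q\ge 2$, the $(q+1,q)$ torus knot realises the regular $(2q+1)$-gon; 2. for every odd $p\ge 7$, the $(p,2)$ torus knot realises the regular $p$-gon; 3. for every odd $q>1$, the $(2q+2,q)$ torus knot realises the regular $(2q+2)$-gon; 4. for every odd $q>1$, the $(2q+4,q)$ torus knot realises the regular $(2q+4)$-gon;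 5. consequently, every regular $n$-gon with $n\ge 7$, and also the regular pentagon, is realised by a torus knot of one of these four families; 6. every regular $n$-gon with $n\ge 7$ odd is realised in two different ways: if $n=2q+1$ (so $q\ge 3$), it is formed by a ribbon that is a $(q+1,q)$ torus knot and by a ribbon that is an $(n,2)$ torus knot, and these two ribbons can be chosen so that the regions of the plane that they cover are not congruent. -/

import Mathlib

open scoped InnerProductSpace

noncomputable section

/-! ### Knots in three-space

Three-space is `ℂ × ℝ` (horizontal plane, height). A knot is a regular `C¹` closed curve without
self-intersections, parametrised by `ℝ` modulo `ℤ`. -/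

structure Knot where
  toFun : ℝ → ℂ × ℝ
  contDiff : ContDiff ℝ 1 toFun
  periodic : ∀ s, toFun (s + 1) = toFun s
  regular : ∀ s, deriv toFun s ≠ 0
  embedded : ∀ s t, toFun s = toFun t → ∃ m : ℤ, s - t = m

/-- Isotopy of knots: a path of knots that is continuous in the `C¹` sense, that is, the points and
the velocity vectors depend jointly continuously on time and parameter. -/
def Knot.Isotopic (K L : Knot) : Prop :=
  ∃ F : unitInterval → Knot,
    Continuous (fun x : unitInterval × ℝ => (F x.1).toFun x.2) ∧
    Continuous (fun x : unitInterval × ℝ => deriv (F x.1).toFun x.2) ∧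
    F 0 = K ∧ F 1 = L

/-- The curve on the standard torus (core radius `2`, tube radius `1`) that winds `p` times around
the tube while it goes `q` times around the axis. -/
def torusCurve (p q : ℕ) (s : ℝ) : ℂ × ℝ :=
  (((2 + Real.cos (2 * Real.pi * (p * s)) : ℝ) : ℂ) *
      Complex.exp (((2 * Real.pi * (q * s) : ℝ) : ℂ) * Complex.I),
    Real.sin (2 * Real.pi * (p * s)))

theorem torusCurve_embedded {p q : ℕ} (h : p.Coprime q) (s t : ℝ)
    (hst : torusCurve p q s = torusCurve p q t) : ∃ m : ℤ, s - t = m := by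
  obtain ⟨h1, h2⟩ := Prod.ext_iff.1 hst
  simp only [torusCurve] at h1 h2
  have hn := congrArg norm h1
  rw [norm_mul, norm_mul, Complex.norm_exp_ofReal_mul_I, Complex.norm_exp_ofReal_mul_I,
    Complex.norm_real, Complex.norm_real, mul_one, mul_one, Real.norm_eq_abs, Real.norm_eq_abs,
    abs_of_pos (by linarith [Real.neg_one_le_cos (2 * Real.pi * (p * s))]),
    abs_of_pos (by linarith [Real.neg_one_le_cos (2 * Real.pi * (p * t))])] at hn
  have hc : Real.cos (2 * Real.pi * (p * s)) = Real.cos (2 * Real.pi * (p * t)) := by linarith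
  rw [hc] at h1
  have hne : (((2 + Real.cos (2 * Real.pi * (p * t)) : ℝ)) : ℂ) ≠ 0 := by
    exact_mod_cast (by linarith [Real.neg_one_le_cos (2 * Real.pi * (p * t))] :
      (0 : ℝ) < 2 + Real.cos (2 * Real.pi * (p * t))).ne'
  have he := mul_left_cancel₀ hne h1
  have key : ∀ x y : ℝ, Complex.exp (((2 * Real.pi * x : ℝ) : ℂ) * Complex.I) =
      Complex.exp (((2 * Real.pi * y : ℝ) : ℂ) * Complex.I) → ∃ k : ℤ, x - y = k := by
    intro x y hxy
    obtain ⟨k, hk⟩ := Complex.exp_eq_exp_iff_exists_int.1 hxy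
    refine ⟨k, ?_⟩
    have := congrArg Complex.im hk
    simp at this
    have hpi := Real.pi_pos
    have h3 : 2 * Real.pi * (x - y - k) = 0 := by linarith
    have := (mul_eq_zero.1 h3).resolve_left (by positivity)
    linarith
  obtain ⟨b, hb⟩ := key _ _ he
  obtain ⟨a, ha⟩ := key (p * s) (p * t) (by
    rw [Complex.exp_mul_I, Complex.exp_mul_I, ← Complex.ofReal_cos, ← Complex.ofReal_cos,
      ← Complex.ofReal_sin, ← Complex.ofReal_sin, hc, h2])
  have hbez := Nat.gcd_eq_gcd_ab p q
  rw [h] at hbez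
  refine ⟨a * p.gcdA q + b * p.gcdB q, ?_⟩
  have hb' : (1 : ℝ) = p * p.gcdA q + q * p.gcdB q := by exact_mod_cast hbez
  push_cast
  rw [← ha, ← hb]
  linear_combination (s - t) * hb'

theorem torusCurve_hasDerivAt (p q : ℕ) (s : ℝ) :
    HasDerivAt (torusCurve p q)
      ((((-(Real.sin (2 * Real.pi * (p * s)) * (2 * Real.pi * p)) : ℝ) : ℂ) +
          ((2 + Real.cos (2 * Real.pi * (p * s)) : ℝ) : ℂ) *
            (((2 * Real.pi * q : ℝ) : ℂ) * Complex.I)) *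
          Complex.exp (((2 * Real.pi * (q * s) : ℝ) : ℂ) * Complex.I),
        Real.cos (2 * Real.pi * (p * s)) * (2 * Real.pi * p)) s := by
  have hp : HasDerivAt (fun s : ℝ => 2 * Real.pi * (p * s)) (2 * Real.pi * p) s := by
    simpa using ((hasDerivAt_id s).const_mul (p : ℝ)).const_mul (2 * Real.pi)
  have hq : HasDerivAt (fun s : ℝ => 2 * Real.pi * (q * s)) (2 * Real.pi * q) s := by
    simpa using ((hasDerivAt_id s).const_mul (q : ℝ)).const_mul (2 * Real.pi)
  have hc := (hp.cos.const_add 2).ofReal_comp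
  have he := (hq.ofReal_comp.mul_const Complex.I).cexp
  refine ((hc.mul he).prodMk hp.sin).congr_deriv ?_
  refine Prod.ext ?_ rfl
  push_cast
  ring

/-- The `(p, q)` torus knot. -/
def torusKnot (p q : ℕ) (h : p.Coprime q) : Knot where
  toFun := torusCurve p q
  contDiff := by
    unfold torusCurve
    refine ContDiff.prodMk (ContDiff.mul ?_ (ContDiff.cexp (ContDiff.mul ?_ contDiff_const))) ?_
    · exact Complex.ofRealCLM.contDiff.comp
        (contDiff_const.add (Real.contDiff_cos.comp
          (contDiff_const.mul (contDiff_const.mul contDiff_id))))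
    · exact Complex.ofRealCLM.contDiff.comp
        (contDiff_const.mul (contDiff_const.mul contDiff_id))
    · fun_prop
  periodic s := by
    have hk : ∀ k : ℕ, 2 * Real.pi * (k * (s + 1)) = 2 * Real.pi * (k * s) + k * (2 * Real.pi) :=
      fun k => by ring
    have he : Complex.exp (((2 * Real.pi * (q * s) + q * (2 * Real.pi) : ℝ) : ℂ) * Complex.I) =
        Complex.exp (((2 * Real.pi * (q * s) : ℝ) : ℂ) * Complex.I) :=
      Complex.exp_eq_exp_iff_exists_int.2 ⟨q, by push_cast; ring⟩
    simp only [torusCurve, hk, Real.cos_add_nat_mul_two_pi, Real.sin_add_nat_mul_two_pi, he]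
  regular s := by
    rw [(torusCurve_hasDerivAt p q s).deriv]
    intro h0
    obtain ⟨h1, h2⟩ := Prod.ext_iff.1 h0
    have h3 := (mul_eq_zero.1 h1).resolve_right (Complex.exp_ne_zero _)
    have hre := congrArg Complex.re h3
    have him := congrArg Complex.im h3
    simp only [Complex.add_re, Complex.add_im, Complex.mul_re, Complex.mul_im, Complex.ofReal_re,
      Complex.ofReal_im, Complex.I_re, Complex.I_im, Complex.zero_re, Complex.zero_im] at hre him
    have hcos := Real.neg_one_le_cos (2 * Real.pi * (p * s))
    have hsc := Real.sin_sq_add_cos_sq (2 * Real.pi * (p * s))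
    have hpi := Real.pi_pos
    have hq : (q : ℝ) = 0 := by
      have : (2 + Real.cos (2 * Real.pi * (p * s))) * (2 * Real.pi * q) = 0 := by linarith
      have := (mul_eq_zero.1 this).resolve_left (by linarith)
      exact (mul_eq_zero.1 this).resolve_left (by positivity)
    have hp : (2 * Real.pi * p) ^ 2 = 0 := by
      have e1 : Real.sin (2 * Real.pi * (p * s)) * (2 * Real.pi * p) = 0 := by linarith
      have e2 : Real.cos (2 * Real.pi * (p * s)) * (2 * Real.pi * p) = 0 := h2
      linear_combination (-(2 * Real.pi * p) ^ 2) * hsc +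
        Real.sin (2 * Real.pi * (p * s)) * (2 * Real.pi * p) * e1 +
        Real.cos (2 * Real.pi * (p * s)) * (2 * Real.pi * p) * e2
    have hp' : (p : ℝ) = 0 := (mul_eq_zero.1 (pow_eq_zero_iff two_ne_zero |>.1 hp)).resolve_left
      (by positivity)
    have hp0 : p = 0 := by exact_mod_cast hp'
    have hq0 : q = 0 := by exact_mod_cast hq
    subst hp0 hq0
    simp at h
  embedded := torusCurve_embedded h

/-! ### Flat folded ribbons -/

/-- The planar data of a closed flat ribbon: the vertices (in cyclic order) of the closed polygon
that is its centre line, and its width. The ribbon is folded at each of these vertices. -/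
structure RibbonShape (n : ℕ) where
  vertex : ZMod n → ℂ
  width : ℝ

namespace RibbonShape

variable {n : ℕ} (R : RibbonShape n)

/-- Unit direction of the edge of the centre line from vertex `i` to vertex `i + 1`. -/
def dir (i : ZMod n) : ℂ :=
  ((‖R.vertex (i + 1) - R.vertex i‖⁻¹ : ℝ) : ℂ) * (R.vertex (i + 1) - R.vertex i)

/-- Normal vector of the fold line at vertex `i`: the reflection that exchanges the directions
before and after the fold is the one in a line perpendicular to this vector. It points to the side
on which both layers lie. -/
def foldNormal (i : ZMod n) : ℂ := R.dir i - R.dir (i - 1)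

/-- Signed distance of `z` from the line through the edge `i` of the centre line. -/
def offset (i : ZMod n) (z : ℂ) : ℝ := ⟪Complex.I * R.dir i, z - R.vertex i⟫_ℝ

/-- The fold line at vertex `i`, cut off at the two edges of the ribbon. -/
def crease (i : ZMod n) : Set ℂ :=
  {z | ⟪R.foldNormal i, z - R.vertex i⟫_ℝ = 0 ∧ |R.offset i z| ≤ R.width / 2}

/-- The fold line without its end points. -/
def openCrease (i : ZMod n) : Set ℂ :=
  {z | ⟪R.foldNormal i, z - R.vertex i⟫_ℝ = 0 ∧ |R.offset i z| < R.width / 2}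

/-- The piece of the flat ribbon (a trapezoid or a parallelogram) between the fold lines at the
vertices `i` and `i + 1`. -/
def strip (i : ZMod n) : Set ℂ :=
  {z | |R.offset i z| ≤ R.width / 2 ∧ 0 ≤ ⟪R.foldNormal i, z - R.vertex i⟫_ℝ ∧
    0 ≤ ⟪R.foldNormal (i + 1), z - R.vertex (i + 1)⟫_ℝ}

/-- The interior of that piece. -/
def openStrip (i : ZMod n) : Set ℂ :=
  {z | |R.offset i z| < R.width / 2 ∧ 0 < ⟪R.foldNormal i, z - R.vertex i⟫_ℝ ∧
    0 < ⟪R.foldNormal (i + 1), z - R.vertex (i + 1)⟫_ℝ}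

/-- The part of the plane that the folded ribbon covers. -/
def shadow : Set ℂ := ⋃ i, R.strip i

/-- The centre line, parametrised so that `[i, i + 1]` runs along the edge `i`. -/
def core (x : ℝ) : ℂ :=
  AffineMap.lineMap (R.vertex (⌊x⌋ : ℤ)) (R.vertex ((⌊x⌋ : ℤ) + 1)) (Int.fract x)

end RibbonShape

/-- A closed flat folded ribbon, with `n` folds. `above i j` says that piece `i` lies above piece
`j`; it carries information only for pieces that overlap. The ribbon need not be orientable. -/
structure FoldedRibbon (n : ℕ) extends RibbonShape n where
  three_le : 3 ≤ n
  width_pos : 0 < width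
  edge_ne : ∀ i, vertex (i + 1) ≠ vertex i
  /-- The centre line is the projection of a knot diagram: no vertex lies on an edge that it does
  not bound. -/
  core_regular : ∀ i j, i ≠ j → i ≠ j + 1 → vertex i ∉ segment ℝ (vertex j) (vertex (j + 1))
  /-- There is a genuine fold at each vertex. -/
  fold_ne : ∀ i, toRibbonShape.foldNormal i ≠ 0
  /-- The fold lines do not meet within the ribbon. -/
  crease_disjoint : ∀ i, Disjoint (toRibbonShape.crease i) (toRibbonShape.crease (i + 1))
  above : ZMod n → ZMod n → Prop
  /-- Over each point, the pieces of ribbon are stacked in a linear order. -/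
  above_irrefl : ∀ z i, z ∈ toRibbonShape.openStrip i → ¬ above i i
  above_trans : ∀ z i j k, z ∈ toRibbonShape.openStrip i → z ∈ toRibbonShape.openStrip j →
    z ∈ toRibbonShape.openStrip k → above i j → above j k → above i k
  above_total : ∀ z i j, z ∈ toRibbonShape.openStrip i → z ∈ toRibbonShape.openStrip j →
    i ≠ j → above i j ∨ above j i
  /-- No piece of ribbon passes through a fold: a piece that extends across a fold line does not lie
  between the two layers that are joined there. -/
  fold_strip : ∀ i j z, z ∈ toRibbonShape.openCrease i → z ∈ toRibbonShape.openStrip j →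
    (above j (i - 1) ↔ above j i)
  /-- Two folds along a common piece of line, with their layers on the same side, do not
  interlock. -/
  fold_fold : ∀ i j z, i ≠ j → z ∈ toRibbonShape.openCrease i → z ∈ toRibbonShape.openCrease j →
    SameRay ℝ (toRibbonShape.foldNormal i) (toRibbonShape.foldNormal j) →
    ((above (j - 1) (i - 1) ↔ above (j - 1) i) ↔ (above j (i - 1) ↔ above j i))

namespace FoldedRibbon

variable {n : ℕ} (R : FoldedRibbon n)

/-- `K` is a knot formed by the centre line of `R` in space: it projects to the centre line,
traversed once, and its crossings are as the layers of the ribbon prescribe. -/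
def IsCoreKnot (K : Knot) : Prop :=
  ∃ x : ℝ → ℝ, Continuous x ∧ Monotone x ∧ (∀ s, x (s + 1) = x s + n) ∧
    (∀ s, (K.toFun s).1 = R.core (x s)) ∧
    ∀ s t, R.core (x s) = R.core (x t) → R.above (⌊x s⌋ : ℤ) (⌊x t⌋ : ℤ) →
      (K.toFun t).2 < (K.toFun s).2

/-- The ribbon is a `(p, q)` torus knot. (All knots formed by the centre line of the same ribbon
have the same diagram, hence the same type.) -/
def IsTorusKnot (p q : ℕ) : Prop :=
  ∃ (h : p.Coprime q) (K : Knot), R.IsCoreKnot K ∧ K.Isotopic (torusKnot p q h)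

end FoldedRibbon

/-! ### Regular polygons -/

/-- Vertices of the regular `n`-gon with centre `c` and a vertex at `c + ρ`. -/
def polygonVertex (n : ℕ) (c ρ : ℂ) (k : ℕ) : ℂ :=
  c + ρ * Complex.exp (((2 * Real.pi * (k / n) : ℝ) : ℂ) * Complex.I)

def polygonSide (n : ℕ) (c ρ : ℂ) (k : ℕ) : Set ℂ :=
  segment ℝ (polygonVertex n c ρ k) (polygonVertex n c ρ (k + 1))

def regularPolygon (n : ℕ) (c ρ : ℂ) : Set ℂ :=
  convexHull ℝ (Set.range (polygonVertex n c ρ))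

/-- The folded ribbon forms the regular `n`-gon: it lies in the polygon, and its `n` fold lines are
the `n` sides. So the polygon is the outline of the folded ribbon; a hole in the middle is
allowed. -/
def FoldedRibbon.Forms {n : ℕ} (R : FoldedRibbon n) (c ρ : ℂ) : Prop :=
  R.shadow ⊆ regularPolygon n c ρ ∧
    ∃ σ : Equiv.Perm (ZMod n), ∀ i, R.crease i = polygonSide n c ρ (σ i).val

/-- The `(p, q)` torus knot can be tied with a closed ribbon so as to form each regular `n`-gon. -/
def TorusKnotRealises (p q n : ℕ) : Prop :=
  ∀ c ρ : ℂ, ρ ≠ 0 → ∃ R : FoldedRibbon n, R.IsTorusKnot p q ∧ R.Forms c ρ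

/-- The families `(q + 1, q)`, `(p, 2)`, `(2 q + 2, q)` and `(2 q + 4, q)`. -/
def InTorusFamilies (p q : ℕ) : Prop :=
  (2 ≤ q ∧ p = q + 1) ∨ (7 ≤ p ∧ Odd p ∧ q = 2) ∨
    (1 < q ∧ Odd q ∧ p = 2 * q + 2) ∨ (1 < q ∧ Odd q ∧ p = 2 * q + 4)

end

noncomputable section

/-! ### Isotopy of knots -/

/-! One planar figure serves all cases. The centre line is the star polygon `{n / k}` through the
midpoints of the sides of the regular polygon, advancing by `k` sides from fold to fold. If the
half-width is half a side times the sine of the angle `π * k / n` between side and edge, the fold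
lines are exactly the sides, and each piece is swept out by segments between two sides, so the
ribbon lies in the polygon. Folds lie on the boundary and distinct sides share no relative interior
point, so no piece can pass through a fold and no two folds can interlock (`openCrease_openStrip`,
`openCrease_inj`). Hence every stacking that is a linear order over each point is admissible
(`starRibbon`).

Two stackings are used. If `2 * k + 2 ≤ n`, the interiors of the pieces stay on one side of the
centre; then "begins between one and `k` sides ahead" is a linear order over each point
(`openStrip_overlap`, `Ahead.trans`) and gives the `(n, k)` torus knot. This covers `k = 2`, and `n
= 2 * k + 2` and `n = 2 * k + 4` with `k` odd. If `n = 2 * k + 1`, the pieces are ranked by their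
first sides, starting from a cut, and the result is the `(k + 1, k)` torus knot.

The knot types are found in polar coordinates. The star polygon winds `k` times around its centre,
and on each edge the radius falls and then rises symmetrically. So double points occur only between
mirror phases `x` and `1 - x`, and an integrality condition keeps them away from the corners
(`crossing_or_eq`). Angle and radius can therefore be deformed linearly to those of the torus curve
while a height that separates these pairs stays fixed (`IsStarHeight.isBraid`). Corners become `C¹`
because the horizontal velocity vanishes there while the height keeps moving. The height `sin` gives
the `(n, k)` torus knot at once.

For the ranked layers the result is a closed braid on `k` strands whose common phase advances by `(2
* k + 1) / k` turns. Over the part of the circle before the threshold `(2 * k + 1) * θ = k + 1` the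
strands are stacked by their number (`cutRank_order`), so one full turn of phase can be taken back
there (`twist_cases`, `isBraid_full_phase`). What remains is `(k + 1) / k` turns on a torus.

Finally, for odd `n ≥ 7` the ranked ribbon covers the centre and the ribbon with `k = 2` does not.
An isometry that matches the covered regions must fix the centre, since the corners determine it; so
none exists (`shadow_not_congruent`). -/

theorem Knot.ext_toFun {K L : Knot} (h : K.toFun = L.toFun) : K = L := by
  cases K; cases L; cases h; rfl

theorem Knot.Isotopic.trans {K L M : Knot} (h₁ : K.Isotopic L) (h₂ : L.Isotopic M) :
    K.Isotopic M := by
  obtain ⟨F, hF, hF', F0, F1⟩ := h₁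
  obtain ⟨G, hG, hG', G0, G1⟩ := h₂
  have pr : Continuous (Set.projIcc (0 : ℝ) 1 zero_le_one) := continuous_projIcc
  refine ⟨fun t => if (t : ℝ) ≤ 1 / 2 then F (Set.projIcc 0 1 zero_le_one (2 * (t : ℝ)))
    else G (Set.projIcc 0 1 zero_le_one (2 * (t : ℝ) - 1)), ?_, ?_, ?_, ?_⟩
  · have : (fun x : unitInterval × ℝ =>
        (if (x.1 : ℝ) ≤ 1 / 2 then F (Set.projIcc 0 1 zero_le_one (2 * (x.1 : ℝ)))
          else G (Set.projIcc 0 1 zero_le_one (2 * (x.1 : ℝ) - 1))).toFun x.2) =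
        fun x => if (x.1 : ℝ) ≤ 1 / 2 then
          (F (Set.projIcc 0 1 zero_le_one (2 * (x.1 : ℝ)))).toFun x.2
          else (G (Set.projIcc 0 1 zero_le_one (2 * (x.1 : ℝ) - 1))).toFun x.2 := by
      funext x; split_ifs <;> rfl
    rw [this]
    refine Continuous.if_le ?_ ?_ (by fun_prop) (by fun_prop) ?_
    · exact hF.comp (f := fun x : unitInterval × ℝ =>
        (Set.projIcc (0 : ℝ) 1 zero_le_one (2 * (x.1 : ℝ)), x.2)) (by fun_prop)
    · exact hG.comp (f := fun x : unitInterval × ℝ =>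
        (Set.projIcc (0 : ℝ) 1 zero_le_one (2 * (x.1 : ℝ) - 1), x.2)) (by fun_prop)
    · intro x hx
      have e1 : Set.projIcc (0 : ℝ) 1 zero_le_one (2 * (x.1 : ℝ)) = 1 := by
        rw [hx]; norm_num
      have e2 : Set.projIcc (0 : ℝ) 1 zero_le_one (2 * (x.1 : ℝ) - 1) = 0 := by
        rw [hx]; norm_num
      rw [e1, e2, F1, G0]
  · have : (fun x : unitInterval × ℝ =>
        deriv (if (x.1 : ℝ) ≤ 1 / 2 then F (Set.projIcc 0 1 zero_le_one (2 * (x.1 : ℝ)))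
          else G (Set.projIcc 0 1 zero_le_one (2 * (x.1 : ℝ) - 1))).toFun x.2) =
        fun x => if (x.1 : ℝ) ≤ 1 / 2 then
          deriv (F (Set.projIcc 0 1 zero_le_one (2 * (x.1 : ℝ)))).toFun x.2
          else deriv (G (Set.projIcc 0 1 zero_le_one (2 * (x.1 : ℝ) - 1))).toFun x.2 := by
      funext x; split_ifs <;> rfl
    rw [this]
    refine Continuous.if_le ?_ ?_ (by fun_prop) (by fun_prop) ?_
    · exact hF'.comp (f := fun x : unitInterval × ℝ =>
        (Set.projIcc (0 : ℝ) 1 zero_le_one (2 * (x.1 : ℝ)), x.2)) (by fun_prop)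
    · exact hG'.comp (f := fun x : unitInterval × ℝ =>
        (Set.projIcc (0 : ℝ) 1 zero_le_one (2 * (x.1 : ℝ) - 1), x.2)) (by fun_prop)
    · intro x hx
      have e1 : Set.projIcc (0 : ℝ) 1 zero_le_one (2 * (x.1 : ℝ)) = 1 := by
        rw [hx]; norm_num
      have e2 : Set.projIcc (0 : ℝ) 1 zero_le_one (2 * (x.1 : ℝ) - 1) = 0 := by
        rw [hx]; norm_num
      rw [e1, e2, F1, G0]
  · simp [F0]
  · norm_num
    exact G1

theorem HasDerivAt.similar {f : ℝ → ℂ × ℝ} {f' : ℂ × ℝ} {s : ℝ} (h : HasDerivAt f f' s)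
    (c a : ℂ) : HasDerivAt (fun s => (c + a * (f s).1, (f s).2)) (a * f'.1, f'.2) s := by
  have h1 : HasDerivAt (fun s => (f s).1) f'.1 s :=
    (ContinuousLinearMap.fst ℝ ℂ ℝ).hasFDerivAt.comp_hasDerivAt s h
  have h2 : HasDerivAt (fun s => (f s).2) f'.2 s :=
    (ContinuousLinearMap.snd ℝ ℂ ℝ).hasFDerivAt.comp_hasDerivAt s h
  exact ((h1.const_mul a).const_add c).prodMk h2

/-- Image of a knot under a similarity of the horizontal plane. -/
def Knot.similar (K : Knot) (c a : ℂ) (ha : a ≠ 0) : Knot where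
  toFun s := (c + a * (K.toFun s).1, (K.toFun s).2)
  contDiff := by have := K.contDiff; fun_prop
  periodic s := by rw [K.periodic]
  regular s h := by
    have hd : HasDerivAt K.toFun (deriv K.toFun s) s :=
      (K.contDiff.differentiable one_ne_zero s).hasDerivAt
    rw [(hd.similar c a).deriv] at h
    obtain ⟨h1, h2⟩ := Prod.ext_iff.1 h
    exact K.regular s (Prod.ext ((mul_eq_zero.1 h1).resolve_left ha) h2)
  embedded s t h := by
    obtain ⟨h1, h2⟩ := Prod.ext_iff.1 h
    exact K.embedded s t (Prod.ext (mul_left_cancel₀ ha (add_left_cancel h1)) h2)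

/-- The path `exp ((1 - t) * log a)` joins `a` to `1` through nonzero numbers, so every stage is
again a similarity. -/
theorem Knot.similar_isotopic (K : Knot) (c a : ℂ) (ha : a ≠ 0) :
    (K.similar c a ha).Isotopic K := by
  have hd : ∀ s, HasDerivAt K.toFun (deriv K.toFun s) s := fun s =>
    (K.contDiff.differentiable one_ne_zero s).hasDerivAt
  have hc : Continuous (deriv K.toFun) := K.contDiff.continuous_deriv_one
  have hK := K.contDiff.continuous
  refine ⟨fun t => K.similar (((1 - t : ℝ) : ℂ) * c)
    (Complex.exp (((1 - t : ℝ) : ℂ) * Complex.log a)) (Complex.exp_ne_zero _), ?_, ?_, ?_, ?_⟩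
  · simp only [Knot.similar]
    fun_prop
  · have : ∀ x : unitInterval × ℝ, deriv (K.similar (((1 - x.1 : ℝ) : ℂ) * c)
        (Complex.exp (((1 - x.1 : ℝ) : ℂ) * Complex.log a)) (Complex.exp_ne_zero _)).toFun x.2 =
        (Complex.exp (((1 - x.1 : ℝ) : ℂ) * Complex.log a) * (deriv K.toFun x.2).1,
          (deriv K.toFun x.2).2) := fun x =>
      ((hd x.2).similar _ _).deriv
    simp only [this]
    fun_prop
  · apply Knot.ext_toFun
    simp [Knot.similar, Complex.exp_log ha]
  · apply Knot.ext_toFun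
    simp [Knot.similar]

/-! ### Closed curves that wind around an axis -/

/-- The curve with angle `2 * π * q * φ`, distance `ρ` from the vertical axis and height `h`. -/
def braidCurve (q : ℕ) (φ ρ h : ℝ → ℝ) (s : ℝ) : ℂ × ℝ :=
  ((ρ s : ℂ) * Complex.exp (((2 * Real.pi * (q * φ s) : ℝ) : ℂ) * Complex.I), h s)

/-- Conditions under which `braidCurve q φ ρ h` is a knot. -/
structure IsBraid (q : ℕ) (φ ρ h : ℝ → ℝ) : Prop where
  angle_add_one : ∀ s, φ (s + 1) = φ s + 1
  radius_add_one : ∀ s, ρ (s + 1) = ρ s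
  height_add_one : ∀ s, h (s + 1) = h s
  radius_pos : ∀ s, 0 < ρ s
  regular : ∀ s, deriv φ s ≠ 0 ∨ deriv h s ≠ 0
  embedded : ∀ s t, ∀ b : ℤ, q * (φ t - φ s) = b → ρ s = ρ t → h s = h t → ∃ m : ℤ, s - t = m

theorem exp_two_pi_eq_iff {x y : ℝ} : Complex.exp (((2 * Real.pi * x : ℝ) : ℂ) * Complex.I) =
    Complex.exp (((2 * Real.pi * y : ℝ) : ℂ) * Complex.I) ↔ ∃ k : ℤ, x - y = k := by
  rw [Complex.exp_eq_exp_iff_exists_int]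
  refine exists_congr fun k => ⟨fun hk => ?_, fun hk => ?_⟩
  · have := congrArg Complex.im hk
    simp at this
    have h3 : 2 * Real.pi * (x - y - k) = 0 := by linarith
    have := (mul_eq_zero.1 h3).resolve_left (by positivity)
    linarith
  · have : x = y + k := by linarith
    rw [this]; push_cast; ring

theorem polar_eq {r r' x y : ℝ} (hr : 0 < r) (hr' : 0 < r')
    (h : (r : ℂ) * Complex.exp (((2 * Real.pi * x : ℝ) : ℂ) * Complex.I) =
      r' * Complex.exp (((2 * Real.pi * y : ℝ) : ℂ) * Complex.I)) :
    r = r' ∧ ∃ k : ℤ, x - y = k := by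
  have hn := congrArg norm h
  rw [norm_mul, norm_mul, Complex.norm_exp_ofReal_mul_I, Complex.norm_exp_ofReal_mul_I,
    Complex.norm_real, Complex.norm_real, mul_one, mul_one, Real.norm_eq_abs, Real.norm_eq_abs,
    abs_of_pos hr, abs_of_pos hr'] at hn
  subst hn
  exact ⟨rfl, exp_two_pi_eq_iff.1 (mul_left_cancel₀ (by exact_mod_cast hr.ne') h)⟩

/-- Velocity of a braid curve in terms of angle, radius and their derivatives. -/
def braidVelocity (q : ℕ) (φ φ' ρ ρ' h' : ℝ) : ℂ × ℝ :=
  (((ρ' : ℂ) + ρ * (((2 * Real.pi * (q * φ') : ℝ) : ℂ) * Complex.I)) *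
    Complex.exp (((2 * Real.pi * (q * φ) : ℝ) : ℂ) * Complex.I), h')

theorem braidCurve_hasDerivAt (q : ℕ) {φ ρ h : ℝ → ℝ} {φ' ρ' h' s : ℝ}
    (hφ : HasDerivAt φ φ' s) (hρ : HasDerivAt ρ ρ' s) (hh : HasDerivAt h h' s) :
    HasDerivAt (braidCurve q φ ρ h) (braidVelocity q (φ s) φ' (ρ s) ρ' h') s := by
  have he := (((hφ.const_mul (q : ℝ)).const_mul (2 * Real.pi)).ofReal_comp.mul_const
    Complex.I).cexp
  refine ((hρ.ofReal_comp.mul he).prodMk hh).congr_deriv (Prod.ext ?_ rfl)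
  simp only [braidVelocity]
  push_cast
  ring

def braidKnot (q : ℕ) (hq : 0 < q) (φ ρ h : ℝ → ℝ) (hφ : ContDiff ℝ 1 φ) (hρ : ContDiff ℝ 1 ρ)
    (hh : ContDiff ℝ 1 h) (H : IsBraid q φ ρ h) : Knot where
  toFun := braidCurve q φ ρ h
  contDiff := by
    unfold braidCurve
    have h1 : ContDiff ℝ 1 fun s => ((ρ s : ℝ) : ℂ) := Complex.ofRealCLM.contDiff.comp hρ
    have h2 : ContDiff ℝ 1 fun s => ((2 * Real.pi * (q * φ s) : ℝ) : ℂ) :=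
      Complex.ofRealCLM.contDiff.comp (contDiff_const.mul (contDiff_const.mul hφ))
    exact (h1.mul (h2.mul contDiff_const).cexp).prodMk hh
  periodic s := by
    simp only [braidCurve, H.angle_add_one, H.radius_add_one, H.height_add_one]
    rw [(exp_two_pi_eq_iff (x := q * (φ s + 1)) (y := q * φ s)).2 ⟨q, by push_cast; ring⟩]
  regular s h0 := by
    have d1 := (hφ.differentiable one_ne_zero s).hasDerivAt
    have d2 := (hρ.differentiable one_ne_zero s).hasDerivAt
    have d3 := (hh.differentiable one_ne_zero s).hasDerivAt
    rw [(braidCurve_hasDerivAt q d1 d2 d3).deriv] at h0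
    obtain ⟨h1, h2⟩ := Prod.ext_iff.1 h0
    rcases H.regular s with h3 | h3
    · have h4 := congrArg Complex.im ((mul_eq_zero.1 h1).resolve_right (Complex.exp_ne_zero _))
      simp only [Complex.add_im, Complex.mul_im, Complex.ofReal_re, Complex.ofReal_im,
        Complex.I_re, Complex.I_im, Complex.zero_im, Complex.mul_re] at h4
      have : ρ s * (2 * Real.pi * (q * deriv φ s)) = 0 := by linarith
      have hq' : (0 : ℝ) < q := by exact_mod_cast hq
      have := (mul_eq_zero.1 this).resolve_left (H.radius_pos s).ne'
      have := (mul_eq_zero.1 this).resolve_left (by positivity)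
      exact h3 ((mul_eq_zero.1 this).resolve_left hq'.ne')
    · exact h3 h2
  embedded s t hst := by
    obtain ⟨h1, h2⟩ := Prod.ext_iff.1 hst
    obtain ⟨h3, k, hk⟩ := polar_eq (H.radius_pos s) (H.radius_pos t) h1
    exact H.embedded s t (-k) (by push_cast; linarith) h3 h2

/-- A family of functions that is continuous in the `C¹` sense. -/
def C1Family (f : ℝ → ℝ → ℝ) : Prop :=
  ∃ f' : ℝ → ℝ → ℝ, (∀ t s, HasDerivAt (f t) (f' t s) s) ∧
    Continuous (fun x : ℝ × ℝ => f x.1 x.2) ∧ Continuous (fun x : ℝ × ℝ => f' x.1 x.2)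

theorem C1Family.contDiff {f : ℝ → ℝ → ℝ} (hf : C1Family f) (t : ℝ) : ContDiff ℝ 1 (f t) := by
  obtain ⟨f', h1, -, h3⟩ := hf
  refine contDiff_one_iff_deriv.2 ⟨fun s => (h1 t s).differentiableAt, ?_⟩
  rw [show deriv (f t) = f' t from funext fun s => (h1 t s).deriv]
  exact h3.comp (f := fun s => (t, s)) (by fun_prop)

theorem ContDiff.c1Family_lerp {f g : ℝ → ℝ} (hf : ContDiff ℝ 1 f) (hg : ContDiff ℝ 1 g) :
    C1Family fun t s => (1 - t) * f s + t * g s := by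
  have c1 := hf.continuous
  have c2 := hg.continuous
  have c3 := hf.continuous_deriv_one
  have c4 := hg.continuous_deriv_one
  refine ⟨fun t s => (1 - t) * deriv f s + t * deriv g s, fun t s => ?_, by fun_prop, by fun_prop⟩
  exact ((hf.differentiable one_ne_zero s).hasDerivAt.const_mul (1 - t)).add
    ((hg.differentiable one_ne_zero s).hasDerivAt.const_mul t)

theorem ContDiff.c1Family_const {f : ℝ → ℝ} (hf : ContDiff ℝ 1 f) : C1Family fun _ s => f s := by
  have c1 := hf.continuous
  have c3 := hf.continuous_deriv_one
  exact ⟨fun _ s => deriv f s, fun t s => (hf.differentiable one_ne_zero s).hasDerivAt,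
    by fun_prop, by fun_prop⟩

theorem C1Family.comp {f : ℝ → ℝ → ℝ} (hf : C1Family f) {g : ℝ → ℝ} (hg : ContDiff ℝ 1 g) :
    C1Family fun t s => g (f t s) := by
  obtain ⟨f', h1, h2, h3⟩ := hf
  have c1 := hg.continuous
  have c3 := hg.continuous_deriv_one
  refine ⟨fun t s => deriv g (f t s) * f' t s, fun t s => ?_, by fun_prop, by fun_prop⟩
  exact (hg.differentiable one_ne_zero _).hasDerivAt.comp s (h1 t s)

/-- Reduces each isotopy between curves around the axis to checking `IsBraid` at every fixed time.
-/
theorem Knot.isotopic_of_isBraid {q : ℕ} (hq : 0 < q) {φ ρ h : ℝ → ℝ → ℝ} (hφ : C1Family φ)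
    (hρ : C1Family ρ) (hh : C1Family h)
    (H : ∀ t, 0 ≤ t → t ≤ 1 → IsBraid q (φ t) (ρ t) (h t)) {K L : Knot}
    (hK : K.toFun = braidCurve q (φ 0) (ρ 0) (h 0))
    (hL : L.toFun = braidCurve q (φ 1) (ρ 1) (h 1)) : K.Isotopic L := by
  obtain ⟨φ', p1, p2, p3⟩ := id hφ
  obtain ⟨ρ', r1, r2, r3⟩ := id hρ
  obtain ⟨h', h1, h2, h3⟩ := id hh
  have key : ∀ {f : ℝ → ℝ → ℝ}, Continuous (fun x : ℝ × ℝ => f x.1 x.2) →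
      Continuous (fun x : unitInterval × ℝ => f x.1 x.2) := fun hf =>
    hf.comp (f := fun x : unitInterval × ℝ => ((x.1 : ℝ), x.2)) (by fun_prop)
  have p2 := key p2
  have p3 := key p3
  have r2 := key r2
  have r3 := key r3
  have h2 := key h2
  have h3 := key h3
  refine ⟨fun t => braidKnot q hq (φ t) (ρ t) (h t) (hφ.contDiff t) (hρ.contDiff t)
    (hh.contDiff t) (H t t.2.1 t.2.2), ?_, ?_, ?_, ?_⟩
  · simp only [braidKnot, braidCurve]
    fun_prop
  · have : ∀ x : unitInterval × ℝ, deriv (braidCurve q (φ x.1) (ρ x.1) (h x.1)) x.2 =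
        braidVelocity q (φ x.1 x.2) (φ' x.1 x.2) (ρ x.1 x.2) (ρ' x.1 x.2) (h' x.1 x.2) := fun x =>
      (braidCurve_hasDerivAt q (p1 _ _) (r1 _ _) (h1 _ _)).deriv
    simp only [braidKnot, this, braidVelocity]
    fun_prop
  · exact Knot.ext_toFun (by rw [hK]; rfl)
  · exact Knot.ext_toFun (by rw [hL]; rfl)

/-! ### Gluing functions along the integers -/

/-- On each closed unit interval the glued function is a single branch; at an integer the
derivatives from both sides agree. -/
theorem hasDerivAt_glue {F F' : ℤ → ℝ → ℝ}
    (hF : ∀ m, ∀ x ∈ Set.Icc (0 : ℝ) 1, HasDerivAt (F m) (F' m x) x)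
    (h0 : ∀ m, F m 1 = F (m + 1) 0) (h1 : ∀ m, F' m 1 = F' (m + 1) 0) (s : ℝ) :
    HasDerivAt (fun s => F ⌊s⌋ (Int.fract s)) (F' ⌊s⌋ (Int.fract s)) s := by
  have e : ∀ m : ℤ, ∀ s ∈ Set.Icc (m : ℝ) (m + 1), F ⌊s⌋ (Int.fract s) = F m (s - m) := by
    rintro m s ⟨hs, hs'⟩
    rcases hs'.lt_or_eq with h | h
    · have : ⌊s⌋ = m := Int.floor_eq_iff.2 ⟨hs, h⟩
      rw [Int.fract, this]
    · have : ⌊s⌋ = m + 1 := by rw [h]; exact_mod_cast Int.floor_intCast (m + 1)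
      rw [Int.fract, this, h]; push_cast; simp [h0]
  have e' : ∀ m : ℤ, ∀ s ∈ Set.Icc (m : ℝ) (m + 1), F' ⌊s⌋ (Int.fract s) = F' m (s - m) := by
    rintro m s ⟨hs, hs'⟩
    rcases hs'.lt_or_eq with h | h
    · have : ⌊s⌋ = m := Int.floor_eq_iff.2 ⟨hs, h⟩
      rw [Int.fract, this]
    · have : ⌊s⌋ = m + 1 := by rw [h]; exact_mod_cast Int.floor_intCast (m + 1)
      rw [Int.fract, this, h]; push_cast; simp [h1]
  have d : ∀ m : ℤ, ∀ s ∈ Set.Icc (m : ℝ) (m + 1), HasDerivWithinAt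
      (fun s => F ⌊s⌋ (Int.fract s)) (F' ⌊s⌋ (Int.fract s)) (Set.Icc (m : ℝ) (m + 1)) s := by
    intro m s hs
    rw [e' m s hs]
    have := (hF m (s - m) ⟨by linarith [hs.1], by linarith [hs.2]⟩).comp_sub_const s (m : ℝ)
    exact this.hasDerivWithinAt.congr (fun y hy => e m y hy) (e m s hs)
  have a1 := Int.floor_le s
  have a2 := Int.lt_floor_add_one s
  rcases a1.lt_or_eq with h | h
  · exact (d ⌊s⌋ s ⟨a1, a2.le⟩).hasDerivAt (Icc_mem_nhds h a2)
  · have u := (d (⌊s⌋ - 1) s ⟨by push_cast; linarith, by push_cast; linarith⟩).union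
      (d ⌊s⌋ s ⟨a1, a2.le⟩)
    push_cast at u
    rw [sub_add_cancel, Set.Icc_union_Icc_eq_Icc (by linarith) (by linarith)] at u
    exact u.hasDerivAt (Icc_mem_nhds (by linarith) a2)

theorem continuous_glue {F : ℤ → ℝ → ℝ} (hF : ∀ m, ContinuousOn (F m) (Set.Icc 0 1))
    (h0 : ∀ m, F m 1 = F (m + 1) 0) : Continuous (fun s : ℝ => F ⌊s⌋ (Int.fract s)) := by
  have e : ∀ m : ℤ, ∀ s ∈ Set.Icc (m : ℝ) (m + 1), F ⌊s⌋ (Int.fract s) = F m (s - m) := by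
    rintro m s ⟨hs, hs'⟩
    rcases hs'.lt_or_eq with h | h
    · have : ⌊s⌋ = m := Int.floor_eq_iff.2 ⟨hs, h⟩
      rw [Int.fract, this]
    · have : ⌊s⌋ = m + 1 := by rw [h]; exact_mod_cast Int.floor_intCast (m + 1)
      rw [Int.fract, this, h]; push_cast; simp [h0]
  have d : ∀ m : ℤ, ContinuousOn (fun s : ℝ => F ⌊s⌋ (Int.fract s))
      (Set.Icc (m : ℝ) (m + 1)) := by
    intro m
    refine ContinuousOn.congr ((hF m).comp (f := fun s : ℝ => s - m) (by fun_prop) ?_) (e m)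
    exact fun s hs => ⟨by linarith [hs.1], by linarith [hs.2]⟩
  refine continuous_iff_continuousAt.2 fun s => ?_
  have a1 := Int.floor_le s
  have a2 := Int.lt_floor_add_one s
  have u := (d (⌊s⌋ - 1)).union_of_isClosed (d ⌊s⌋) isClosed_Icc isClosed_Icc
  push_cast at u
  rw [sub_add_cancel, Set.Icc_union_Icc_eq_Icc (by linarith) (by linarith)] at u
  exact u.continuousAt (Icc_mem_nhds (by linarith) a2)

theorem contDiff_glue {F F' : ℤ → ℝ → ℝ}
    (hF : ∀ m, ∀ x ∈ Set.Icc (0 : ℝ) 1, HasDerivAt (F m) (F' m x) x)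
    (hF' : ∀ m, ContinuousOn (F' m) (Set.Icc 0 1))
    (h0 : ∀ m, F m 1 = F (m + 1) 0) (h1 : ∀ m, F' m 1 = F' (m + 1) 0) :
    ContDiff ℝ 1 (fun s => F ⌊s⌋ (Int.fract s)) := by
  refine contDiff_one_iff_deriv.2 ⟨fun s => (hasDerivAt_glue hF h0 h1 s).differentiableAt, ?_⟩
  rw [show deriv (fun s => F ⌊s⌋ (Int.fract s)) = fun s => F' ⌊s⌋ (Int.fract s) from
    funext fun s => (hasDerivAt_glue hF h0 h1 s).deriv]
  exact continuous_glue hF' h1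

/-- A bump, multiplied by a different constant on each unit interval. -/
theorem contDiff_bump {β : ℝ → ℝ} (hβ : ContDiff ℝ 1 β) (b0 : β 0 = 0) (b1 : β 1 = 0)
    (d0 : deriv β 0 = 0) (d1 : deriv β 1 = 0) (a : ℤ → ℝ) :
    ContDiff ℝ 1 (fun s => a ⌊s⌋ * β (Int.fract s)) := by
  refine contDiff_glue (F := fun m x => a m * β x) (F' := fun m x => a m * deriv β x)
    (fun m x _ => (hβ.differentiable one_ne_zero x).hasDerivAt.const_mul _) (fun m => ?_) ?_ ?_
  · have := hβ.continuous_deriv_one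
    fun_prop
  · simp [b0, b1]
  · simp [d0, d1]

/-! ### A slow-down at the integers -/

/-- An increasing function that commutes with integer translations and, for `τ = 1`, has
derivative zero at the integers. -/
def slow (τ x : ℝ) : ℝ := x - τ * (Real.sin (2 * Real.pi * x) / (2 * Real.pi))

theorem sin_two_pi_add_int (x : ℝ) (m : ℤ) :
    Real.sin (2 * Real.pi * (x + m)) = Real.sin (2 * Real.pi * x) := by
  rw [show 2 * Real.pi * (x + m) = 2 * Real.pi * x + m * (2 * Real.pi) by ring,
    Real.sin_add_int_mul_two_pi]

theorem cos_two_pi_add_int (x : ℝ) (m : ℤ) :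
    Real.cos (2 * Real.pi * (x + m)) = Real.cos (2 * Real.pi * x) := by
  rw [show 2 * Real.pi * (x + m) = 2 * Real.pi * x + m * (2 * Real.pi) by ring,
    Real.cos_add_int_mul_two_pi]

theorem sin_two_pi_one_sub (x : ℝ) :
    Real.sin (2 * Real.pi * (1 - x)) = -Real.sin (2 * Real.pi * x) := by
  rw [show 2 * Real.pi * (1 - x) = 2 * Real.pi - 2 * Real.pi * x by ring, Real.sin_two_pi_sub]

theorem cos_two_pi_one_sub (x : ℝ) :
    Real.cos (2 * Real.pi * (1 - x)) = Real.cos (2 * Real.pi * x) := by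
  rw [show 2 * Real.pi * (1 - x) = 2 * Real.pi - 2 * Real.pi * x by ring, Real.cos_two_pi_sub]

theorem sin_two_pi_fract (x : ℝ) :
    Real.sin (2 * Real.pi * Int.fract x) = Real.sin (2 * Real.pi * x) := by
  rw [← sin_two_pi_add_int (Int.fract x) ⌊x⌋, Int.fract_add_floor]

theorem cos_two_pi_fract (x : ℝ) :
    Real.cos (2 * Real.pi * Int.fract x) = Real.cos (2 * Real.pi * x) := by
  rw [← cos_two_pi_add_int (Int.fract x) ⌊x⌋, Int.fract_add_floor]

theorem slow_add_int (τ x : ℝ) (m : ℤ) : slow τ (x + m) = slow τ x + m := by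
  simp only [slow, sin_two_pi_add_int]; ring

theorem slow_one_sub (τ x : ℝ) : slow τ (1 - x) = 1 - slow τ x := by
  simp only [slow, sin_two_pi_one_sub]; ring

theorem slow_zero (τ : ℝ) : slow τ 0 = 0 := by simp [slow]

theorem slow_one (τ : ℝ) : slow τ 1 = 1 := by
  have := slow_one_sub τ 0
  simpa [slow_zero] using this

theorem slow_half (τ : ℝ) : slow τ (1 / 2) = 1 / 2 := by
  have := slow_one_sub τ (1 / 2)
  norm_num at this ⊢
  linarith

theorem slow_strictMono {τ : ℝ} (h0 : 0 ≤ τ) (h1 : τ ≤ 1) : StrictMono (slow τ) := by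
  intro x y hxy
  have hpi := Real.pi_pos
  have key : Real.sin (2 * Real.pi * y) - Real.sin (2 * Real.pi * x) < 2 * Real.pi * (y - x) := by
    rw [Real.sin_sub_sin]
    have e1 : (2 * Real.pi * y - 2 * Real.pi * x) / 2 = Real.pi * (y - x) := by ring
    have hp : 0 < Real.pi * (y - x) := mul_pos hpi (by linarith)
    rw [e1]
    have h2 : |Real.sin (Real.pi * (y - x))| < Real.pi * (y - x) := by
      have := Real.abs_sin_lt_abs (x := Real.pi * (y - x)) hp.ne'
      rwa [abs_of_pos hp] at this
    have h3 := Real.abs_cos_le_one ((2 * Real.pi * y + 2 * Real.pi * x) / 2)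
    have h4 := mul_le_mul_of_nonneg_left h3 (abs_nonneg (Real.sin (Real.pi * (y - x))))
    rw [← abs_mul] at h4
    have h5 := le_abs_self (Real.sin (Real.pi * (y - x)) *
      Real.cos ((2 * Real.pi * y + 2 * Real.pi * x) / 2))
    linarith
  have key2 : Real.sin (2 * Real.pi * y) / (2 * Real.pi) - Real.sin (2 * Real.pi * x) /
      (2 * Real.pi) < y - x := by
    rw [← sub_div, div_lt_iff₀ (by positivity)]; linarith
  simp only [slow]
  rcases h0.lt_or_eq with h | h
  · have := mul_lt_mul_of_pos_left key2 h
    nlinarith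
  · simpa [← h] using hxy

/-- Turns a lower bound on the slowed phase into one on the phase itself, for all `τ` at once. -/
theorem slow_le {τ x : ℝ} (h0 : 0 ≤ τ) (hx : 0 ≤ x) (hx' : x ≤ 1 / 2) : slow τ x ≤ x := by
  have := Real.sin_nonneg_of_nonneg_of_le_pi (x := 2 * Real.pi * x) (by positivity)
    (by nlinarith [Real.pi_pos])
  have : 0 ≤ τ * (Real.sin (2 * Real.pi * x) / (2 * Real.pi)) := by positivity
  simp only [slow]; linarith

theorem slow_hasDerivAt (τ x : ℝ) :
    HasDerivAt (slow τ) (1 - τ * Real.cos (2 * Real.pi * x)) x := by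
  have h1 : HasDerivAt (fun x => 2 * Real.pi * x) (2 * Real.pi) x := by
    simpa using (hasDerivAt_id x).const_mul (2 * Real.pi)
  refine ((hasDerivAt_id x).sub ((h1.sin.div_const (2 * Real.pi)).const_mul τ)).congr_deriv ?_
  have := Real.pi_pos
  field_simp

theorem slow_contDiff (τ : ℝ) : ContDiff ℝ 1 (slow τ) := by
  unfold slow
  exact contDiff_id.sub (contDiff_const.mul
    ((Real.contDiff_sin.comp (contDiff_const.mul contDiff_id)).div_const _))

/-! ### Polar coordinates on a star polygon -/

/-- Distance from the centre of the point at phase `x` on an edge of a star polygon with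
circumradius `1` and half angle `κ`. -/
def starRadius (κ x : ℝ) : ℝ := Real.cos κ / Real.cos (κ * (2 * slow 1 x - 1))

theorem slow_mem_Icc {τ : ℝ} (h0 : 0 ≤ τ) (h1 : τ ≤ 1) {x : ℝ} (hx : x ∈ Set.Icc (0 : ℝ) 1) :
    slow τ x ∈ Set.Icc (0 : ℝ) 1 := by
  have m := (slow_strictMono h0 h1).monotone
  have a := m hx.1
  have b := m hx.2
  rw [slow_zero] at a
  rw [slow_one] at b
  exact ⟨a, b⟩

section

variable {κ : ℝ}

theorem starRadius_cos_pos (h0 : 0 < κ) (h1 : κ < Real.pi / 2) {x : ℝ}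
    (hx : x ∈ Set.Icc (0 : ℝ) 1) : 0 < Real.cos (κ * (2 * slow 1 x - 1)) := by
  obtain ⟨a, b⟩ := slow_mem_Icc zero_le_one le_rfl hx
  apply Real.cos_pos_of_mem_Ioo
  constructor <;> nlinarith

theorem starRadius_pos (h0 : 0 < κ) (h1 : κ < Real.pi / 2) {x : ℝ}
    (hx : x ∈ Set.Icc (0 : ℝ) 1) : 0 < starRadius κ x :=
  div_pos (Real.cos_pos_of_mem_Ioo ⟨by linarith, h1⟩) (starRadius_cos_pos h0 h1 hx)

theorem starRadius_one_sub (x : ℝ) : starRadius κ (1 - x) = starRadius κ x := by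
  rw [starRadius, starRadius, slow_one_sub,
    show κ * (2 * (1 - slow 1 x) - 1) = -(κ * (2 * slow 1 x - 1)) by ring, Real.cos_neg]

/-- The derivative carries the factor `1 - cos (2 * π * x)` coming from `slow 1`, which vanishes at
both ends of an edge; this is what smooths the corners. -/
theorem starRadius_contDiff (h0 : 0 < κ) (h1 : κ < Real.pi / 2) :
    ContDiff ℝ 1 (fun s => starRadius κ (Int.fract s)) := by
  refine contDiff_glue (F := fun _ x => starRadius κ x)
    (F' := fun _ x => Real.cos κ * (Real.sin (κ * (2 * slow 1 x - 1)) *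
      (κ * (2 * (1 - Real.cos (2 * Real.pi * x))))) / Real.cos (κ * (2 * slow 1 x - 1)) ^ 2)
    (fun m x hx => ?_) (fun m => ?_) (fun m => ?_) (fun m => ?_)
  · have hc := starRadius_cos_pos h0 h1 hx
    have d := ((((slow_hasDerivAt 1 x).const_mul 2).sub_const 1).const_mul κ).cos
    refine ((hasDerivAt_const x (Real.cos κ)).div d hc.ne').congr_deriv ?_
    simp only [one_mul]
    ring
  · have := (slow_contDiff 1).continuous
    refine ContinuousOn.div (by fun_prop) (by fun_prop) fun x hx => ?_
    exact pow_ne_zero 2 (starRadius_cos_pos h0 h1 hx).ne'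
  · have := starRadius_one_sub (κ := κ) 0
    simpa using this
  · simp

theorem starRadius_strictAntiOn (h0 : 0 < κ) (h1 : κ < Real.pi / 2) :
    StrictAntiOn (starRadius κ) (Set.Icc 0 (1 / 2)) := by
  intro x hx y hy hxy
  have s1 := slow_strictMono zero_le_one le_rfl hxy
  have s2 := (slow_strictMono zero_le_one le_rfl).monotone hy.2
  have s3 := (slow_strictMono zero_le_one le_rfl).monotone hx.1
  rw [slow_half] at s2
  rw [slow_zero] at s3
  have hc : 0 < Real.cos κ := Real.cos_pos_of_mem_Ioo ⟨by linarith, h1⟩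
  refine div_lt_div_of_pos_left hc (starRadius_cos_pos h0 h1 ⟨hx.1, by linarith [hx.2]⟩) ?_
  rw [← Real.cos_neg, ← Real.cos_neg (κ * (2 * slow 1 y - 1))]
  apply Real.cos_lt_cos_of_nonneg_of_le_pi <;> nlinarith

end

theorem cos_two_pi_strictAntiOn :
    StrictAntiOn (fun x => Real.cos (2 * Real.pi * x)) (Set.Icc 0 (1 / 2)) := by
  intro x hx y hy hxy
  have := Real.pi_pos
  exact Real.cos_lt_cos_of_nonneg_of_le_pi (by have := hx.1; positivity)
    (by nlinarith [hy.2]) (by nlinarith)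

/-- Both phases are reflected into `[0, 1 / 2]`, where `Q` is injective. -/
theorem eq_or_eq_one_sub_of_strictAntiOn {Q : ℝ → ℝ} (hQ : StrictAntiOn Q (Set.Icc 0 (1 / 2)))
    (hs : ∀ x, Q (1 - x) = Q x) {x y : ℝ} (hx : x ∈ Set.Icc (0 : ℝ) 1)
    (hy : y ∈ Set.Icc (0 : ℝ) 1) (h : Q x = Q y) : y = x ∨ y = 1 - x := by
  have key : ∀ x ∈ Set.Icc (0 : ℝ) 1, ∃ x' ∈ Set.Icc (0 : ℝ) (1 / 2),
      (x' = x ∨ x' = 1 - x) ∧ Q x' = Q x := by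
    intro x hx
    rcases le_total x (1 / 2) with h | h
    · exact ⟨x, ⟨hx.1, h⟩, .inl rfl, rfl⟩
    · exact ⟨1 - x, ⟨by linarith [hx.2], by linarith⟩, .inr rfl, hs x⟩
  obtain ⟨x', hx', ex, qx⟩ := key x hx
  obtain ⟨y', hy', ey, qy⟩ := key y hy
  have : x' = y' := hQ.injOn hx' hy' (by rw [qx, qy, h])
  rcases ex with ex | ex <;> rcases ey with ey | ey
  · left; linarith
  · right; linarith
  · right; linarith
  · left; linarith

/-! ### Double points of curves with the symmetry of a star polygon -/

section

variable {n k : ℕ}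

/-- At a double point with phases `x` and `1 - x`. -/
theorem crossing_phase (hk : 0 < k) (hn : 2 * k < n) {τ s t : ℝ} {b : ℤ}
    (hb : k * (slow τ (n * t) / n - slow τ (n * s) / n) = b)
    (hx : Int.fract (n * t) = 1 - Int.fract (n * s)) :
    2 * k * slow τ (Int.fract (n * s)) = (k * (⌊n * t⌋ - ⌊n * s⌋ + 1) - n * b : ℤ) := by
  have hn0 : (n : ℝ) ≠ 0 := by norm_cast; omega
  have e1 : slow τ (n * t) = 1 - slow τ (Int.fract (n * s)) + ⌊n * t⌋ := by
    rw [← slow_one_sub, ← hx, ← slow_add_int, Int.fract_add_floor]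
  have e2 : slow τ (n * s) = slow τ (Int.fract (n * s)) + ⌊n * s⌋ := by
    rw [← slow_add_int, Int.fract_add_floor]
  rw [e1, e2] at hb
  field_simp at hb
  push_cast
  linarith

/-- Equal phases force equal parameters modulo `1`, by coprimality. Mirror phases make `2 * k * slow
τ x` an integer strictly between `0` and `2 * k`, which keeps `x` at least `1 / (2 * k)` away from
the corners. The bound does not depend on `τ`, so one height can serve a whole deformation. -/
theorem crossing_or_eq (hk : 0 < k) (hn : 2 * k < n) (hc : n.Coprime k) {τ s t : ℝ} {b : ℤ}
    (h0 : 0 ≤ τ) (h1 : τ ≤ 1)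
    (hb : k * (slow τ (n * t) / n - slow τ (n * s) / n) = b)
    (hx : Int.fract (n * t) = Int.fract (n * s) ∨ Int.fract (n * t) = 1 - Int.fract (n * s)) :
    (∃ m : ℤ, s - t = m) ∨ (Int.fract (n * t) = 1 - Int.fract (n * s) ∧
      ¬ (n : ℤ) ∣ ⌊n * t⌋ - ⌊n * s⌋ ∧ Int.fract (n * s) ≠ 1 / 2 ∧
      1 ≤ 2 * k * Int.fract (n * s) ∧ 1 ≤ 2 * k * (1 - Int.fract (n * s))) := by
  have hnp : (0 : ℝ) < n := by norm_cast; omega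
  have hn0 := hnp.ne'
  have hkp : (0 : ℝ) < k := by exact_mod_cast hk
  have hkn : 2 * (k : ℝ) < n := by exact_mod_cast hn
  by_cases he : Int.fract (n * t) = Int.fract (n * s)
  · left
    have hts : n * t = n * s + (⌊n * t⌋ - ⌊n * s⌋ : ℤ) := by
      have a := Int.fract_add_floor (n * t)
      have b := Int.fract_add_floor (n * s)
      push_cast
      linarith
    rw [hts, slow_add_int] at hb
    set a : ℤ := ⌊n * t⌋ - ⌊n * s⌋
    have h2 : (k : ℝ) * a = n * b := by field_simp at hb; linarith
    have h3 : (n : ℤ) ∣ k * a := ⟨b, by exact_mod_cast h2⟩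
    obtain ⟨c, hc'⟩ := (Nat.isCoprime_iff_coprime.2 hc).dvd_of_dvd_mul_left h3
    refine ⟨-c, ?_⟩
    rw [hc'] at hts
    push_cast at hts ⊢
    have : n * (t - s - c) = 0 := by linarith
    have := (mul_eq_zero.1 this).resolve_left hn0
    linarith
  · right
    have hx := hx.resolve_left he
    have hp := crossing_phase hk hn hb hx
    have f0 := Int.fract_nonneg (n * s)
    have f1 := Int.fract_lt_one (n * s)
    have f2 := Int.fract_lt_one (n * t)
    have hpos : 0 < Int.fract (n * s) := by linarith
    set x := Int.fract (n * s)
    have mono := slow_strictMono h0 h1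
    have y0 := mono hpos
    have y1 := mono f1
    rw [slow_zero] at y0
    rw [slow_one] at y1
    have hhalf : x ≠ 1 / 2 := fun h => he (by rw [hx, h]; norm_num)
    set N : ℤ := k * (⌊n * t⌋ - ⌊n * s⌋ + 1) - n * b with hN
    have N0 : 0 < N := by
      have : (0 : ℝ) < N := by rw [← hp]; positivity
      exact_mod_cast this
    have N1 : N < 2 * k := by
      have : (N : ℝ) < 2 * k := by rw [← hp]; nlinarith
      exact_mod_cast this
    refine ⟨hx, ?_, hhalf, ?_, ?_⟩
    · rintro ⟨a, ha⟩
      rw [ha] at hN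
      have h3 : N - k = n * (k * a - b) := by rw [hN]; ring
      have h4 : k * a - b = 0 := by
        by_contra h5
        have h7 : |N - k| < n := abs_lt.2 ⟨by omega, by omega⟩
        rw [h3, abs_mul, Nat.abs_cast] at h7
        have h6 := Int.one_le_abs h5
        nlinarith
      rw [h4, mul_zero] at h3
      have h8 : (N : ℝ) = k := by exact_mod_cast (by omega : N = k)
      rw [h8] at hp
      have h9 : slow τ x = slow τ (1 / 2) := by
        rw [slow_half]
        have : (k : ℝ) * (2 * slow τ x - 1) = 0 := by linarith
        have := (mul_eq_zero.1 this).resolve_left hkp.ne'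
        linarith
      exact hhalf (mono.injective h9)
    · rcases le_total x (1 / 2) with h | h
      · have := slow_le h0 f0 h
        have N0' : (1 : ℝ) ≤ N := by exact_mod_cast N0
        nlinarith
      · have : (1 : ℝ) ≤ k := by exact_mod_cast hk
        nlinarith
    · rcases le_total x (1 / 2) with h | h
      · have : (1 : ℝ) ≤ k := by exact_mod_cast hk
        nlinarith
      · have := slow_le (x := 1 - x) h0 (by linarith) (by linarith)
        rw [slow_one_sub] at this
        have N1' : (N : ℝ) + 1 ≤ 2 * k := by exact_mod_cast N1
        nlinarith

/-- Heights that turn a star polygon with slow corners into a knot. -/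
structure IsStarHeight (n k : ℕ) (h : ℝ → ℝ) : Prop where
  contDiff : ContDiff ℝ 1 h
  add_one : ∀ s, h (s + 1) = h s
  deriv_ne : ∀ s : ℝ, ∀ m : ℤ, n * s = m → deriv h s ≠ 0
  crossing : ∀ s t : ℝ, Int.fract (n * t) = 1 - Int.fract (n * s) →
    ¬ (n : ℤ) ∣ ⌊n * t⌋ - ⌊n * s⌋ → Int.fract (n * s) ≠ 1 / 2 →
    1 ≤ 2 * k * Int.fract (n * s) → 1 ≤ 2 * k * (1 - Int.fract (n * s)) → h s ≠ h t

/-- The half angle that an edge of the star polygon `{n / k}` spans at the centre. -/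
def halfAngle (n k : ℕ) : ℝ := Real.pi * k / n

theorem halfAngle_pos (hk : 0 < k) (hn : 2 * k < n) : 0 < halfAngle n k := by
  have : (0 : ℝ) < n := by norm_cast; omega
  have : (0 : ℝ) < k := by exact_mod_cast hk
  unfold halfAngle; positivity

theorem halfAngle_lt (hn : 2 * k < n) : halfAngle n k < Real.pi / 2 := by
  have h1 : (0 : ℝ) < n := by norm_cast; omega
  have hkn : 2 * (k : ℝ) < n := by exact_mod_cast hn
  have := Real.pi_pos
  rw [halfAngle, div_lt_div_iff₀ h1 two_pos]; nlinarith

/-! ### Deforming the star polygon into the torus curve at fixed heights -/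

def starAngle (n : ℕ) (s : ℝ) : ℝ := slow 1 (n * s) / n

theorem starAngle_contDiff : ContDiff ℝ 1 (starAngle n) :=
  ((slow_contDiff 1).comp (contDiff_const.mul contDiff_id)).div_const _

theorem starAngle_add_one (hn : 0 < n) (s : ℝ) : starAngle n (s + 1) = starAngle n s + 1 := by
  have h1 : (n : ℝ) ≠ 0 := by norm_cast; omega
  have := slow_add_int 1 (n * s) n
  rw [starAngle, mul_add, mul_one]
  push_cast at this
  rw [this, add_div, div_self h1, starAngle]

theorem fract_mul_add_one (n : ℕ) (s : ℝ) : Int.fract (n * (s + 1)) = Int.fract (n * s) := by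
  rw [mul_add, mul_one, Int.fract_add_natCast]

theorem cos_mul_add_one (n : ℕ) (s : ℝ) :
    Real.cos (2 * Real.pi * (n * (s + 1))) = Real.cos (2 * Real.pi * (n * s)) := by
  have := cos_two_pi_add_int (n * s) n
  rw [mul_add, mul_one]; exact_mod_cast this

theorem sin_mul_add_one (n : ℕ) (s : ℝ) :
    Real.sin (2 * Real.pi * (n * (s + 1))) = Real.sin (2 * Real.pi * (n * s)) := by
  have := sin_two_pi_add_int (n * s) n
  rw [mul_add, mul_one]; exact_mod_cast this

theorem starRadius_comp_contDiff (hk : 0 < k) (hn : 2 * k < n) :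
    ContDiff ℝ 1 (fun s : ℝ => starRadius (halfAngle n k) (Int.fract (n * s))) :=
  (starRadius_contDiff (halfAngle_pos hk hn) (halfAngle_lt hn)).comp
    (contDiff_const.mul contDiff_id)

theorem cos_comp_contDiff (n : ℕ) :
    ContDiff ℝ 1 (fun s : ℝ => 2 + Real.cos (2 * Real.pi * (n * s))) :=
  contDiff_const.add (Real.contDiff_cos.comp
          (contDiff_const.mul (contDiff_const.mul contDiff_id)))

/-- The linear deformation of the angle stays in the family `slow τ`, with `τ = 1 - t`, so
`crossing_or_eq` applies at every time. -/
theorem starAngle_lerp (hn : 0 < n) (t s : ℝ) :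
    (1 - t) * starAngle n s + t * s = slow (1 - t) (n * s) / n := by
  have h1 : (n : ℝ) ≠ 0 := by norm_cast; omega
  simp only [starAngle, slow]
  field_simp
  ring

/-- A convex combination of the two radii is still symmetric and strictly decreasing on the first
half of an edge. Double points therefore remain mirror pairs, which `h` separates. -/
theorem IsStarHeight.isBraid (hk : 0 < k) (hn : 2 * k < n) (hc : n.Coprime k) {h : ℝ → ℝ}
    (H : IsStarHeight n k h) {t : ℝ} (t0 : 0 ≤ t) (t1 : t ≤ 1) :
    IsBraid k (fun s => (1 - t) * starAngle n s + t * s)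
      (fun s => (1 - t) * starRadius (halfAngle n k) (Int.fract (n * s)) +
        t * (2 + Real.cos (2 * Real.pi * (n * s)))) h where
  angle_add_one s := by rw [starAngle_add_one (by omega)]; ring
  radius_add_one s := by simp only [fract_mul_add_one, cos_mul_add_one]
  height_add_one := H.add_one
  radius_pos s := by
    have h1 := starRadius_pos (halfAngle_pos hk hn) (halfAngle_lt hn)
      ⟨Int.fract_nonneg (n * s), (Int.fract_lt_one _).le⟩
    have h2 : 0 < 2 + Real.cos (2 * Real.pi * (n * s)) := by
      linarith [Real.neg_one_le_cos (2 * Real.pi * (n * s))]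
    rcases t0.lt_or_eq with h | h
    · have := mul_pos h h2
      have := mul_nonneg (by linarith : 0 ≤ 1 - t) h1.le
      linarith
    · simp [← h, h1]
  regular s := by
    have hnp : (0 : ℝ) < n := by norm_cast; omega
    have d : HasDerivAt (fun s => (1 - t) * starAngle n s + t * s)
        (1 - (1 - t) * Real.cos (2 * Real.pi * (n * s))) s := by
      have h1 : HasDerivAt (fun s : ℝ => (n : ℝ) * s) n s := by
        simpa using (hasDerivAt_id s).const_mul (n : ℝ)
      have := ((slow_hasDerivAt (1 - t) (n * s)).comp s h1).div_const (n : ℝ)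
      refine (this.congr_deriv (by field_simp)).congr_of_eventuallyEq ?_
      exact Filter.Eventually.of_forall fun s => starAngle_lerp (by omega) t s
    rw [d.deriv]
    -- The angular velocity `1 - (1 - t) * cos` can vanish only at a corner and for `t = 0`; there
    -- the height is moving.
    by_contra! hcon
    have hcos := Real.cos_le_one (2 * Real.pi * (n * s))
    have hcos1 : Real.cos (2 * Real.pi * (n * s)) = 1 := by
      have h1 := mul_nonneg (by linarith : 0 ≤ 1 - t) (by linarith :
        0 ≤ 1 - Real.cos (2 * Real.pi * (n * s)))
      have h2 : t = 0 := by linarith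
      have h3 := hcon.1
      rw [h2] at h3
      linarith
    obtain ⟨m, hm⟩ := (Real.cos_eq_one_iff _).1 hcos1
    refine H.deriv_ne s m ?_ hcon.2
    have := Real.pi_pos
    have : 2 * Real.pi * (n * s - m) = 0 := by linarith
    have := (mul_eq_zero.1 this).resolve_left (by positivity)
    linarith
  embedded s s' b hb hρ hh := by
    simp only [starAngle_lerp (show 0 < n by omega)] at hb
    have hQ : StrictAntiOn (fun x => (1 - t) * starRadius (halfAngle n k) x +
        t * (2 + Real.cos (2 * Real.pi * x))) (Set.Icc 0 (1 / 2)) := by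
      intro x hx y hy hxy
      have a := starRadius_strictAntiOn (halfAngle_pos hk hn) (halfAngle_lt hn) hx hy hxy
      have b := cos_two_pi_strictAntiOn hx hy hxy
      simp only at b ⊢
      rcases t0.lt_or_eq with h | h
      · have := mul_lt_mul_of_pos_left b h
        have := mul_le_mul_of_nonneg_left a.le (by linarith : 0 ≤ 1 - t)
        linarith
      · simp [← h, a]
    have hx := eq_or_eq_one_sub_of_strictAntiOn hQ
      (fun x => by simp only [starRadius_one_sub, cos_two_pi_one_sub])
      ⟨Int.fract_nonneg (n * s), (Int.fract_lt_one _).le⟩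
      ⟨Int.fract_nonneg (n * s'), (Int.fract_lt_one _).le⟩
      (by simpa only [cos_two_pi_fract] using hρ)
    rcases crossing_or_eq hk hn hc (by linarith) (by linarith) hb hx with h | ⟨a1, a2, a3, a4, a5⟩
    · exact h
    · exact absurd hh (H.crossing s s' a1 a2 a3 a4 a5)

/-- The star polygon `{n / k}` with circumradius `1`, lifted to space. -/
def starKnot (hk : 0 < k) (hn : 2 * k < n) (hc : n.Coprime k) {h : ℝ → ℝ}
    (H : IsStarHeight n k h) : Knot :=
  braidKnot k hk (starAngle n) (fun s => starRadius (halfAngle n k) (Int.fract (n * s))) h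
    starAngle_contDiff (starRadius_comp_contDiff hk hn) H.contDiff
    (by simpa using H.isBraid hk hn hc le_rfl zero_le_one)

theorem starKnot_isotopic (hk : 0 < k) (hn : 2 * k < n) (hc : n.Coprime k) {h : ℝ → ℝ}
    (H : IsStarHeight n k h) {L : Knot}
    (hL : L.toFun = braidCurve k id (fun s => 2 + Real.cos (2 * Real.pi * (n * s))) h) :
    (starKnot hk hn hc H).Isotopic L := by
  refine Knot.isotopic_of_isBraid hk
    (starAngle_contDiff.c1Family_lerp contDiff_id)
    ((starRadius_comp_contDiff hk hn).c1Family_lerp (cos_comp_contDiff n))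
    H.contDiff.c1Family_const (fun t t0 t1 => H.isBraid hk hn hc t0 t1) ?_ ?_
  · simp [starKnot, braidKnot]
  · rw [hL]
    simp
    rfl

/-- Mirror phases have opposite sines, so equal heights would mean the excluded midpoint. -/
theorem isStarHeight_sin (hk : 0 < k) (hn : 2 * k < n) :
    IsStarHeight n k fun s => Real.sin (2 * Real.pi * (n * s)) where
  contDiff := Real.contDiff_sin.comp (contDiff_const.mul (contDiff_const.mul contDiff_id))
  add_one := sin_mul_add_one n
  deriv_ne s m hs := by
    have hp : HasDerivAt (fun s : ℝ => 2 * Real.pi * (n * s)) (2 * Real.pi * n) s := by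
      simpa using ((hasDerivAt_id s).const_mul (n : ℝ)).const_mul (2 * Real.pi)
    rw [hp.sin.deriv, hs, mul_comm (2 * Real.pi), Real.cos_int_mul_two_pi]
    have : (0 : ℝ) < n := by norm_cast; omega
    have := Real.pi_pos
    positivity
  crossing s t h1 _ h3 _ _ h := by
    rw [← sin_two_pi_fract, ← sin_two_pi_fract (n * t), h1, sin_two_pi_one_sub] at h
    have h2 : Real.sin (2 * Real.pi * Int.fract (n * s)) = 0 := by linarith
    obtain ⟨m, hm⟩ := Real.sin_eq_zero_iff.1 h2
    have f0 := Int.fract_lt_one (n * t)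
    have f1 := Int.fract_lt_one (n * s)
    have hpi := Real.pi_pos
    have : Real.pi * (m - 2 * Int.fract (n * s)) = 0 := by linarith
    have h4 := (mul_eq_zero.1 this).resolve_left hpi.ne'
    have m0 : (0 : ℝ) < m := by linarith
    have m1 : (m : ℝ) < 2 := by linarith
    have : m = 1 := by
      have m0' : 0 < m := by exact_mod_cast m0
      have m1' : m < 2 := by exact_mod_cast m1
      omega
    rw [this] at h4
    push_cast at h4
    exact h3 (by linarith)

theorem starKnot_isotopic_torusKnot (hk : 0 < k) (hn : 2 * k < n) (hc : n.Coprime k) :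
    (starKnot hk hn hc (isStarHeight_sin hk hn)).Isotopic (torusKnot n k hc) :=
  starKnot_isotopic hk hn hc _ rfl

end

/-! ### Interpolation between values at the integers -/

theorem hasDerivAt_bump {β : ℝ → ℝ} (hβ : ContDiff ℝ 1 β) (b0 : β 0 = 0) (b1 : β 1 = 0)
    (d0 : deriv β 0 = 0) (d1 : deriv β 1 = 0) (a : ℤ → ℝ) (s : ℝ) :
    HasDerivAt (fun s => a ⌊s⌋ * β (Int.fract s)) (a ⌊s⌋ * deriv β (Int.fract s)) s :=
  hasDerivAt_glue (F := fun m x => a m * β x) (F' := fun m x => a m * deriv β x)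
    (fun m x _ => (hβ.differentiable one_ne_zero x).hasDerivAt.const_mul _)
    (by simp [b0, b1]) (by simp [d0, d1]) s

/-- A `C¹` function with prescribed values at the integers. -/
def interp (a : ℤ → ℝ) (w : ℝ) : ℝ := a ⌊w⌋ + (a (⌊w⌋ + 1) - a ⌊w⌋) * slow 1 (Int.fract w)

theorem interp_hasDerivAt (a : ℤ → ℝ) (w : ℝ) : HasDerivAt (interp a)
    ((a (⌊w⌋ + 1) - a ⌊w⌋) * (1 - 1 * Real.cos (2 * Real.pi * Int.fract w))) w :=
  hasDerivAt_glue (F := fun m x => a m + (a (m + 1) - a m) * slow 1 x)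
    (F' := fun m x => (a (m + 1) - a m) * (1 - 1 * Real.cos (2 * Real.pi * x)))
    (fun m x _ => ((slow_hasDerivAt 1 x).const_mul _).const_add _)
    (by simp [slow_zero, slow_one]) (by simp) w

theorem interp_contDiff (a : ℤ → ℝ) : ContDiff ℝ 1 (interp a) :=
  contDiff_glue (F := fun m x => a m + (a (m + 1) - a m) * slow 1 x)
    (F' := fun m x => (a (m + 1) - a m) * (1 - 1 * Real.cos (2 * Real.pi * x)))
    (fun m x _ => ((slow_hasDerivAt 1 x).const_mul _).const_add _)
    (fun m => by fun_prop)
    (by simp [slow_zero, slow_one]) (by simp)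

theorem interp_intCast (a : ℤ → ℝ) (m : ℤ) : interp a m = a m := by
  simp [interp, slow_zero]

/-- Later estimates need only that the value lies between its two neighbouring grid values, whatever
the weight `u`. -/
theorem interp_lerp (a : ℤ → ℝ) (w : ℝ) : ∃ v u : ℝ, 0 ≤ v ∧ v < 1 ∧ 0 ≤ u ∧ u ≤ 1 ∧
    w = ⌊w⌋ + v ∧ interp a w = (1 - u) * a ⌊w⌋ + u * a (⌊w⌋ + 1) := by
  have f0 := Int.fract_nonneg w
  have f1 := Int.fract_lt_one w
  have := slow_mem_Icc zero_le_one le_rfl ⟨f0, f1.le⟩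
  exact ⟨_, _, f0, f1, this.1, this.2, (Int.floor_add_fract w).symm, by rw [interp]; ring⟩

theorem eq_of_cos_two_pi_eq {x y : ℝ}
    (h : Real.cos (2 * Real.pi * x) = Real.cos (2 * Real.pi * y)) :
    (∃ m : ℤ, x - y = m) ∨ ∃ m : ℤ, x + y = m := by
  have hpi := Real.pi_pos
  obtain ⟨m, hm | hm⟩ := Real.cos_eq_cos_iff.1 h
  · left
    refine ⟨-m, ?_⟩
    have : 2 * Real.pi * (y - m - x) = 0 := by linarith
    have := (mul_eq_zero.1 this).resolve_left (by positivity)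
    push_cast; linarith
  · right
    refine ⟨m, ?_⟩
    have : 2 * Real.pi * (y - m + x) = 0 := by linarith
    have := (mul_eq_zero.1 this).resolve_left (by positivity)
    linarith

/-! ### Heights ranked around a cut -/

/-- Rank of the edge number `m` of the star polygon `{n / k}`, counted by its starting point. -/
def cutRank (n k : ℕ) (m : ℤ) : ℤ := (k * m - 1) % n

theorem cutRank_add (n k : ℕ) (m : ℤ) : cutRank n k (m + n) = cutRank n k m := by
  unfold cutRank
  rw [show (k : ℤ) * (m + n) - 1 = k * m - 1 + n * k by ring, Int.add_mul_emod_self_left]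

theorem cutRank_injective {n k : ℕ} (hc : n.Coprime k) {m m' : ℤ}
    (h : cutRank n k m = cutRank n k m') : (n : ℤ) ∣ m' - m := by
  have := Int.ModEq.dvd h
  have h2 : (n : ℤ) ∣ k * (m' - m) := by
    convert this using 1; ring
  exact (Nat.isCoprime_iff_coprime.2 hc).dvd_of_dvd_mul_left h2

/-- On each edge the height is essentially the rank. -/
def cutHeight (n k : ℕ) (s : ℝ) : ℝ :=
  cutRank n k ⌊n * s⌋ * Real.sin (Real.pi * Int.fract (n * s)) ^ 2 +
    (8 * k : ℝ)⁻¹ * Real.sin (2 * Real.pi * (n * s))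

section

variable {n k : ℕ}

/-- At a mirror pair the rank terms share the factor `sin (π * x) ^ 2` and the perturbations are
opposite. The phase bounds give `sin (π * x) ≥ 1 / k`. After one factor `sin (π * x)` is split off,
the perturbation contributes at most `1 / (2 * k)`, so a rank difference of one decides. The
perturbation is there to make the height move at the corners. -/
theorem cutHeight_lt (hk : 0 < k) {s t : ℝ} (h1 : Int.fract (n * t) = 1 - Int.fract (n * s))
    (h2 : 1 ≤ 2 * k * Int.fract (n * s)) (h3 : 1 ≤ 2 * k * (1 - Int.fract (n * s)))
    (hr : cutRank n k ⌊n * t⌋ < cutRank n k ⌊n * s⌋) : cutHeight n k t < cutHeight n k s := by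
  have hkp : (0 : ℝ) < k := by exact_mod_cast hk
  have hpi := Real.pi_pos
  unfold cutHeight
  rw [← sin_two_pi_fract, ← sin_two_pi_fract (n * s), h1, sin_two_pi_one_sub,
    show Real.pi * (1 - Int.fract (n * s)) = Real.pi - Real.pi * Int.fract (n * s) by ring,
    Real.sin_pi_sub]
  have f1 := Int.fract_lt_one (n * s)
  have f0 := Int.fract_nonneg (n * s)
  set x := Int.fract (n * s)
  have hS : 1 / k ≤ Real.sin (Real.pi * x) := by
    have key : ∀ y : ℝ, 0 ≤ y → y ≤ 1 / 2 → 1 ≤ 2 * k * y → 1 / k ≤ Real.sin (Real.pi * y) := by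
      intro y h0 h1 h2
      have := Real.mul_le_sin (x := Real.pi * y) (by positivity) (by nlinarith)
      have e : 2 / Real.pi * (Real.pi * y) = 2 * y := by field_simp
      rw [e] at this
      refine le_trans ?_ this
      rw [div_le_iff₀ hkp]
      linarith
    rcases le_total x (1 / 2) with h | h
    · exact key x f0 h h2
    · have := key (1 - x) (by linarith) (by linarith) h3
      rwa [mul_sub, mul_one, Real.sin_pi_sub] at this
  have hC := Real.neg_one_le_cos (Real.pi * x)
  have hr' : (cutRank n k ⌊n * t⌋ : ℝ) + 1 ≤ cutRank n k ⌊n * s⌋ := by exact_mod_cast hr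
  rw [mul_assoc 2 Real.pi, Real.sin_two_mul]
  set S := Real.sin (Real.pi * x)
  set C := Real.cos (Real.pi * x)
  have hS0 : 0 < S := lt_of_lt_of_le (by positivity) hS
  have h5 : S * 1 ≤ S * (cutRank n k ⌊n * s⌋ - cutRank n k ⌊n * t⌋ : ℝ) :=
    mul_le_mul_of_nonneg_left (by linarith) hS0.le
  have h6 : -(1 / k : ℝ) * (1 / 2) ≤ 4 * (8 * k : ℝ)⁻¹ * C := by
    have : 4 * (8 * k : ℝ)⁻¹ * C = (1 / k) * (1 / 2) * C := by field_simp; ring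
    rw [this]
    have : 0 < (1 / k : ℝ) := by positivity
    nlinarith
  have h7 : 0 < (1 / k : ℝ) := by positivity
  have h8 : 0 < S * (S * (cutRank n k ⌊n * s⌋ - cutRank n k ⌊n * t⌋ : ℝ) +
      4 * (8 * k : ℝ)⁻¹ * C) := mul_pos hS0 (by linarith)
  nlinarith

theorem sin_sq_contDiff : ContDiff ℝ 1 fun x => Real.sin (Real.pi * x) ^ 2 :=
  (Real.contDiff_sin.comp (contDiff_const.mul contDiff_id)).pow 2

theorem sin_sq_deriv_intCast (m : ℤ) : deriv (fun x => Real.sin (Real.pi * x) ^ 2) m = 0 := by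
  have h1 : HasDerivAt (fun x => Real.pi * x) Real.pi (m : ℝ) := by
    simpa using (hasDerivAt_id (m : ℝ)).const_mul Real.pi
  have h2 : deriv (fun x => Real.sin (Real.pi * x) ^ 2) (m : ℝ) = _ := (h1.sin.pow 2).deriv
  rw [h2, mul_comm Real.pi (m : ℝ), Real.sin_int_mul_pi]
  simp

theorem cutHeight_isStarHeight (hk : 0 < k) (hn : 2 * k < n) (hc : n.Coprime k) :
    IsStarHeight n k (cutHeight n k) where
  contDiff := by
    have h1 := contDiff_bump sin_sq_contDiff (by simp) (by simp)
      (by simpa using sin_sq_deriv_intCast 0) (by simpa using sin_sq_deriv_intCast 1)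
      (fun m => cutRank n k m)
    exact (h1.comp (contDiff_const.mul contDiff_id)).add
      (contDiff_const.mul (isStarHeight_sin hk hn).contDiff)
  add_one s := by
    have : ⌊n * (s + 1)⌋ = ⌊n * s⌋ + n := by rw [mul_add, mul_one, Int.floor_add_natCast]
    simp only [cutHeight, fract_mul_add_one, sin_mul_add_one, this, cutRank_add]
  deriv_ne s m hs := by
    have h1 := hasDerivAt_bump sin_sq_contDiff (by simp) (by simp)
      (by simpa using sin_sq_deriv_intCast 0) (by simpa using sin_sq_deriv_intCast 1)
      (fun m => cutRank n k m) (n * s)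
    have h2 : HasDerivAt (fun s : ℝ => (n : ℝ) * s) n s := by
      simpa using (hasDerivAt_id s).const_mul (n : ℝ)
    have h3 := h1.comp s h2
    have hd := (isStarHeight_sin hk hn).contDiff.differentiable one_ne_zero s
    have h4 := h3.add (hd.hasDerivAt.const_mul (8 * k : ℝ)⁻¹)
    have h5 : deriv (cutHeight n k) s = _ := h4.deriv
    rw [h5, hs, Int.fract_intCast]
    have h6 := sin_sq_deriv_intCast 0
    rw [Int.cast_zero] at h6
    rw [h6, mul_zero, zero_mul, zero_add]
    exact mul_ne_zero (by positivity) ((isStarHeight_sin hk hn).deriv_ne s m hs)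
  crossing s t h1 h2 h3 h4 h5 := by
    rcases lt_trichotomy (cutRank n k ⌊n * t⌋) (cutRank n k ⌊n * s⌋) with h | h | h
    · exact (cutHeight_lt hk h1 h4 h5 h).ne'
    · exact absurd (cutRank_injective hc h.symm) h2
    · refine (cutHeight_lt hk (s := t) (t := s) (by rw [h1]; ring) ?_ ?_ h).ne
      · rw [h1]; exact h5
      · rw [h1]; linarith

end

/-! ### Twisting half way around -/

/-- When the angle is linear, the points over one half plane are the strands `s = (θ + i) / k`
modulo `1` with a common `θ`, so only pairs of strands need to be compared. -/
theorem isBraid_id {k : ℕ} (hk : 0 < k) {ρ h : ℝ → ℝ} (hρ : ∀ s, ρ (s + 1) = ρ s)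
    (hh : ∀ s, h (s + 1) = h s) (pos : ∀ s, 0 < ρ s)
    (emb : ∀ θ : ℝ, 0 ≤ θ → θ < 1 → ∀ i i' : ℕ, i < i' → i' < k →
      ρ ((θ + i) / k) = ρ ((θ + i') / k) → h ((θ + i) / k) ≠ h ((θ + i') / k)) :
    IsBraid k id ρ h where
  angle_add_one s := rfl
  radius_add_one := hρ
  height_add_one := hh
  radius_pos := pos
  regular s := .inl (by simp)
  embedded s t b hb e1 e2 := by
    have hkp : (0 : ℝ) < k := by exact_mod_cast hk
    have red : ∀ s : ℝ, ∃ i : ℕ, i < k ∧ ∃ m : ℤ, s = (Int.fract (k * s) + i) / k + m := by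
      intro s
      have hk' : (0 : ℤ) < k := by exact_mod_cast hk
      have e0 := Int.emod_nonneg ⌊k * s⌋ hk'.ne'
      have e1 := Int.emod_lt_of_pos ⌊k * s⌋ hk'
      have e2 := Int.emod_add_mul_ediv ⌊k * s⌋ k
      obtain ⟨i, hi⟩ := Int.eq_ofNat_of_zero_le e0
      refine ⟨i, by omega, ⌊k * s⌋ / k, ?_⟩
      have e3 := Int.fract_add_floor (k * s)
      rw [hi] at e2
      have e4 : ((i : ℝ) + k * (⌊k * s⌋ / k : ℤ)) = ⌊k * s⌋ := by exact_mod_cast e2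
      have e5 : k * (s - (⌊k * s⌋ / k : ℤ)) = Int.fract (k * s) + i := by linarith
      rw [← e5, mul_div_cancel_left₀ _ hkp.ne']
      ring
    have per : ∀ {f : ℝ → ℝ}, (∀ s, f (s + 1) = f s) → ∀ s, ∀ m : ℤ, f (s + m) = f s := by
      intro f hf s m
      have : Function.Periodic f 1 := hf
      simpa using this.int_mul m s
    obtain ⟨i, hi, m, hs⟩ := red s
    obtain ⟨i', hi', m', ht⟩ := red t
    have hθ : Int.fract (k * t) = Int.fract (k * s) := by
      simp only [id] at hb
      rw [show k * t = k * s + b by linarith, Int.fract_add_intCast]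
    rw [hθ] at ht
    have f0 := Int.fract_nonneg (k * s)
    have f1 := Int.fract_lt_one (k * s)
    set θ := Int.fract (k * s)
    rw [hs, ht, per hρ, per hρ] at e1
    rw [hs, ht, per hh, per hh] at e2
    rcases lt_trichotomy i i' with h | h | h
    · exact absurd e2 (emb θ f0 f1 i i' h hi' e1)
    · exact ⟨m - m', by rw [hs, ht, h]; push_cast; ring⟩
    · exact absurd e2.symm (emb θ f0 f1 i' i h hi e1.symm)

/-- Number of half steps by which the twist has been taken back, at the grid point `J`. -/
def backSeq (k : ℕ) (J : ℤ) : ℝ :=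
  (J / (2 * (2 * k + 1)) : ℤ) +
    max 0 (min (k : ℝ) ((((J % (2 * (2 * k + 1)) : ℤ) : ℝ) - 1) / 2)) / k

/-- One full turn is taken back between the grid points `1` and `2 * k + 1`, at a pace that keeps
`(2 * k + 1) * θ - k * backTwist k θ` in `[0, 1)` meanwhile. -/
def backTwist (k : ℕ) (θ : ℝ) : ℝ := interp (backSeq k) (2 * (2 * k + 1) * θ)

/-- The indices `1` to `2 * k + 1` span the range in which `backTwist` changes; the cells on either
side are ramps on which the twist is constant. -/
def shuffleSeq (k : ℕ) (J : ℤ) : ℝ := if 1 ≤ J ∧ J ≤ 2 * k + 1 then 1 else 0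

/-- Cut-off function, equal to `1` where the strands are stacked by their number. -/
def shuffle (k : ℕ) (θ : ℝ) : ℝ := interp (shuffleSeq k) (2 * (2 * k + 1) * θ)

/-- The phase, with part of the twist taken back. -/
def phase (k : ℕ) (s : ℝ) : ℝ := (2 * k + 1) * s - backTwist k (k * s)

/-- Where the cut-off is `1` the strands are stacked with number `0` on top; where it is `0` the
height is that of a torus curve. -/
def shuffleHeight (k : ℕ) (s : ℝ) : ℝ :=
  (1 - shuffle k (Int.fract (k * s))) * Real.sin (2 * Real.pi * phase k s) -
    (⌊k * s⌋ % k : ℤ) * shuffle k (Int.fract (k * s))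

section

variable {k : ℕ}

theorem backTwist_contDiff : ContDiff ℝ 1 (backTwist k) :=
  (interp_contDiff _).comp (contDiff_const.mul contDiff_id)

theorem backTwist_add_int (θ : ℝ) (m : ℤ) : backTwist k (θ + m) = backTwist k θ + m := by
  have h1 : ∀ J : ℤ, backSeq k (J + m * (2 * (2 * k + 1))) = backSeq k J + m := by
    intro J
    unfold backSeq
    rw [Int.add_mul_ediv_right _ _ (by omega), Int.add_mul_emod_self_right]
    push_cast; ring
  have h2 : (2 * (2 * k + 1) * (θ + m) : ℝ) =
      2 * (2 * k + 1) * θ + (m * (2 * (2 * k + 1)) : ℤ) := by push_cast; ring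
  unfold backTwist interp
  rw [h2, Int.floor_add_intCast, Int.fract_add_intCast, add_right_comm, h1, h1]
  ring

theorem phase_contDiff : ContDiff ℝ 1 (phase k) :=
  (contDiff_const.mul contDiff_id).sub (backTwist_contDiff.comp (contDiff_const.mul contDiff_id))

theorem phase_add_one (s : ℝ) : phase k (s + 1) = phase k s + (k + 1 : ℤ) := by
  have := backTwist_add_int (k := k) (k * s) k
  unfold phase
  rw [mul_add (k : ℝ), mul_one]
  push_cast at this ⊢
  rw [this]; ring

theorem shuffle_contDiff : ContDiff ℝ 1 (shuffle k) :=
  (interp_contDiff _).comp (contDiff_const.mul contDiff_id)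

theorem shuffle_deriv (m : ℤ) : deriv (shuffle k) m = 0 := by
  have h2 : HasDerivAt (fun s : ℝ => (2 * (2 * k + 1) : ℝ) * s) (2 * (2 * k + 1)) m := by
    simpa using (hasDerivAt_id (m : ℝ)).const_mul (2 * (2 * k + 1) : ℝ)
  have h1 := (interp_hasDerivAt (shuffleSeq k) (2 * (2 * k + 1) * m)).comp (m : ℝ) h2
  have h3 : (2 * (2 * k + 1) * m : ℝ) = (2 * (2 * k + 1) * m : ℤ) := by push_cast; ring
  have h4 : deriv (shuffle k) m = _ := h1.deriv
  rw [h4, h3, Int.fract_intCast]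
  simp

theorem shuffle_zero : shuffle k 0 = 0 := by
  have := interp_intCast (shuffleSeq k) 0
  rw [Int.cast_zero] at this
  rw [shuffle, mul_zero, this]
  simp [shuffleSeq]

theorem shuffle_one : shuffle k 1 = 0 := by
  have := interp_intCast (shuffleSeq k) (2 * (2 * k + 1))
  push_cast at this
  rw [shuffle, mul_one, this, shuffleSeq, if_neg (by omega)]

/-- The strand number jumps when `k * s` is an integer, but the cut-off and its derivative vanish
there. -/
theorem shuffleHeight_contDiff : ContDiff ℝ 1 (shuffleHeight k) := by
  have d0 : deriv (shuffle k) 0 = 0 := by simpa using shuffle_deriv (k := k) 0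
  have d1 : deriv (shuffle k) 1 = 0 := by simpa using shuffle_deriv (k := k) 1
  have hk : ContDiff ℝ 1 fun s : ℝ => (k : ℝ) * s := contDiff_const.mul contDiff_id
  have b1 := (contDiff_bump shuffle_contDiff shuffle_zero shuffle_one d0 d1 fun _ => 1).comp hk
  have b2 := (contDiff_bump shuffle_contDiff shuffle_zero shuffle_one d0 d1
    fun m => (m % k : ℤ)).comp hk
  simp only [Function.comp_def, one_mul] at b1 b2
  exact ((contDiff_const.sub b1).mul (Real.contDiff_sin.comp
    (contDiff_const.mul phase_contDiff))).sub b2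

theorem shuffleHeight_add_one (s : ℝ) : shuffleHeight k (s + 1) = shuffleHeight k s := by
  unfold shuffleHeight
  rw [phase_add_one, sin_two_pi_add_int, mul_add, mul_one, Int.fract_add_natCast,
    Int.floor_add_natCast, Int.add_emod_right]

/-- The formula remains valid at the right end of the period, where the quotient is `1` and the
remainder `0`. -/
theorem backSeq_eq (hk : 0 < k) {J : ℤ} (h0 : 0 ≤ J) (h1 : J ≤ 2 * (2 * k + 1)) :
    backSeq k J = max 0 (min (k : ℝ) (((J : ℝ) - 1) / 2)) / k := by
  have hkp : (0 : ℝ) < k := by exact_mod_cast hk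
  unfold backSeq
  rcases h1.lt_or_eq with h | h
  · rw [Int.ediv_eq_zero_of_lt h0 h, Int.emod_eq_of_lt h0 h]; simp
  · rw [h, Int.ediv_self (by omega), Int.emod_self]
    have h2 : min (k : ℝ) ((((0 : ℤ) : ℝ) - 1) / 2) ≤ 0 := (min_le_right _ _).trans (by norm_num)
    have h3 : min (k : ℝ) ((((2 * (2 * k + 1) : ℤ) : ℝ) - 1) / 2) = k := by
      apply min_eq_left; push_cast; linarith
    rw [max_eq_left h2, h3, max_eq_right hkp.le, zero_div, div_self hkp.ne']
    norm_num

/-- Three ranges of the angle: the ramps (cells `0` and `2 * k + 1`), where the twist is an integer;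
the cells `1` to `2 * k`, where the twist changes under a cut-off equal to `1`; and the rest, where
the twist is complete and the height is that of the torus. In the first two the common phase offset
lies in `[0, 1)`, so the strand numbers order the phases. -/
theorem twist_cases (hk : 0 < k) {θ : ℝ} (h0 : 0 ≤ θ) (h1 : θ < 1) :
    ((2 * k + 1) * θ < k + 1 ∧ ∃ e : ℤ, backTwist k θ = e ∧ 0 ≤ (2 * k + 1) * θ - k * e ∧
      (2 * k + 1) * θ - k * e < 1 ∧ 0 ≤ shuffle k θ ∧ shuffle k θ ≤ 1) ∨
    ((2 * k + 1) * θ < k + 1 ∧ 0 ≤ (2 * k + 1) * θ - k * backTwist k θ ∧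
      (2 * k + 1) * θ - k * backTwist k θ < 1 ∧ shuffle k θ = 1) ∨
    (k + 1 ≤ (2 * k + 1) * θ ∧ backTwist k θ = 1 ∧ shuffle k θ = 0) := by
  have hkp : (0 : ℝ) < k := by exact_mod_cast hk
  obtain ⟨v, u, v0, v1, u0, u1, hw, hb⟩ := interp_lerp (backSeq k) (2 * (2 * k + 1) * θ)
  obtain ⟨v', u', v0', v1', u0', u1', hw', hs⟩ := interp_lerp (shuffleSeq k) (2 * (2 * k + 1) * θ)
  rw [← backTwist] at hb
  rw [← shuffle] at hs
  have j0 : 0 ≤ ⌊(2 * (2 * k + 1) * θ : ℝ)⌋ := Int.floor_nonneg.2 (by positivity)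
  have j1 : ⌊(2 * (2 * k + 1) * θ : ℝ)⌋ < 2 * (2 * k + 1) := by
    rw [Int.floor_lt]; push_cast; nlinarith
  set j := ⌊(2 * (2 * k + 1) * θ : ℝ)⌋
  rw [backSeq_eq hk j0 j1.le, backSeq_eq hk (by omega) (by omega)] at hb
  push_cast at hb
  have shift : ((j : ℝ) + 1 - 1) / 2 = j / 2 := by ring
  rw [shift] at hb
  rcases (show j = 0 ∨ (1 ≤ j ∧ j ≤ 2 * k) ∨ j = 2 * k + 1 ∨ 2 * k + 2 ≤ j by omega) with
    h | ⟨h, h'⟩ | h | h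
  · left
    rw [h] at hb hs hw
    push_cast at hb hw
    rw [show ((0 : ℝ) - 1) / 2 = -(1 / 2) by norm_num, min_eq_right (by linarith),
      max_eq_left (by norm_num), zero_div, zero_div, min_eq_right hkp.le, max_eq_left le_rfl,
      zero_div] at hb
    refine ⟨by linarith, 0, by rw [hb]; simp, by push_cast; linarith, by push_cast; linarith, ?_⟩
    rw [hs]
    simp [shuffleSeq, u0', u1']
  · right; left
    have hj : (1 : ℝ) ≤ j := by exact_mod_cast h
    have hj' : (j : ℝ) ≤ 2 * k := by exact_mod_cast h'
    rw [min_eq_right (by linarith), max_eq_right (by linarith), min_eq_right (by linarith),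
      max_eq_right (by linarith)] at hb
    have hb' : k * backTwist k θ = (1 - u) * ((j - 1) / 2) + u * (j / 2) := by
      rw [hb]; field_simp
    refine ⟨by linarith, ?_, ?_, ?_⟩
    · rw [hb']; linarith
    · rw [hb']; linarith
    · rw [hs, shuffleSeq, shuffleSeq, if_pos ⟨h, by omega⟩, if_pos ⟨by omega, by omega⟩]; ring
  · left
    have hj : (j : ℝ) = 2 * k + 1 := by exact_mod_cast h
    rw [min_eq_left (by linarith), max_eq_right (by linarith), min_eq_left (by linarith),
      max_eq_right (by linarith), div_self hkp.ne'] at hb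
    refine ⟨by linarith, 1, by rw [hb]; simp, by push_cast; linarith, by push_cast; linarith, ?_⟩
    rw [hs, shuffleSeq, shuffleSeq, if_pos ⟨by omega, by omega⟩, if_neg (by omega)]
    constructor <;> linarith
  · right; right
    have hj : 2 * (k : ℝ) + 2 ≤ j := by exact_mod_cast h
    rw [min_eq_left (by linarith), max_eq_right (by linarith), min_eq_left (by linarith),
      max_eq_right (by linarith), div_self hkp.ne'] at hb
    refine ⟨by linarith, by rw [hb]; ring, ?_⟩
    rw [hs, shuffleSeq, shuffleSeq, if_neg (by omega), if_neg (by omega)]; ring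

/-! ### The strands over a common angle -/

variable {θ : ℝ} {i : ℕ}

theorem strand_mul (hk : 0 < k) : (k : ℝ) * ((θ + i) / k) = θ + i := by
  have hkp : (0 : ℝ) < k := by exact_mod_cast hk
  field_simp

theorem strand_fract (hk : 0 < k) (h0 : 0 ≤ θ) (h1 : θ < 1) :
    Int.fract (k * ((θ + i) / k)) = θ := by
  rw [strand_mul hk, Int.fract_add_natCast]
  exact Int.fract_eq_self.2 ⟨h0, h1⟩

theorem strand_floor (hk : 0 < k) (h0 : 0 ≤ θ) (h1 : θ < 1) :
    ⌊k * ((θ + i) / k)⌋ = i := by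
  rw [strand_mul hk, Int.floor_add_natCast, Int.floor_eq_zero_iff.2 ⟨h0, h1⟩, zero_add]

theorem strand_full (hk : 0 < k) :
    (2 * k + 1) * ((θ + i) / k) = (2 * i : ℤ) + ((2 * k + 1) * θ + i) / k := by
  have hkp : (0 : ℝ) < k := by exact_mod_cast hk
  field_simp
  push_cast
  ring

/-- Modulo `1` the phases of the strands are `k` equally spaced points with a common offset. -/
theorem strand_phase (hk : 0 < k) :
    phase k ((θ + i) / k) = ((2 * k + 1) * θ - k * backTwist k θ + i) / k + (i : ℤ) := by
  have hkp : (0 : ℝ) < k := by exact_mod_cast hk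
  unfold phase
  have := backTwist_add_int (k := k) θ i
  rw [strand_mul hk]
  push_cast at this ⊢
  rw [this]
  field_simp
  ring

theorem strand_shuffleHeight (hk : 0 < k) (h0 : 0 ≤ θ) (h1 : θ < 1) (hi : i < k) :
    shuffleHeight k ((θ + i) / k) =
      (1 - shuffle k θ) * Real.sin (2 * Real.pi * phase k ((θ + i) / k)) - i * shuffle k θ := by
  unfold shuffleHeight
  rw [strand_fract hk h0 h1, strand_floor hk h0 h1, Int.emod_eq_of_lt (by omega) (by omega)]
  push_cast; ring

/-- The sum can only be `1`, so the smaller phase lies on the upper half of the circle. -/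
theorem sin_lt_of_cos_eq {y y' : ℝ} (h0 : 0 ≤ y) (h1 : y < y') (h2 : y' < 1) {m : ℤ}
    (h : y + y' = m) : Real.sin (2 * Real.pi * y') < Real.sin (2 * Real.pi * y) := by
  have m0 : (0 : ℝ) < m := by linarith
  have m1 : (m : ℝ) < 2 := by linarith
  have hm : m = 1 := by
    have m0' : 0 < m := by exact_mod_cast m0
    have m1' : m < 2 := by exact_mod_cast m1
    omega
  rw [hm] at h
  push_cast at h
  have e : y' = 1 - y := by linarith
  have hpi := Real.pi_pos
  have : 0 < y := by linarith
  have := Real.sin_pos_of_pos_of_lt_pi (x := 2 * Real.pi * y) (by positivity) (by nlinarith)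
  rw [e, sin_two_pi_one_sub]
  linarith

theorem not_int_div (hk : 0 < k) {i i' : ℕ} (h1 : i < i') (h2 : i' < k) (m : ℤ) :
    ((i' : ℝ) - i) / k ≠ m := by
  intro h
  have hkp : (0 : ℝ) < k := by exact_mod_cast hk
  have h1' : (i : ℝ) < i' := by exact_mod_cast h1
  have h2' : (i' : ℝ) < k := by exact_mod_cast h2
  have hi : (0 : ℝ) ≤ i := by positivity
  have m0 : (0 : ℝ) < m := by rw [← h]; exact div_pos (by linarith) hkp
  have m1 : (m : ℝ) < 1 := by rw [← h, div_lt_one hkp]; linarith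
  have m0' : 0 < m := by exact_mod_cast m0
  have m1' : m < 1 := by exact_mod_cast m1
  omega

theorem phase_sum {i' : ℕ} (hk : 0 < k) (h1 : i < i') (h2 : i' < k)
    (h : Real.cos (2 * Real.pi * phase k ((θ + i) / k)) =
      Real.cos (2 * Real.pi * phase k ((θ + i') / k))) :
    ∃ m : ℤ, ((2 * k + 1) * θ - k * backTwist k θ + i) / k +
      ((2 * k + 1) * θ - k * backTwist k θ + i') / k = m := by
  rw [strand_phase hk, strand_phase hk, cos_two_pi_add_int, cos_two_pi_add_int] at h
  refine (eq_of_cos_two_pi_eq h).resolve_left ?_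
  rintro ⟨m, hm⟩
  refine not_int_div hk h1 h2 (-m) ?_
  push_cast
  rw [← hm]; ring

/-- With the offset in `[0, 1)` all phases lie in `[0, 1)` in the order of the strand numbers. At a
crossing the torus order is then the stacking order. -/
theorem phase_sin_lt {i' : ℕ} (hk : 0 < k) (h1 : i < i') (h2 : i' < k)
    (d0 : 0 ≤ (2 * k + 1) * θ - k * backTwist k θ) (d1 : (2 * k + 1) * θ - k * backTwist k θ < 1)
    (h : Real.cos (2 * Real.pi * phase k ((θ + i) / k)) =
      Real.cos (2 * Real.pi * phase k ((θ + i') / k))) :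
    Real.sin (2 * Real.pi * phase k ((θ + i') / k)) <
      Real.sin (2 * Real.pi * phase k ((θ + i) / k)) := by
  obtain ⟨m, hm⟩ := phase_sum hk h1 h2 h
  rw [strand_phase hk, strand_phase hk, sin_two_pi_add_int, sin_two_pi_add_int]
  have hkp : (0 : ℝ) < k := by exact_mod_cast hk
  have h1' : (i : ℝ) < i' := by exact_mod_cast h1
  have h2' : (i' : ℝ) + 1 ≤ k := by exact_mod_cast h2
  refine sin_lt_of_cos_eq (by positivity) (by gcongr) ?_ hm
  rw [div_lt_one hkp]; linarith

/-- Whole turns are invisible modulo `1`: when the twist is an integer, the radii before and after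
twisting agree. -/
theorem cos_phase_of_int {e : ℤ} (hk : 0 < k) (he : backTwist k θ = e) :
    Real.cos (2 * Real.pi * phase k ((θ + i) / k)) =
      Real.cos (2 * Real.pi * ((2 * k + 1) * ((θ + i) / k))) := by
  have hkp : (0 : ℝ) < k := by exact_mod_cast hk
  rw [strand_phase hk, strand_full hk, cos_two_pi_add_int, he, add_comm ((2 * i : ℤ) : ℝ),
    cos_two_pi_add_int, ← cos_two_pi_add_int _ e]
  congr 2
  field_simp
  ring

/-- Order of the heights of two strands at a double point of the twisted curve. -/
theorem shuffleHeight_lt_of_phase {i' : ℕ} (hk : 0 < k) (h0 : 0 ≤ θ) (h1 : θ < 1) (hi : i < i')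
    (hi' : i' < k) (hθ : (2 * k + 1) * θ < k + 1)
    (h : Real.cos (2 * Real.pi * phase k ((θ + i) / k)) =
      Real.cos (2 * Real.pi * phase k ((θ + i') / k))) :
    shuffleHeight k ((θ + i') / k) < shuffleHeight k ((θ + i) / k) ∧
      Real.sin (2 * Real.pi * phase k ((θ + i') / k)) <
      Real.sin (2 * Real.pi * phase k ((θ + i) / k)) := by
  rw [strand_shuffleHeight hk h0 h1 hi', strand_shuffleHeight hk h0 h1 (hi.trans hi')]
  have hii : (i : ℝ) < i' := by exact_mod_cast hi
  rcases twist_cases hk h0 h1 with ⟨-, e, he, d0, d1, s0, s1⟩ | ⟨-, d0, d1, s⟩ | ⟨h, -, -⟩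
  · rw [← he] at d0 d1
    have := phase_sin_lt hk hi hi' d0 d1 h
    refine ⟨?_, this⟩
    rcases s0.lt_or_eq with h | h
    · have a := mul_lt_mul_of_pos_right hii h
      have b := mul_le_mul_of_nonneg_left this.le (by linarith : 0 ≤ 1 - shuffle k θ)
      linarith
    · rw [← h]; linarith
  · refine ⟨?_, phase_sin_lt hk hi hi' d0 d1 h⟩
    rw [s]; linarith
  · linarith

/-- The crossings meant here are those of the untwisted radius. Where the twist is an integer they
are also those of the twisted one; elsewhere the strand number alone decides. -/
theorem shuffleHeight_lt {i' : ℕ} (hk : 0 < k) (h0 : 0 ≤ θ) (h1 : θ < 1) (hi : i < i')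
    (hi' : i' < k) (hθ : (2 * k + 1) * θ < k + 1)
    (h : Real.cos (2 * Real.pi * ((2 * k + 1) * ((θ + i) / k))) =
      Real.cos (2 * Real.pi * ((2 * k + 1) * ((θ + i') / k)))) :
    shuffleHeight k ((θ + i') / k) < shuffleHeight k ((θ + i) / k) := by
  rcases twist_cases hk h0 h1 with ⟨-, e, he, d0, d1, s0, s1⟩ | ⟨-, d0, d1, s⟩ | ⟨h, -, -⟩
  · exact (shuffleHeight_lt_of_phase hk h0 h1 hi hi' hθ
      (by rwa [cos_phase_of_int hk he, cos_phase_of_int hk he])).1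
  · rw [strand_shuffleHeight hk h0 h1 hi', strand_shuffleHeight hk h0 h1 (hi.trans hi'), s]
    have hii : (i : ℝ) < i' := by exact_mod_cast hi
    linarith
  · linarith

/-- The rank of an edge in terms of angle and strand. -/
theorem cutRank_strand (hk : 0 < k) {c : ℤ}
    (hc : (c : ℝ) * k ≤ (2 * k + 1) * θ + i) (hc' : (2 * k + 1) * θ + i < (c + 1) * k) :
    ⌊(2 * k + 1) * ((θ + i) / k)⌋ = 2 * i + c ∧
    Int.fract ((2 * k + 1) * ((θ + i) / k)) = ((2 * k + 1) * θ + i) / k - c ∧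
    cutRank (2 * k + 1) k (2 * i + c) = (k * c - i - 1) % (2 * k + 1) := by
  have hkp : (0 : ℝ) < k := by exact_mod_cast hk
  have f : ⌊((2 * k + 1) * θ + i) / k⌋ = c := by
    rw [Int.floor_eq_iff, le_div_iff₀ hkp, div_lt_iff₀ hkp]
    exact ⟨hc, hc'⟩
  refine ⟨?_, ?_, ?_⟩
  · rw [strand_full hk, Int.floor_intCast_add, f]
  · rw [strand_full hk, Int.fract_intCast_add, Int.fract, f]
  · unfold cutRank
    push_cast
    rw [show (k : ℤ) * (2 * i + c) - 1 = k * c - i - 1 + (2 * k + 1) * i by ring,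
      Int.add_mul_emod_self_left]

/-- The crossings of the ranked star polygon are those of the shuffled braid. -/
theorem cutRank_order {i' : ℕ} (hk : 0 < k) (h0 : 0 ≤ θ) (h1 : θ < 1) (hi : i < i')
    (hi' : i' < k)
    (h : Real.cos (2 * Real.pi * ((2 * k + 1) * ((θ + i) / k))) =
      Real.cos (2 * Real.pi * ((2 * k + 1) * ((θ + i') / k))))
    (hx : Int.fract ((2 * k + 1) * ((θ + i') / k)) = 1 - Int.fract ((2 * k + 1) * ((θ + i) / k)))
    (hx' : Int.fract ((2 * k + 1) * ((θ + i) / k)) ≠ 1 / 2) :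
    (cutRank (2 * k + 1) k ⌊(2 * k + 1) * ((θ + i') / k)⌋ <
        cutRank (2 * k + 1) k ⌊(2 * k + 1) * ((θ + i) / k)⌋ ∧
      shuffleHeight k ((θ + i') / k) < shuffleHeight k ((θ + i) / k)) ∨
    (cutRank (2 * k + 1) k ⌊(2 * k + 1) * ((θ + i) / k)⌋ <
        cutRank (2 * k + 1) k ⌊(2 * k + 1) * ((θ + i') / k)⌋ ∧
      shuffleHeight k ((θ + i) / k) < shuffleHeight k ((θ + i') / k)) := by
  have hkp : (0 : ℝ) < k := by exact_mod_cast hk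
  have hii : (i : ℝ) + 1 ≤ i' := by exact_mod_cast hi
  have hik : (i' : ℝ) + 1 ≤ k := by exact_mod_cast hi'
  have hi0 : (0 : ℝ) ≤ i := by positivity
  have hn : 0 ≤ (2 * k + 1) * θ := by positivity
  have hn' : (2 * k + 1) * θ < 2 * k + 1 := by nlinarith
  rcases lt_or_ge ((2 * k + 1) * θ) (k + 1) with hθ | hθ
  · left
    refine ⟨?_, shuffleHeight_lt hk h0 h1 hi hi' hθ h⟩
    -- Before the threshold the ranks are `2 * k - i` for the strands with smaller numbers and `k -
    -- i - 1` for the others. Altogether they decrease with `i`, as in the stack.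
    have rk : ∀ i : ℕ, i < k → (2 * k + 1) * θ + i < k →
        cutRank (2 * k + 1) k ⌊(2 * k + 1) * ((θ + i) / k)⌋ = 2 * k - i := by
      intro i hi h
      obtain ⟨a, -, b⟩ := cutRank_strand (θ := θ) (c := 0) hk
        (by push_cast; linarith [(by positivity : (0 : ℝ) ≤ i)])
        (by push_cast; linarith)
      rw [a, b, show (k : ℤ) * 0 - i - 1 = 2 * k - i + (2 * k + 1) * (-1) by ring,
        Int.add_mul_emod_self_left, Int.emod_eq_of_lt (by omega) (by omega)]
    have rk' : ∀ i : ℕ, i < k → (k : ℝ) ≤ (2 * k + 1) * θ + i →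
        cutRank (2 * k + 1) k ⌊(2 * k + 1) * ((θ + i) / k)⌋ = k - i - 1 := by
      intro i hi h
      have : (i : ℝ) + 1 ≤ k := by exact_mod_cast hi
      obtain ⟨a, -, b⟩ := cutRank_strand (θ := θ) (c := 1) hk (by push_cast; linarith)
        (by push_cast; linarith)
      rw [a, b, mul_one, Int.emod_eq_of_lt (by omega) (by omega)]
    rcases lt_or_ge ((2 * k + 1) * θ + i) k with h2 | h2
    · rw [rk i (hi.trans hi') h2]
      rcases lt_or_ge ((2 * k + 1) * θ + i') k with h3 | h3
      · rw [rk i' hi' h3]; omega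
      · rw [rk' i' hi' h3]; omega
    · rw [rk' i (hi.trans hi') h2, rk' i' hi' (by linarith)]; omega
  · obtain ⟨-, hb, hs⟩ := ((twist_cases hk h0 h1).resolve_left (fun h => by linarith [h.1])
      ).resolve_left (fun h => by linarith [h.1])
    have hgt : ∀ i : ℕ, i < k → shuffleHeight k ((θ + i) / k) =
        Real.sin (2 * Real.pi * Int.fract ((2 * k + 1) * ((θ + i) / k))) := by
      intro i hi
      rw [strand_shuffleHeight hk h0 h1 hi, hs, sin_two_pi_fract, strand_phase hk, strand_full hk,
        sin_two_pi_add_int, hb, add_comm ((2 * i : ℤ) : ℝ), sin_two_pi_add_int,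
        ← sin_two_pi_add_int (((2 * k + 1) * θ + i) / k) (-1)]
      simp only [sub_zero, one_mul, mul_zero]
      congr 2
      field_simp
      push_cast
      ring
    -- Beyond the threshold the rank is a decreasing affine function of the phase. Of two mirror
    -- phases the one below `1 / 2` is on top, exactly as for the sine.
    have rk : ∀ i : ℕ, i < k → (cutRank (2 * k + 1) k ⌊(2 * k + 1) * ((θ + i) / k)⌋ : ℝ) =
        (2 * k + 1) * θ - 1 - k * Int.fract ((2 * k + 1) * ((θ + i) / k)) := by
      intro i hi
      have hik : (i : ℝ) + 1 ≤ k := by exact_mod_cast hi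
      rcases lt_or_ge ((2 * k + 1) * θ + i) (2 * k) with h2 | h2
      · obtain ⟨a, b, c⟩ := cutRank_strand (θ := θ) (c := 1) hk
          (by push_cast; linarith [(by positivity : (0 : ℝ) ≤ i)]) (by push_cast; linarith)
        rw [a, b, c, mul_one, Int.emod_eq_of_lt (by omega) (by omega)]
        push_cast; field_simp; ring
      · obtain ⟨a, b, c⟩ := cutRank_strand (θ := θ) (c := 2) hk (by push_cast; linarith)
          (by push_cast; linarith)
        rw [a, b, c, Int.emod_eq_of_lt (by omega) (by omega)]
        push_cast; field_simp; ring
    rw [hgt i (hi.trans hi'), hgt i' hi', hx, sin_two_pi_one_sub]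
    have r1 := rk i (hi.trans hi')
    have r2 := rk i' hi'
    rw [hx] at r2
    have f0 := Int.fract_nonneg ((2 * k + 1) * ((θ + i) / k))
    have f1 := Int.fract_lt_one ((2 * k + 1) * ((θ + i) / k))
    have f2 := Int.fract_lt_one ((2 * k + 1) * ((θ + i') / k))
    have hpi := Real.pi_pos
    set x := Int.fract ((2 * k + 1) * ((θ + i) / k))
    have fpos : 0 < x := by linarith
    rcases lt_or_gt_of_ne hx' with h2 | h2
    · left
      have := Real.sin_pos_of_pos_of_lt_pi (x := 2 * Real.pi * x) (by positivity) (by nlinarith)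
      refine ⟨?_, by linarith⟩
      have : (cutRank (2 * k + 1) k ⌊(2 * k + 1) * ((θ + i') / k)⌋ : ℝ) <
          cutRank (2 * k + 1) k ⌊(2 * k + 1) * ((θ + i) / k)⌋ := by rw [r1, r2]; nlinarith
      exact_mod_cast this
    · right
      have := Real.sin_pos_of_pos_of_lt_pi (x := 2 * Real.pi * (1 - x))
        (mul_pos (by positivity) (by linarith)) (by nlinarith)
      rw [sin_two_pi_one_sub] at this
      refine ⟨?_, by linarith⟩
      have : (cutRank (2 * k + 1) k ⌊(2 * k + 1) * ((θ + i) / k)⌋ : ℝ) <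
          cutRank (2 * k + 1) k ⌊(2 * k + 1) * ((θ + i') / k)⌋ := by rw [r1, r2]; nlinarith
      exact_mod_cast this

end

section

variable {k : ℕ} {θ : ℝ} {i i' : ℕ}

/-- This is `crossing_or_eq` for `τ = 0`; two different strands never agree modulo `1`. -/
theorem strand_crossing (hk : 0 < k) (hi : i < i') (hi' : i' < k)
    (h : Real.cos (2 * Real.pi * ((2 * k + 1) * ((θ + i) / k))) =
      Real.cos (2 * Real.pi * ((2 * k + 1) * ((θ + i') / k)))) :
    Int.fract ((2 * k + 1) * ((θ + i') / k)) = 1 - Int.fract ((2 * k + 1) * ((θ + i) / k)) ∧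
      Int.fract ((2 * k + 1) * ((θ + i) / k)) ≠ 1 / 2 ∧
      1 ≤ 2 * k * Int.fract ((2 * k + 1) * ((θ + i) / k)) ∧
      1 ≤ 2 * k * (1 - Int.fract ((2 * k + 1) * ((θ + i) / k))) := by
  have hkp : (0 : ℝ) < k := by exact_mod_cast hk
  have hx := eq_or_eq_one_sub_of_strictAntiOn cos_two_pi_strictAntiOn cos_two_pi_one_sub
      ⟨Int.fract_nonneg ((2 * k + 1) * ((θ + i) / k)), (Int.fract_lt_one _).le⟩
      ⟨Int.fract_nonneg ((2 * k + 1) * ((θ + i') / k)), (Int.fract_lt_one _).le⟩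
      (by simpa only [cos_two_pi_fract] using h)
  have hcop : (2 * k + 1).Coprime k := by
    rw [Nat.coprime_mul_right_add_left]; exact Nat.coprime_one_left k
  have key := crossing_or_eq (n := 2 * k + 1) (τ := 0) (s := (θ + i) / k) (t := (θ + i') / k)
    (b := i' - i) hk (by omega) hcop le_rfl zero_le_one
    (by simp only [slow]; push_cast; field_simp; ring)
  push_cast at key
  rcases key hx with ⟨m, hm⟩ | ⟨a, -, b, c, d⟩
  · refine absurd ?_ (not_int_div hk hi hi' (-m))
    push_cast
    rw [← hm]; ring
  · exact ⟨a, b, c, d⟩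

/-- Both heights put the same strand on top, so a linear interpolation between them creates no
self-intersection. -/
theorem cutHeight_shuffleHeight (hk : 0 < k) (h0 : 0 ≤ θ) (h1 : θ < 1) (hi : i < i')
    (hi' : i' < k) (h : Real.cos (2 * Real.pi * ((2 * k + 1) * ((θ + i) / k))) =
      Real.cos (2 * Real.pi * ((2 * k + 1) * ((θ + i') / k)))) :
    (cutHeight (2 * k + 1) k ((θ + i') / k) < cutHeight (2 * k + 1) k ((θ + i) / k) ∧
      shuffleHeight k ((θ + i') / k) < shuffleHeight k ((θ + i) / k)) ∨
    (cutHeight (2 * k + 1) k ((θ + i) / k) < cutHeight (2 * k + 1) k ((θ + i') / k) ∧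
      shuffleHeight k ((θ + i) / k) < shuffleHeight k ((θ + i') / k)) := by
  obtain ⟨a, b, c, d⟩ := strand_crossing hk hi hi' h
  have l1 := cutHeight_lt (n := 2 * k + 1) hk (s := (θ + i) / k) (t := (θ + i') / k)
  have l2 := cutHeight_lt (n := 2 * k + 1) hk (s := (θ + i') / k) (t := (θ + i) / k)
  push_cast at l1 l2
  rcases cutRank_order hk h0 h1 hi hi' h a b with ⟨e, f⟩ | ⟨e, f⟩
  · exact .inl ⟨l1 a c d e, f⟩
  · refine .inr ⟨l2 (by rw [a]; ring) (by rw [a]; exact d) (by rw [a]; linarith) e, f⟩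

end

/-! ### Four isotopies from the ranked braid to the `(k + 1, k)` torus knot -/

section

variable {k : ℕ}

/-- Radius of the double wound torus curve. -/
def fullRadius (k : ℕ) (s : ℝ) : ℝ := 2 + Real.cos (2 * Real.pi * ((2 * k + 1) * s))

def phaseRadius (k : ℕ) (s : ℝ) : ℝ := 2 + Real.cos (2 * Real.pi * phase k s)

def phaseHeight (k : ℕ) (s : ℝ) : ℝ := Real.sin (2 * Real.pi * phase k s)

theorem fullRadius_contDiff : ContDiff ℝ 1 (fullRadius k) :=
  contDiff_const.add (Real.contDiff_cos.comp
          (contDiff_const.mul (contDiff_const.mul contDiff_id)))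

theorem phaseRadius_contDiff : ContDiff ℝ 1 (phaseRadius k) :=
  contDiff_const.add (Real.contDiff_cos.comp (contDiff_const.mul phase_contDiff))

theorem phaseHeight_contDiff : ContDiff ℝ 1 (phaseHeight k) :=
  Real.contDiff_sin.comp (contDiff_const.mul phase_contDiff)

theorem fullRadius_add_one (s : ℝ) : fullRadius k (s + 1) = fullRadius k s := by
  have := cos_mul_add_one (2 * k + 1) s
  push_cast at this
  simp only [fullRadius, this]

theorem phaseRadius_add_one (s : ℝ) : phaseRadius k (s + 1) = phaseRadius k s := by
  simp only [phaseRadius, phase_add_one, cos_two_pi_add_int]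

theorem phaseHeight_add_one (s : ℝ) : phaseHeight k (s + 1) = phaseHeight k s := by
  simp only [phaseHeight, phase_add_one, sin_two_pi_add_int]

theorem fullRadius_pos (s : ℝ) : 0 < fullRadius k s := by
  unfold fullRadius; linarith [Real.neg_one_le_cos (2 * Real.pi * ((2 * k + 1) * s))]

theorem phaseRadius_pos (s : ℝ) : 0 < phaseRadius k s := by
  unfold phaseRadius; linarith [Real.neg_one_le_cos (2 * Real.pi * phase k s)]

theorem lerp_pos {a b t : ℝ} (ha : 0 < a) (hb : 0 < b) (t0 : 0 ≤ t) (t1 : t ≤ 1) :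
    0 < (1 - t) * a + t * b := by
  rcases t0.lt_or_eq with h | h
  · have := mul_pos h hb
    have := mul_nonneg (by linarith : 0 ≤ 1 - t) ha.le
    linarith
  · simp [← h, ha]

theorem lerp_lt {a a' b b' t : ℝ} (ha : a' < a) (hb : b' < b) (t0 : 0 ≤ t) (t1 : t ≤ 1) :
    (1 - t) * a' + t * b' < (1 - t) * a + t * b := by
  have := lerp_pos (sub_pos.2 ha) (sub_pos.2 hb) t0 t1
  linarith

theorem cutHeight_odd_isStarHeight (hk : 0 < k) :
    IsStarHeight (2 * k + 1) k (cutHeight (2 * k + 1) k) :=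
  cutHeight_isStarHeight hk (by omega)
    (by rw [Nat.coprime_mul_right_add_left]; exact Nat.coprime_one_left k)

theorem isBraid_cut_shuffle (hk : 0 < k) {t : ℝ} (t0 : 0 ≤ t) (t1 : t ≤ 1) :
    IsBraid k id (fullRadius k)
      (fun s => (1 - t) * cutHeight (2 * k + 1) k s + t * shuffleHeight k s) := by
  refine isBraid_id hk fullRadius_add_one (fun s => ?_) fullRadius_pos ?_
  · simp only [(cutHeight_odd_isStarHeight hk).add_one, shuffleHeight_add_one]
  · intro θ h0 h1 i i' hi hi' hρ
    rcases cutHeight_shuffleHeight hk h0 h1 hi hi' (add_left_cancel hρ) with ⟨a, b⟩ | ⟨a, b⟩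
    · exact (lerp_lt a b t0 t1).ne'
    · exact (lerp_lt a b t0 t1).ne

/-- While the twist is being taken back, the strands lie at different heights and their radii may
pass one another. Where the twist is an integer the two radii coincide and nothing moves. -/
theorem isBraid_full_phase (hk : 0 < k) {t : ℝ} (t0 : 0 ≤ t) (t1 : t ≤ 1) :
    IsBraid k id (fun s => (1 - t) * fullRadius k s + t * phaseRadius k s) (shuffleHeight k) := by
  refine isBraid_id hk (fun s => ?_) shuffleHeight_add_one
    (fun s => lerp_pos (fullRadius_pos s) (phaseRadius_pos s) t0 t1) ?_
  · simp only [fullRadius_add_one, phaseRadius_add_one]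
  · intro θ h0 h1 i i' hi hi' hρ
    have red : ∀ e : ℤ, backTwist k θ = e →
        shuffleHeight k ((θ + i) / k) ≠ shuffleHeight k ((θ + i') / k) := by
      intro e he
      have hr : ∀ i : ℕ, phaseRadius k ((θ + i) / k) = fullRadius k ((θ + i) / k) := by
        intro i
        rw [phaseRadius, fullRadius, cos_phase_of_int hk he]
      rw [hr, hr] at hρ
      have : fullRadius k ((θ + i) / k) = fullRadius k ((θ + i') / k) := by linarith
      rcases cutHeight_shuffleHeight hk h0 h1 hi hi' (add_left_cancel this) with ⟨-, b⟩ | ⟨-, b⟩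
      · exact b.ne'
      · exact b.ne
    rcases twist_cases hk h0 h1 with ⟨-, e, he, -⟩ | ⟨-, -, -, s⟩ | ⟨-, he, -⟩
    · exact red e he
    · rw [strand_shuffleHeight hk h0 h1 hi', strand_shuffleHeight hk h0 h1 (hi.trans hi'), s]
      have hii : (i : ℝ) < i' := by exact_mod_cast hi
      intro h
      linarith
    · exact red 1 (by simpa using he)

/-- Before the threshold both heights order every crossing in the same way. After it the heights
coincide, and distinct strands are distinct points of the torus. -/
theorem isBraid_shuffle_phase (hk : 0 < k) {t : ℝ} (t0 : 0 ≤ t) (t1 : t ≤ 1) :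
    IsBraid k id (phaseRadius k) (fun s => (1 - t) * shuffleHeight k s + t * phaseHeight k s) := by
  refine isBraid_id hk phaseRadius_add_one (fun s => ?_) phaseRadius_pos ?_
  · simp only [phaseHeight_add_one, shuffleHeight_add_one]
  · intro θ h0 h1 i i' hi hi' hρ
    have hρ := add_left_cancel hρ
    rcases lt_or_ge ((2 * k + 1) * θ) (k + 1) with hθ | hθ
    · obtain ⟨a, b⟩ := shuffleHeight_lt_of_phase hk h0 h1 hi hi' hθ hρ
      exact (lerp_lt a b t0 t1).ne'
    · obtain ⟨-, hb, hs⟩ := ((twist_cases hk h0 h1).resolve_left (fun h => by linarith [h.1])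
        ).resolve_left (fun h => by linarith [h.1])
      rw [strand_shuffleHeight hk h0 h1 hi', strand_shuffleHeight hk h0 h1 (hi.trans hi'), hs]
      intro h
      simp only [phaseHeight] at h
      have h : Real.sin (2 * Real.pi * phase k ((θ + i) / k)) =
        Real.sin (2 * Real.pi * phase k ((θ + i') / k)) := by linarith
      have he : Complex.exp (((2 * Real.pi * phase k ((θ + i) / k) : ℝ) : ℂ) * Complex.I) =
          Complex.exp (((2 * Real.pi * phase k ((θ + i') / k) : ℝ) : ℂ) * Complex.I) := by
        rw [Complex.exp_mul_I, Complex.exp_mul_I, ← Complex.ofReal_cos, ← Complex.ofReal_cos,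
          ← Complex.ofReal_sin, ← Complex.ofReal_sin, hρ, h]
      obtain ⟨m, hm⟩ := exp_two_pi_eq_iff.1 he
      rw [strand_phase hk, strand_phase hk] at hm
      refine not_int_div hk hi hi' (-(m - i + i')) ?_
      push_cast at hm ⊢
      rw [← hm]; ring

/-- The curve stays on the torus. Equal angles give `k * s' = k * s + b`, and `backTwist` then
changes by exactly `b`, so `t` drops out of the phase difference: `(k + 1) * (s - s')` is an integer
`m` while `k * (s - s') = -b`. -/
theorem isBraid_phase_torus (hk : 0 < k) (t : ℝ) :
    IsBraid k id (fun s => 2 + Real.cos (2 * Real.pi * ((1 - t) * phase k s + t * ((k + 1) * s))))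
      (fun s => Real.sin (2 * Real.pi * ((1 - t) * phase k s + t * ((k + 1) * s)))) := by
  have hkp : (0 : ℝ) < k := by exact_mod_cast hk
  have per : ∀ s, (1 - t) * phase k (s + 1) + t * ((k + 1) * (s + 1)) =
      (1 - t) * phase k s + t * ((k + 1) * s) + (k + 1 : ℤ) := by
    intro s
    rw [phase_add_one]; push_cast; ring
  refine ⟨fun s => rfl, fun s => ?_, fun s => ?_, fun s => ?_, fun s => .inl (by simp), ?_⟩
  · simp only [per, cos_two_pi_add_int]
  · simp only [per, sin_two_pi_add_int]
  · linarith [Real.neg_one_le_cos (2 * Real.pi * ((1 - t) * phase k s + t * ((k + 1) * s)))]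
  · intro s s' b hb hc hs
    have hc := add_left_cancel hc
    have he : Complex.exp
        (((2 * Real.pi * ((1 - t) * phase k s + t * ((k + 1) * s)) : ℝ) : ℂ) * Complex.I) =
        Complex.exp
        (((2 * Real.pi * ((1 - t) * phase k s' + t * ((k + 1) * s')) : ℝ) : ℂ) * Complex.I) := by
      rw [Complex.exp_mul_I, Complex.exp_mul_I, ← Complex.ofReal_cos, ← Complex.ofReal_cos,
        ← Complex.ofReal_sin, ← Complex.ofReal_sin, hc, hs]
    obtain ⟨m, hm⟩ := exp_two_pi_eq_iff.1 he
    simp only [id] at hb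
    have h1 : (k : ℝ) * s' = k * s + b := by linarith
    refine ⟨m + b, ?_⟩
    unfold phase at hm
    rw [h1, backTwist_add_int] at hm
    push_cast
    rw [← hm]
    linear_combination (2 - t) * h1

def cutKnot (hk : 0 < k) : Knot :=
  braidKnot k hk id (fullRadius k) (cutHeight (2 * k + 1) k) contDiff_id fullRadius_contDiff
    (cutHeight_odd_isStarHeight hk).contDiff
    (by simpa using isBraid_cut_shuffle hk le_rfl zero_le_one)

def shuffleKnot (hk : 0 < k) : Knot :=
  braidKnot k hk id (fullRadius k) (shuffleHeight k) contDiff_id fullRadius_contDiff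
    shuffleHeight_contDiff (by simpa using isBraid_cut_shuffle hk zero_le_one le_rfl)

def shufflePhaseKnot (hk : 0 < k) : Knot :=
  braidKnot k hk id (phaseRadius k) (shuffleHeight k) contDiff_id phaseRadius_contDiff
    shuffleHeight_contDiff (by simpa using isBraid_full_phase hk zero_le_one le_rfl)

def phaseKnot (hk : 0 < k) : Knot :=
  braidKnot k hk id (phaseRadius k) (phaseHeight k) contDiff_id phaseRadius_contDiff
    phaseHeight_contDiff (by simpa using isBraid_shuffle_phase hk zero_le_one le_rfl)

theorem cutKnot_isotopic (hk : 0 < k) : (cutKnot hk).Isotopic (shuffleKnot hk) :=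
  Knot.isotopic_of_isBraid hk contDiff_id.c1Family_const fullRadius_contDiff.c1Family_const
    ((cutHeight_odd_isStarHeight hk).contDiff.c1Family_lerp shuffleHeight_contDiff)
    (fun _ t0 t1 => isBraid_cut_shuffle hk t0 t1)
    (by simp [cutKnot, braidKnot, Function.id_def])
    (by simp [shuffleKnot, braidKnot, Function.id_def])

theorem shuffleKnot_isotopic (hk : 0 < k) : (shuffleKnot hk).Isotopic (shufflePhaseKnot hk) :=
  Knot.isotopic_of_isBraid hk contDiff_id.c1Family_const
    (fullRadius_contDiff.c1Family_lerp phaseRadius_contDiff)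
    shuffleHeight_contDiff.c1Family_const (fun _ t0 t1 => isBraid_full_phase hk t0 t1)
    (by simp [shuffleKnot, braidKnot, Function.id_def])
    (by simp [shufflePhaseKnot, braidKnot, Function.id_def])

theorem shufflePhaseKnot_isotopic (hk : 0 < k) : (shufflePhaseKnot hk).Isotopic (phaseKnot hk) :=
  Knot.isotopic_of_isBraid hk contDiff_id.c1Family_const phaseRadius_contDiff.c1Family_const
    (shuffleHeight_contDiff.c1Family_lerp phaseHeight_contDiff)
    (fun _ t0 t1 => isBraid_shuffle_phase hk t0 t1)
    (by simp [shufflePhaseKnot, braidKnot, Function.id_def])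
    (by simp [phaseKnot, braidKnot, Function.id_def])

theorem phaseKnot_isotopic (hk : 0 < k) (h : (k + 1).Coprime k) :
    (phaseKnot hk).Isotopic (torusKnot (k + 1) k h) := by
  have F : C1Family fun t s => (1 - t) * phase k s + t * ((k + 1) * s) :=
    phase_contDiff.c1Family_lerp (contDiff_const.mul contDiff_id)
  refine Knot.isotopic_of_isBraid hk contDiff_id.c1Family_const
    (F.comp (g := fun x => 2 + Real.cos (2 * Real.pi * x))
      (contDiff_const.add (Real.contDiff_cos.comp (contDiff_const.mul contDiff_id))))
    (F.comp (g := fun x => Real.sin (2 * Real.pi * x))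
      (Real.contDiff_sin.comp (contDiff_const.mul contDiff_id)))
    (fun t _ _ => isBraid_phase_torus hk t) ?_ ?_
  · simp [phaseKnot, braidKnot, Function.id_def]
    rfl
  · funext s
    simp [torusKnot, torusCurve, braidCurve]

theorem starKnot_cutHeight_isotopic (hk : 0 < k) (hn : 2 * k < 2 * k + 1)
    (hc : (2 * k + 1).Coprime k) (h : (k + 1).Coprime k) :
    (starKnot hk hn hc (cutHeight_odd_isStarHeight hk)).Isotopic (torusKnot (k + 1) k h) := by
  refine (starKnot_isotopic hk hn hc _ (L := cutKnot hk) ?_).trans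
    ((cutKnot_isotopic hk).trans ((shuffleKnot_isotopic hk).trans
      ((shufflePhaseKnot_isotopic hk).trans (phaseKnot_isotopic hk h))))
  simp only [cutKnot, braidKnot]
  congr 1
  funext s
  simp [fullRadius]

end

/-! ### Directions in a regular polygon -/

section

variable {n k : ℕ}

/-- Unit vector at angle `π * x / n`. -/
def unitDir (n : ℕ) (x : ℝ) : ℂ := Complex.exp (((Real.pi * x / n : ℝ) : ℂ) * Complex.I)

theorem unitDir_add (x y : ℝ) : unitDir n (x + y) = unitDir n x * unitDir n y := by
  rw [unitDir, unitDir, unitDir, ← Complex.exp_add]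
  congr 1; push_cast; ring

theorem unitDir_eq (x : ℝ) : unitDir n x =
    (Real.cos (Real.pi * x / n) : ℂ) + (Real.sin (Real.pi * x / n) : ℂ) * Complex.I := by
  rw [unitDir, Complex.exp_mul_I, Complex.ofReal_cos, Complex.ofReal_sin]

theorem norm_unitDir (x : ℝ) : ‖unitDir n x‖ = 1 := Complex.norm_exp_ofReal_mul_I _

theorem conj_unitDir (x : ℝ) : (starRingEnd ℂ) (unitDir n x) = unitDir n (-x) := by
  rw [unitDir, unitDir, ← Complex.exp_conj, map_mul, Complex.conj_I, Complex.conj_ofReal]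
  congr 1; push_cast; ring

theorem unitDir_zero : unitDir n 0 = 1 := by simp [unitDir]

theorem unitDir_neg_mul (x : ℝ) : unitDir n (-x) * unitDir n x = 1 := by
  rw [← unitDir_add, neg_add_cancel, unitDir_zero]

theorem unitDir_intCast [NeZero n] {l m : ℤ} (h : (l : ZMod n) = m) :
    unitDir n (2 * l) = unitDir n (2 * m) := by
  have h1 := (ZMod.intCast_eq_intCast_iff_dvd_sub l m n).1 h
  obtain ⟨d, hd⟩ := h1
  have hn : (n : ℝ) ≠ 0 := by exact_mod_cast NeZero.ne n
  rw [unitDir, unitDir, Complex.exp_eq_exp_iff_exists_int]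
  refine ⟨-d, ?_⟩
  have h2 : (l : ℝ) = m - n * d := by
    have : l = m - n * d := by omega
    exact_mod_cast this
  rw [h2, show Real.pi * (2 * (m - n * d)) / n = Real.pi * (2 * m) / n - 2 * Real.pi * d by
    field_simp]
  push_cast; ring

theorem stdAddChar_intCast [NeZero n] (m : ℤ) :
    (ZMod.stdAddChar (m : ZMod n) : ℂ) = unitDir n (2 * m) := by
  rw [ZMod.stdAddChar_coe, unitDir]
  congr 1; push_cast; ring

/-- Component of `w` in direction `unitDir n x`. -/
def along (n : ℕ) (x : ℝ) (w : ℂ) : ℝ := (unitDir n (-x) * w).re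

/-- Component of `w` perpendicular to `unitDir n x`. -/
def across (n : ℕ) (x : ℝ) (w : ℂ) : ℝ := (unitDir n (-x) * w).im

theorem unitDir_mul_components (x : ℝ) (w : ℂ) :
    unitDir n x * (along n x w + across n x w * Complex.I) = w := by
  rw [along, across, Complex.re_add_im, ← mul_assoc, mul_comm (unitDir n x), unitDir_neg_mul,
    one_mul]

theorem along_mul (x : ℝ) (u v : ℝ) :
    along n x (unitDir n x * (u + v * Complex.I)) = u := by
  rw [along, ← mul_assoc, unitDir_neg_mul, one_mul]; simp

theorem across_mul (x : ℝ) (u v : ℝ) :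
    across n x (unitDir n x * (u + v * Complex.I)) = v := by
  rw [across, ← mul_assoc, unitDir_neg_mul, one_mul]; simp

theorem along_add (x y : ℝ) (w : ℂ) : along n (x + y) w =
    along n x w * Real.cos (Real.pi * y / n) + across n x w * Real.sin (Real.pi * y / n) := by
  rw [along, along, across, neg_add, unitDir_add, mul_assoc, mul_left_comm, unitDir_eq (-y),
    show Real.pi * -y / n = -(Real.pi * y / n) by ring, Real.cos_neg, Real.sin_neg]
  simp only [Complex.mul_re, Complex.add_re, Complex.add_im, Complex.ofReal_re, Complex.ofReal_im,
    Complex.I_re, Complex.I_im, Complex.mul_im]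
  ring

theorem across_add (x y : ℝ) (w : ℂ) : across n (x + y) w =
    across n x w * Real.cos (Real.pi * y / n) - along n x w * Real.sin (Real.pi * y / n) := by
  rw [along, across, across, neg_add, unitDir_add, mul_assoc, mul_left_comm, unitDir_eq (-y),
    show Real.pi * -y / n = -(Real.pi * y / n) by ring, Real.cos_neg, Real.sin_neg]
  simp only [Complex.mul_re, Complex.add_re, Complex.add_im, Complex.ofReal_re, Complex.ofReal_im,
    Complex.I_re, Complex.I_im, Complex.mul_im]
  ring

theorem along_unitDir (x y : ℝ) : along n x (unitDir n y) = Real.cos (Real.pi * (y - x) / n) := by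
  rw [along, ← unitDir_add, show -x + y = y - x by ring, unitDir, Complex.exp_ofReal_mul_I_re]

theorem along_le_norm (x : ℝ) (w : ℂ) : |along n x w| ≤ ‖w‖ := by
  have := Complex.abs_re_le_norm (unitDir n (-x) * w)
  rwa [norm_mul, norm_unitDir, one_mul] at this

theorem along_add_left (x : ℝ) (v w : ℂ) : along n x (v + w) = along n x v + along n x w := by
  simp only [along, mul_add, Complex.add_re]

theorem along_smul (x r : ℝ) (w : ℂ) : along n x (r * w) = r * along n x w := by
  simp only [along]
  rw [mul_left_comm, Complex.re_ofReal_mul]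

/-! ### Regular polygons -/

theorem polygonVertex_eq (c ρ : ℂ) (j : ℕ) :
    polygonVertex n c ρ j = c + ρ * unitDir n (2 * j) := by
  rw [polygonVertex, unitDir]
  congr 4; push_cast; ring

/-- Every corner lies on the inner side of the line through a side, and only the two ends of that
side lie on the line. The index is reduced modulo `n`, and angles beyond `π` are reflected. -/
theorem cos_odd_le [NeZero n] (m : ℤ) :
    Real.cos (Real.pi * (2 * m - 1) / n) ≤ Real.cos (Real.pi / n) ∧
      (Real.cos (Real.pi * (2 * m - 1) / n) = Real.cos (Real.pi / n) →
        (n : ℤ) ∣ m ∨ (n : ℤ) ∣ m - 1) := by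
  have hn : (0 : ℝ) < n := by exact_mod_cast NeZero.pos n
  have hpi := Real.pi_pos
  have hn' : (0 : ℤ) < n := by exact_mod_cast NeZero.pos n
  have e0 := Int.emod_nonneg m hn'.ne'
  have e1 := Int.emod_lt_of_pos m hn'
  have e2 := Int.emod_add_mul_ediv m n
  set d := m % n with hd
  have hm : (m : ℝ) = d + n * (m / n : ℤ) := by exact_mod_cast e2.symm
  have hcos : Real.cos (Real.pi * (2 * m - 1) / n) = Real.cos (Real.pi * (2 * d - 1) / n) := by
    rw [hm, show Real.pi * (2 * (d + n * (m / n : ℤ)) - 1) / n =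
      Real.pi * (2 * d - 1) / n + (m / n : ℤ) * (2 * Real.pi) by field_simp; ring,
      Real.cos_add_int_mul_two_pi]
  rw [hcos]
  have hdiv : (n : ℤ) ∣ m - d := Int.dvd_self_sub_emod
  rcases (show d = 0 ∨ d = 1 ∨ 2 ≤ d by omega) with h | h | h
  · rw [h]
    refine ⟨?_, fun _ => .inl (by simpa [h] using hdiv)⟩
    rw [show Real.pi * (2 * ((0 : ℤ) : ℝ) - 1) / n = -(Real.pi / n) by push_cast; ring,
      Real.cos_neg]
  · rw [h]
    refine ⟨?_, fun _ => .inr (by simpa [h] using hdiv)⟩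
    rw [show Real.pi * (2 * ((1 : ℤ) : ℝ) - 1) / n = Real.pi / n by push_cast; ring]
  · have hlt : Real.cos (Real.pi * (2 * d - 1) / n) < Real.cos (Real.pi / n) := by
      have h2 : (2 : ℝ) ≤ d := by exact_mod_cast h
      have h3 : (d : ℝ) + 1 ≤ n := by exact_mod_cast e1
      rcases le_total (2 * (d : ℝ) - 1) n with h4 | h4
      · apply Real.cos_lt_cos_of_nonneg_of_le_pi (by positivity)
        · rw [div_le_iff₀ hn]; nlinarith
        · gcongr; nlinarith
      · rw [← Real.cos_two_pi_sub (Real.pi * (2 * d - 1) / n)]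
        have e : 2 * Real.pi - Real.pi * (2 * d - 1) / n = Real.pi * (2 * n - (2 * d - 1)) / n := by
          field_simp
        rw [e]
        apply Real.cos_lt_cos_of_nonneg_of_le_pi (by positivity)
        · rw [div_le_iff₀ hn]; nlinarith
        · gcongr; nlinarith
    exact ⟨hlt.le, fun h => absurd h hlt.ne⟩

variable {c ρ : ℂ}

theorem along_le_of_mem_regularPolygon [NeZero n] (hρ : ρ ≠ 0) {z : ℂ}
    (hz : z ∈ regularPolygon n c ρ) (m : ℤ) :
    along n (2 * m + 1) ((z - c) / ρ) ≤ Real.cos (Real.pi / n) := by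
  have hc : Convex ℝ {z : ℂ | along n (2 * m + 1) ((z - c) / ρ) ≤ Real.cos (Real.pi / n)} := by
    intro x hx y hy a b ha hb hab
    simp only [Set.mem_ofPred_eq] at hx hy ⊢
    have : (a • x + b • y - c) / ρ = (a : ℝ) * ((x - c) / ρ) + (b : ℝ) * ((y - c) / ρ) := by
      have hab' : (a : ℂ) + b = 1 := by exact_mod_cast hab
      simp only [Complex.real_smul]
      field_simp
      linear_combination c * hab'
    rw [this, along_add_left, along_smul, along_smul]
    have h1 := mul_le_mul_of_nonneg_left hx ha
    have h2 := mul_le_mul_of_nonneg_left hy hb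
    have h3 : a * Real.cos (Real.pi / n) + b * Real.cos (Real.pi / n) = Real.cos (Real.pi / n) := by
      rw [← add_mul, hab, one_mul]
    linarith
  refine (convexHull_min ?_ hc) hz
  rintro _ ⟨j, rfl⟩
  simp only [Set.mem_ofPred_eq]
  rw [polygonVertex_eq, add_sub_cancel_left, mul_div_cancel_left₀ _ hρ, along_unitDir]
  have := (cos_odd_le (n := n) (j - m)).1
  convert this using 3
  push_cast; ring

theorem norm_le_of_mem_regularPolygon {z : ℂ}
    (hz : z ∈ regularPolygon n c ρ) : ‖(z - c) / ρ‖ ≤ 1 := by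
  have h : z ∈ Metric.closedBall c ‖ρ‖ := by
    refine (convexHull_min ?_ (convex_closedBall c ‖ρ‖)) hz
    rintro _ ⟨j, rfl⟩
    rw [polygonVertex_eq, mem_closedBall_iff_norm, add_sub_cancel_left, norm_mul, norm_unitDir,
      mul_one]
  rw [mem_closedBall_iff_norm] at h
  rw [norm_div]
  exact div_le_one_of_le₀ h (norm_nonneg _)

theorem unitDir_mem_regularPolygon [NeZero n] (m : ℤ) :
    c + ρ * unitDir n (2 * m) ∈ regularPolygon n c ρ := by
  refine subset_convexHull ℝ _ ⟨(m : ZMod n).val, ?_⟩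
  rw [polygonVertex_eq]
  have : ((((m : ZMod n).val : ℤ)) : ZMod n) = m := by simp
  have := unitDir_intCast this
  rw [← this]; push_cast; rfl

/-! ### The ribbon along a star polygon -/

/-- The shape of the ribbon whose fold lines are the sides of a regular polygon and that advances
by `k` sides from one fold to the next. -/
def starShape (n k : ℕ) [NeZero n] (c ρ : ℂ) : RibbonShape n where
  -- The midpoint of side number `k * i`.
  vertex i := c + ρ * (Real.cos (Real.pi / n) * (unitDir n 1 * ZMod.stdAddChar ((k : ZMod n) * i)))
  -- Twice half a side, `‖ρ‖ * sin (π / n)`, times the sine of the angle between the side and the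
  -- edge. The boundary of the ribbon then meets the fold line at the ends of the side.
  width := 2 * ‖ρ‖ * (Real.sin (Real.pi / n) * Real.sin (Real.pi * k / n))

theorem starShape_vertex [NeZero n] (m : ℤ) : (starShape n k c ρ).vertex m =
    c + ρ * (Real.cos (Real.pi / n) * unitDir n (2 * (k * m) + 1)) := by
  have h := stdAddChar_intCast (n := n) (k * m)
  push_cast at h
  simp only [starShape]
  rw [h, ← unitDir_add, add_comm (1 : ℝ)]

theorem sin_pi_div_pos (hn : 2 ≤ n) : 0 < Real.sin (Real.pi / n) := by
  have h : (2 : ℝ) ≤ n := by exact_mod_cast hn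
  have := Real.pi_pos
  apply Real.sin_pos_of_pos_of_lt_pi (by positivity)
  rw [div_lt_iff₀ (by linarith)]; nlinarith

theorem cos_pi_div_pos (hn : 3 ≤ n) : 0 < Real.cos (Real.pi / n) := by
  have h : (3 : ℝ) ≤ n := by exact_mod_cast hn
  have := Real.pi_pos
  have h2 : 0 < Real.pi / n := by positivity
  apply Real.cos_pos_of_mem_Ioo ⟨by linarith, ?_⟩
  rw [div_lt_div_iff₀ (by linarith) two_pos]; nlinarith

theorem sin_half_pos (hk : 0 < k) (hn : 2 * k < n) : 0 < Real.sin (Real.pi * k / n) := by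
  have h1 := halfAngle_pos hk hn
  have h2 := halfAngle_lt hn
  unfold halfAngle at h1 h2
  exact Real.sin_pos_of_pos_of_lt_pi h1 (by linarith [Real.pi_pos])

theorem cos_half_pos (hk : 0 < k) (hn : 2 * k < n) : 0 < Real.cos (Real.pi * k / n) := by
  have h1 := halfAngle_pos hk hn
  have h2 := halfAngle_lt hn
  unfold halfAngle at h1 h2
  exact Real.cos_pos_of_mem_Ioo ⟨by linarith [Real.pi_pos], h2⟩

theorem unitDir_sub_neg (x : ℝ) :
    unitDir n x - unitDir n (-x) = 2 * Real.sin (Real.pi * x / n) * Complex.I := by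
  rw [unitDir_eq, unitDir_eq, show Real.pi * -x / n = -(Real.pi * x / n) by ring, Real.cos_neg,
    Real.sin_neg]
  push_cast; ring

theorem openStrip_subset_strip (R : RibbonShape n) (i : ZMod n) : R.openStrip i ⊆ R.strip i :=
  fun _ hz => ⟨hz.1.le, hz.2.1.le, hz.2.2.le⟩

theorem isOpen_openStrip (R : RibbonShape n) (i : ZMod n) : IsOpen (R.openStrip i) := by
  have h : ∀ a v : ℂ, Continuous fun z : ℂ => ⟪a, z - v⟫_ℝ := fun a v => by fun_prop
  exact ((isOpen_lt (h _ _).abs continuous_const).inter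
    ((isOpen_lt continuous_const (h _ _)).inter (isOpen_lt continuous_const (h _ _))))

/-- On a fold line the offset is governed by the position along the fold line. -/
theorem along_fold (x : ℝ) (w : ℂ) (h : along n x w = Real.cos (Real.pi / n)) :
    along n (x + k) w - Real.cos (Real.pi / n) * Real.cos (Real.pi * k / n) =
      across n x w * Real.sin (Real.pi * k / n) := by
  rw [along_add, h]; ring

/-- Translates the inner products in the definition of a ribbon into `along`, in coordinates where
the polygon has centre `0` and circumradius `1`. -/
theorem inner_unitDir (hρ : ρ ≠ 0) (x s r : ℝ) (w : ℂ) :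
    ⟪(s : ℂ) * (ρ / ‖ρ‖ * unitDir n x), ρ * (w - r * unitDir n x)⟫_ℝ =
      s * ‖ρ‖ * (along n x w - r) := by
  have hnρ : (‖ρ‖ : ℂ) ≠ 0 := by exact_mod_cast norm_ne_zero_iff.2 hρ
  have h1 : (starRingEnd ℂ) ((s : ℂ) * (ρ / ‖ρ‖ * unitDir n x)) * (ρ * (w - r * unitDir n x)) =
      ((s * ‖ρ‖ : ℝ) : ℂ) * (unitDir n (-x) * w - r) := by
    have h2 : (starRingEnd ℂ) ρ * ρ = (‖ρ‖ : ℂ) ^ 2 := Complex.conj_mul' ρ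
    have h3 := unitDir_neg_mul (n := n) x
    rw [map_mul, map_mul, map_div₀, Complex.conj_ofReal, Complex.conj_ofReal, conj_unitDir]
    push_cast
    field_simp
    linear_combination s * (unitDir n (-x)) * (w - r * unitDir n x) * h2 -
      s * ‖ρ‖ ^ 2 * r * h3
  rw [Complex.inner, mul_comm, h1, Complex.re_ofReal_mul, Complex.sub_re, Complex.ofReal_re, along]

theorem fold_factor_pos (hk : 0 < k) (hn : 2 * k < n) (hρ : ρ ≠ 0) :
    0 < 2 * Real.sin (Real.pi * k / n) * ‖ρ‖ := by
  have := sin_half_pos hk hn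
  have : 0 < ‖ρ‖ := norm_pos_iff.2 hρ
  positivity

/-- Points of the side of a regular polygon. -/
theorem mem_side_iff (hn : 2 ≤ n) (hρ : ρ ≠ 0) (m : ℤ) (z : ℂ) :
    z ∈ segment ℝ (c + ρ * unitDir n (2 * m)) (c + ρ * unitDir n (2 * m + 2)) ↔
      along n (2 * m + 1) ((z - c) / ρ) = Real.cos (Real.pi / n) ∧
        |across n (2 * m + 1) ((z - c) / ρ)| ≤ Real.sin (Real.pi / n) := by
  have hs := sin_pi_div_pos hn
  have e1 : unitDir n (2 * m) = unitDir n (2 * m + 1) *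
      ((Real.cos (Real.pi / n) : ℂ) - (Real.sin (Real.pi / n) : ℂ) * Complex.I) := by
    have := unitDir_eq (n := n) (-1)
    rw [show Real.pi * -1 / n = -(Real.pi / n) by ring, Real.cos_neg, Real.sin_neg] at this
    rw [show (2 * m : ℝ) = 2 * m + 1 + -1 by ring, unitDir_add, this,
      show (2 * m + 1 + -1 + 1 : ℝ) = 2 * m + 1 by ring]
    push_cast; ring
  have e2 : unitDir n (2 * m + 2) = unitDir n (2 * m + 1) *
      ((Real.cos (Real.pi / n) : ℂ) + (Real.sin (Real.pi / n) : ℂ) * Complex.I) := by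
    have := unitDir_eq (n := n) 1
    rw [mul_one] at this
    rw [show (2 * m + 2 : ℝ) = 2 * m + 1 + 1 by ring, unitDir_add, this]
  rw [segment_eq_image, Set.mem_image]
  constructor
  · rintro ⟨t, ⟨t0, t1⟩, rfl⟩
    have : ((1 - t) • (c + ρ * unitDir n (2 * m)) + t • (c + ρ * unitDir n (2 * m + 2)) - c) / ρ =
        unitDir n (2 * m + 1) * ((Real.cos (Real.pi / n) : ℝ) +
          ((2 * t - 1) * Real.sin (Real.pi / n) : ℝ) * Complex.I) := by
      rw [e1, e2]
      simp only [Complex.real_smul]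
      push_cast
      field_simp
      ring
    rw [this, along_mul, across_mul]
    refine ⟨rfl, ?_⟩
    rw [abs_mul, abs_of_pos hs]
    have : |2 * t - 1| ≤ 1 := abs_le.2 ⟨by linarith, by linarith⟩
    nlinarith
  · rintro ⟨h1, h2⟩
    have hw := unitDir_mul_components (n := n) (2 * m + 1) ((z - c) / ρ)
    rw [h1] at hw
    set y := across n (2 * m + 1) ((z - c) / ρ)
    obtain ⟨y1, y2⟩ := abs_le.1 h2
    have hz : z = c + ρ * (unitDir n (2 * m + 1) *
        ((Real.cos (Real.pi / n) : ℝ) + y * Complex.I)) := by rw [hw]; field_simp; ring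
    refine ⟨(y / Real.sin (Real.pi / n) + 1) / 2, ⟨?_, ?_⟩, ?_⟩
    · have : -1 ≤ y / Real.sin (Real.pi / n) := by rw [le_div_iff₀ hs]; linarith
      linarith
    · have : y / Real.sin (Real.pi / n) ≤ 1 := by rw [div_le_iff₀ hs]; linarith
      linarith
    · have hs' : (Real.sin (Real.pi / n) : ℂ) ≠ 0 := by exact_mod_cast hs.ne'
      rw [hz, e1, e2]
      simp only [Complex.real_smul]
      rw [Complex.ofReal_sub, Complex.ofReal_div, Complex.ofReal_add, Complex.ofReal_div]
      simp only [Complex.ofReal_one, Complex.ofReal_ofNat]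
      field_simp
      ring

variable [NeZero n]

theorem starShape_dir (hk : 0 < k) (hn : 2 * k < n) (hρ : ρ ≠ 0) (m : ℤ) :
    (starShape n k c ρ).dir m = ρ / ‖ρ‖ * (Complex.I * unitDir n (2 * (k * m) + 1 + k)) := by
  have e : (starShape n k c ρ).vertex (m + 1) - (starShape n k c ρ).vertex m =
      (2 * Real.cos (Real.pi / n) * Real.sin (Real.pi * k / n) : ℝ) *
        (ρ * (Complex.I * unitDir n (2 * (k * m) + 1 + k))) := by
    have h1 := starShape_vertex (n := n) (k := k) (c := c) (ρ := ρ) (m + 1)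
    have h2 := unitDir_sub_neg (n := n) (k : ℝ)
    push_cast at h1
    rw [h1, starShape_vertex, show (2 * (k * (m + 1)) + 1 : ℝ) = 2 * (k * m) + 1 + k + k by ring,
      unitDir_add _ (k : ℝ)]
    have h3 : unitDir n (2 * (k * m) + 1) = unitDir n (2 * (k * m) + 1 + k) * unitDir n (-k) := by
      rw [← unitDir_add]; congr 1; ring
    rw [h3]
    push_cast at h2 ⊢
    linear_combination (ρ * Complex.cos (Real.pi / n) * unitDir n (2 * (k * m) + 1 + k)) * h2
  have hpos : 0 < 2 * Real.cos (Real.pi / n) * Real.sin (Real.pi * k / n) := by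
    have := cos_pi_div_pos (n := n) (by omega)
    have := sin_half_pos hk hn
    positivity
  have hnρ : (‖ρ‖ : ℂ) ≠ 0 := by exact_mod_cast norm_ne_zero_iff.2 hρ
  have hpos' : ((2 * Real.cos (Real.pi / n) * Real.sin (Real.pi * k / n) : ℝ) : ℂ) ≠ 0 := by
    exact_mod_cast hpos.ne'
  rw [RibbonShape.dir, e, norm_mul, norm_mul, norm_mul, Complex.norm_real, Complex.norm_I,
    norm_unitDir, Real.norm_eq_abs, abs_of_pos hpos, mul_one, mul_one]
  rw [Complex.ofReal_inv, Complex.ofReal_mul _ ‖ρ‖]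
  field_simp

theorem starShape_foldNormal (hk : 0 < k) (hn : 2 * k < n) (hρ : ρ ≠ 0) (m : ℤ) :
    (starShape n k c ρ).foldNormal m =
      ((-(2 * Real.sin (Real.pi * k / n)) : ℝ) : ℂ) * (ρ / ‖ρ‖ * unitDir n (2 * (k * m) + 1)) := by
  have h1 := starShape_dir (c := c) hk hn hρ (m - 1)
  push_cast at h1
  have h2 := unitDir_sub_neg (n := n) (k : ℝ)
  rw [RibbonShape.foldNormal, h1, starShape_dir hk hn hρ,
    show (2 * (k * (m - 1)) + 1 + k : ℝ) = 2 * (k * m) + 1 + -k by ring, unitDir_add _ (k : ℝ),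
    unitDir_add _ (-k : ℝ)]
  push_cast at h2 ⊢
  linear_combination (ρ / ‖ρ‖ * Complex.I * unitDir n (2 * (k * m) + 1)) * h2 +
    (ρ / ‖ρ‖ * unitDir n (2 * (k * m) + 1) * 2 * Complex.sin (Real.pi * k / n)) * Complex.I_sq

theorem starShape_inner (hk : 0 < k) (hn : 2 * k < n) (hρ : ρ ≠ 0) (m : ℤ) (z : ℂ) :
    ⟪(starShape n k c ρ).foldNormal m, z - (starShape n k c ρ).vertex m⟫_ℝ =
      2 * Real.sin (Real.pi * k / n) * ‖ρ‖ *
        (Real.cos (Real.pi / n) - along n (2 * (k * m) + 1) ((z - c) / ρ)) := by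
  have : z - (starShape n k c ρ).vertex m =
      ρ * ((z - c) / ρ - Real.cos (Real.pi / n) * unitDir n (2 * (k * m) + 1)) := by
    rw [starShape_vertex]; field_simp; ring
  rw [this, starShape_foldNormal hk hn hρ, inner_unitDir hρ]
  ring

theorem starShape_offset (hk : 0 < k) (hn : 2 * k < n) (hρ : ρ ≠ 0) (m : ℤ) (z : ℂ) :
    (starShape n k c ρ).offset m z = -‖ρ‖ * (along n (2 * (k * m) + 1 + k) ((z - c) / ρ) -
      Real.cos (Real.pi / n) * Real.cos (Real.pi * k / n)) := by
  have h1 : Complex.I * (starShape n k c ρ).dir m =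
      ((-1 : ℝ) : ℂ) * (ρ / ‖ρ‖ * unitDir n (2 * (k * m) + 1 + k)) := by
    rw [starShape_dir hk hn hρ]
    push_cast
    linear_combination (ρ / ‖ρ‖ * unitDir n (2 * (k * m) + 1 + k)) * Complex.I_sq
  have h2 : z - (starShape n k c ρ).vertex m =
      ρ * (((z - c) / ρ - Real.cos (Real.pi / n) * unitDir n (2 * (k * m) + 1)) -
        (0 : ℝ) * unitDir n (2 * (k * m) + 1 + k)) := by
    rw [starShape_vertex]; push_cast; field_simp; ring
  have h3 : ∀ v w : ℂ, ∀ x : ℝ, along n x (v - w) = along n x v - along n x w := by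
    intro v w x; simp only [along, mul_sub, Complex.sub_re]
  rw [RibbonShape.offset, h1, h2, inner_unitDir hρ, h3, along_smul, along_unitDir]
  rw [show Real.pi * (2 * (k * m) + 1 - (2 * (k * m) + 1 + k)) / n = -(Real.pi * k / n) by ring,
    Real.cos_neg]
  ring

theorem abs_offset_le_iff (hk : 0 < k) (hn : 2 * k < n) (hρ : ρ ≠ 0) (m : ℤ) (z : ℂ) :
    |(starShape n k c ρ).offset m z| ≤ (starShape n k c ρ).width / 2 ↔
      |along n (2 * (k * m) + 1 + k) ((z - c) / ρ) -
        Real.cos (Real.pi / n) * Real.cos (Real.pi * k / n)| ≤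
      Real.sin (Real.pi / n) * Real.sin (Real.pi * k / n) := by
  have hr : 0 < ‖ρ‖ := norm_pos_iff.2 hρ
  rw [starShape_offset hk hn hρ, abs_mul, abs_neg, abs_of_pos hr]
  simp only [starShape]
  rw [show 2 * ‖ρ‖ * (Real.sin (Real.pi / n) * Real.sin (Real.pi * k / n)) / 2 =
    ‖ρ‖ * (Real.sin (Real.pi / n) * Real.sin (Real.pi * k / n)) by ring]
  exact mul_le_mul_iff_right₀ hr

theorem abs_offset_lt_iff (hk : 0 < k) (hn : 2 * k < n) (hρ : ρ ≠ 0) (m : ℤ) (z : ℂ) :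
    |(starShape n k c ρ).offset m z| < (starShape n k c ρ).width / 2 ↔
      |along n (2 * (k * m) + 1 + k) ((z - c) / ρ) -
        Real.cos (Real.pi / n) * Real.cos (Real.pi * k / n)| <
      Real.sin (Real.pi / n) * Real.sin (Real.pi * k / n) := by
  have hr : 0 < ‖ρ‖ := norm_pos_iff.2 hρ
  rw [starShape_offset hk hn hρ, abs_mul, abs_neg, abs_of_pos hr]
  simp only [starShape]
  rw [show 2 * ‖ρ‖ * (Real.sin (Real.pi / n) * Real.sin (Real.pi * k / n)) / 2 =
    ‖ρ‖ * (Real.sin (Real.pi / n) * Real.sin (Real.pi * k / n)) by ring]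
  exact mul_lt_mul_iff_right₀ hr

theorem inner_nonneg_iff (hk : 0 < k) (hn : 2 * k < n) (hρ : ρ ≠ 0) (m : ℤ) (z : ℂ) :
    0 ≤ ⟪(starShape n k c ρ).foldNormal m, z - (starShape n k c ρ).vertex m⟫_ℝ ↔
      along n (2 * (k * m) + 1) ((z - c) / ρ) ≤ Real.cos (Real.pi / n) := by
  rw [starShape_inner hk hn hρ, mul_nonneg_iff_of_pos_left (fold_factor_pos hk hn hρ), sub_nonneg]

theorem inner_pos_iff (hk : 0 < k) (hn : 2 * k < n) (hρ : ρ ≠ 0) (m : ℤ) (z : ℂ) :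
    0 < ⟪(starShape n k c ρ).foldNormal m, z - (starShape n k c ρ).vertex m⟫_ℝ ↔
      along n (2 * (k * m) + 1) ((z - c) / ρ) < Real.cos (Real.pi / n) := by
  rw [starShape_inner hk hn hρ, mul_pos_iff_of_pos_left (fold_factor_pos hk hn hρ), sub_pos]

theorem inner_eq_zero_iff' (hk : 0 < k) (hn : 2 * k < n) (hρ : ρ ≠ 0) (m : ℤ) (z : ℂ) :
    ⟪(starShape n k c ρ).foldNormal m, z - (starShape n k c ρ).vertex m⟫_ℝ = 0 ↔
      along n (2 * (k * m) + 1) ((z - c) / ρ) = Real.cos (Real.pi / n) := by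
  rw [starShape_inner hk hn hρ, mul_eq_zero_iff_left (fold_factor_pos hk hn hρ).ne', sub_eq_zero,
    eq_comm]

theorem mem_crease_iff (hk : 0 < k) (hn : 2 * k < n) (hρ : ρ ≠ 0) (m : ℤ) (z : ℂ) :
    z ∈ (starShape n k c ρ).crease m ↔
      along n (2 * (k * m) + 1) ((z - c) / ρ) = Real.cos (Real.pi / n) ∧
        |across n (2 * (k * m) + 1) ((z - c) / ρ)| ≤ Real.sin (Real.pi / n) := by
  rw [RibbonShape.crease, Set.mem_ofPred_eq, inner_eq_zero_iff' hk hn hρ,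
    abs_offset_le_iff hk hn hρ]
  refine and_congr_right fun h => ?_
  have hs := sin_half_pos hk hn
  rw [along_fold _ _ h, abs_mul, abs_of_pos hs]
  exact mul_le_mul_iff_left₀ hs

theorem mem_openCrease_iff (hk : 0 < k) (hn : 2 * k < n) (hρ : ρ ≠ 0) (m : ℤ) (z : ℂ) :
    z ∈ (starShape n k c ρ).openCrease m ↔
      along n (2 * (k * m) + 1) ((z - c) / ρ) = Real.cos (Real.pi / n) ∧
        |across n (2 * (k * m) + 1) ((z - c) / ρ)| < Real.sin (Real.pi / n) := by
  rw [RibbonShape.openCrease, Set.mem_ofPred_eq, inner_eq_zero_iff' hk hn hρ,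
    abs_offset_lt_iff hk hn hρ]
  refine and_congr_right fun h => ?_
  have hs := sin_half_pos hk hn
  rw [along_fold _ _ h, abs_mul, abs_of_pos hs]
  exact mul_lt_mul_iff_left₀ hs

theorem starShape_crease (hk : 0 < k) (hn : 2 * k < n) (hρ : ρ ≠ 0) (m : ℤ) :
    (starShape n k c ρ).crease m = segment ℝ (c + ρ * unitDir n (2 * (k * m)))
      (c + ρ * unitDir n (2 * (k * m) + 2)) := by
  ext z
  rw [mem_crease_iff hk hn hρ]
  have := mem_side_iff (n := n) (c := c) (by omega) hρ (k * m) z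
  push_cast at this
  rw [this]

theorem polygonSide_eq (i : ZMod n) (m : ℤ) (h : i = m) :
    polygonSide n c ρ i.val =
      segment ℝ (c + ρ * unitDir n (2 * m)) (c + ρ * unitDir n (2 * m + 2)) := by
  have h1 : ((i.val : ℤ) : ZMod n) = m := by simp [h]
  have h2 := unitDir_intCast h1
  have h3 : unitDir n (2 * (i.val + 1 : ℕ)) = unitDir n (2 * m + 2) := by
    rw [unitDir_add, ← h2, ← unitDir_add]; congr 1; push_cast; ring
  rw [polygonSide, polygonVertex_eq, polygonVertex_eq, h3, ← h2]
  push_cast; rfl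

theorem side_subset_regularPolygon (m : ℤ) :
    segment ℝ (c + ρ * unitDir n (2 * m)) (c + ρ * unitDir n (2 * m + 2)) ⊆
      regularPolygon n c ρ := by
  refine (convex_convexHull ℝ _).segment_subset (unitDir_mem_regularPolygon m) ?_
  have e : unitDir n (2 * m + 2) = unitDir n (2 * (m + 1 : ℤ)) := by
    congr 1; push_cast; ring
  rw [e]
  exact unitDir_mem_regularPolygon (m + 1)

theorem mem_strip_iff (hk : 0 < k) (hn : 2 * k < n) (hρ : ρ ≠ 0) (m : ℤ) (z : ℂ) :
    z ∈ (starShape n k c ρ).strip m ↔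
      |along n (2 * (k * m) + 1 + k) ((z - c) / ρ) -
        Real.cos (Real.pi / n) * Real.cos (Real.pi * k / n)| ≤
      Real.sin (Real.pi / n) * Real.sin (Real.pi * k / n) ∧
      along n (2 * (k * m) + 1) ((z - c) / ρ) ≤ Real.cos (Real.pi / n) ∧
      along n (2 * (k * m) + 1 + k + k) ((z - c) / ρ) ≤ Real.cos (Real.pi / n) := by
  have h := inner_nonneg_iff (c := c) hk hn hρ (m + 1) z
  push_cast at h
  rw [RibbonShape.strip, Set.mem_ofPred_eq, abs_offset_le_iff hk hn hρ, inner_nonneg_iff hk hn hρ,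
    h, show (2 * (k * (m + 1)) + 1 : ℝ) = 2 * (k * m) + 1 + k + k by ring]

theorem mem_openStrip_iff (hk : 0 < k) (hn : 2 * k < n) (hρ : ρ ≠ 0) (m : ℤ) (z : ℂ) :
    z ∈ (starShape n k c ρ).openStrip m ↔
      |along n (2 * (k * m) + 1 + k) ((z - c) / ρ) -
        Real.cos (Real.pi / n) * Real.cos (Real.pi * k / n)| <
      Real.sin (Real.pi / n) * Real.sin (Real.pi * k / n) ∧
      along n (2 * (k * m) + 1) ((z - c) / ρ) < Real.cos (Real.pi / n) ∧
      along n (2 * (k * m) + 1 + k + k) ((z - c) / ρ) < Real.cos (Real.pi / n) := by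
  have h := inner_pos_iff (c := c) hk hn hρ (m + 1) z
  push_cast at h
  rw [RibbonShape.openStrip, Set.mem_ofPred_eq, abs_offset_lt_iff hk hn hρ, inner_pos_iff hk hn hρ,
    h, show (2 * (k * (m + 1)) + 1 : ℝ) = 2 * (k * m) + 1 + k + k by ring]

/-- Each piece of ribbon lies in the polygon: it is swept out by segments between two sides. -/
theorem strip_subset (hk : 0 < k) (hn : 2 * k < n) (hρ : ρ ≠ 0) (m : ℤ) :
    (starShape n k c ρ).strip m ⊆ regularPolygon n c ρ := by
  intro z hz
  rw [mem_strip_iff hk hn hρ] at hz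
  obtain ⟨h1, h2, h3⟩ := hz
  have hs := sin_half_pos hk hn
  have hwc := unitDir_mul_components (n := n) (2 * (k * m) + 1 + k) ((z - c) / ρ)
  have a2 : along n (2 * (k * m) + 1) ((z - c) / ρ) =
      along n (2 * (k * m) + 1 + k) ((z - c) / ρ) * Real.cos (Real.pi * k / n) -
      across n (2 * (k * m) + 1 + k) ((z - c) / ρ) * Real.sin (Real.pi * k / n) := by
    have := along_add (n := n) (2 * (k * m) + 1 + k) (-k) ((z - c) / ρ)
    rw [show Real.pi * -k / n = -(Real.pi * k / n) by ring, Real.cos_neg, Real.sin_neg,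
      add_neg_cancel_right] at this
    rw [this]; ring
  rw [a2] at h2
  rw [along_add] at h3
  set u := along n (2 * (k * m) + 1 + k) ((z - c) / ρ)
  set v := across n (2 * (k * m) + 1 + k) ((z - c) / ρ)
  -- The line parallel to the edge at distance `u` from the centre meets the two fold lines at the
  -- coordinates `-V` and `V`.
  set V := (Real.cos (Real.pi / n) - u * Real.cos (Real.pi * k / n)) / Real.sin (Real.pi * k / n)
    with hV
  have hVs : V * Real.sin (Real.pi * k / n) =
      Real.cos (Real.pi / n) - u * Real.cos (Real.pi * k / n) := by rw [hV]; field_simp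
  have v1 : -V ≤ v := by
    by_contra! h
    have := mul_lt_mul_of_pos_right h hs
    linarith
  have v2 : v ≤ V := by
    by_contra! h
    have := mul_lt_mul_of_pos_right h hs
    linarith
  have hcs := Real.sin_sq_add_cos_sq (Real.pi * k / n)
  -- The sign `σ` selects the second or the first fold; the bound on `u` from the width places the
  -- meeting point on the side itself and not only on its line.
  have key : ∀ σ : ℝ, ∀ l : ℤ, σ ^ 2 = 1 → (2 * l + 1 : ℝ) = 2 * (k * m) + 1 + k + σ * k →
      c + ρ * (unitDir n (2 * (k * m) + 1 + k) * (u + (σ * V : ℝ) * Complex.I)) ∈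
        regularPolygon n c ρ := by
    intro σ l hσ hl
    have hσ1 : σ = 1 ∨ σ = -1 := by
      rcases mul_eq_zero.1 (show (σ - 1) * (σ + 1) = 0 by linear_combination hσ) with h | h
      · left; linarith
      · right; linarith
    refine side_subset_regularPolygon l ((mem_side_iff (by omega) hρ l _).2 ?_)
    rw [add_sub_cancel_left, mul_div_cancel_left₀ _ hρ, hl]
    have hcos : Real.cos (Real.pi * (σ * k) / n) = Real.cos (Real.pi * k / n) := by
      rcases hσ1 with h | h
      · rw [h, one_mul]
      · rw [h, show Real.pi * (-1 * k) / n = -(Real.pi * k / n) by ring, Real.cos_neg]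
    have hsin : Real.sin (Real.pi * (σ * k) / n) = σ * Real.sin (Real.pi * k / n) := by
      rcases hσ1 with h | h
      · rw [h, one_mul, one_mul]
      · rw [h, show Real.pi * (-1 * k) / n = -(Real.pi * k / n) by ring, Real.sin_neg]; ring
    constructor
    · rw [along_add, along_mul, across_mul, hcos, hsin]
      linear_combination hVs + V * Real.sin (Real.pi * k / n) * hσ
    · have hac : across n (2 * (k * m) + 1 + k + σ * k)
          (unitDir n (2 * (k * m) + 1 + k) * (u + (σ * V : ℝ) * Complex.I)) =
          σ * V * Real.cos (Real.pi * k / n) - u * (σ * Real.sin (Real.pi * k / n)) := by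
        rw [across_add, across_mul, along_mul, hcos, hsin]
      rw [hac]
      have : (σ * V * Real.cos (Real.pi * k / n) - u * (σ * Real.sin (Real.pi * k / n))) *
          Real.sin (Real.pi * k / n) =
          -σ * (u - Real.cos (Real.pi / n) * Real.cos (Real.pi * k / n)) := by
        linear_combination σ * Real.cos (Real.pi * k / n) * hVs - σ * u * hcs
      have hσ' : |σ| = 1 := by
        rcases hσ1 with h | h <;> simp [h]
      have h4 := congrArg abs this
      rw [abs_mul, abs_mul, abs_neg, hσ', one_mul, abs_of_pos hs] at h4
      rw [← h4] at h1
      exact le_of_mul_le_mul_right h1 hs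
  have k1 := key 1 (k * m + k) (by norm_num) (by push_cast; ring)
  have k2 := key (-1) (k * m) (by norm_num) (by push_cast; ring)
  have hz : z = c + ρ * (unitDir n (2 * (k * m) + 1 + k) * (u + v * Complex.I)) := by
    rw [hwc]; field_simp; ring
  have hconv := (convex_convexHull ℝ (Set.range (polygonVertex n c ρ))).segment_subset k2 k1
  apply hconv
  rcases (show -V ≤ V by linarith).lt_or_eq with hlt | heq
  · have hV0 : 0 < V := by linarith
    rw [segment_eq_image]
    refine ⟨(v / V + 1) / 2, ⟨?_, ?_⟩, ?_⟩
    · have : -1 ≤ v / V := by rw [le_div_iff₀ hV0]; linarith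
      linarith
    · have : v / V ≤ 1 := by rw [div_le_iff₀ hV0]; linarith
      linarith
    · have hV' : (V : ℂ) ≠ 0 := by exact_mod_cast hV0.ne'
      rw [hz]
      simp only [Complex.real_smul]
      push_cast
      field_simp
      ring
  · have hv : v = -1 * V := by linarith
    rw [hz, hv]
    exact left_mem_segment ℝ _ _

end

/-! ### The fold conditions for a star polygon -/

section

variable {n k : ℕ} {c ρ : ℂ}

theorem along_add_across (x y : ℝ) (w : ℂ) :
    along n (x - y) w + along n (x + y) w = 2 * (along n x w * Real.cos (Real.pi * y / n)) := by
  rw [sub_eq_add_neg, along_add, along_add, show Real.pi * -y / n = -(Real.pi * y / n) by ring,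
    Real.cos_neg, Real.sin_neg]
  ring

theorem natCast_mul_injective (hc : n.Coprime k) :
    Function.Injective fun i : ZMod n => (k : ZMod n) * i :=
  (Units.mulLeft (ZMod.unitOfCoprime k hc.symm)).injective

theorem add_one_ne (hn : 2 ≤ n) (i : ZMod n) : i + 1 ≠ i := by
  have : Fact (1 < n) := ⟨hn⟩
  simp

/-- Piece `i` starts between one and `k` sides ahead of piece `j`. -/
def Ahead (n k : ℕ) (i j : ZMod n) : Prop :=
  ∃ e : ℤ, 1 ≤ e ∧ e ≤ k ∧ (e : ZMod n) = k * (i - j)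

theorem Ahead.irrefl (hn : 2 * k < n) (i : ZMod n) : ¬ Ahead n k i i := by
  rintro ⟨e, h1, h2, h3⟩
  rw [sub_self, mul_zero, ZMod.intCast_zmod_eq_zero_iff_dvd] at h3
  have := Int.le_of_dvd (by omega) h3
  omega

variable [NeZero n]

theorem along_congr {l m : ℤ} (h : (l : ZMod n) = m) (x : ℝ) (w : ℂ) :
    along n (x + 2 * l) w = along n (x + 2 * m) w := by
  have h1 : ((-l : ℤ) : ZMod n) = (-m : ℤ) := by push_cast; rw [h]
  have h2 := unitDir_intCast h1
  have h3 : ∀ l : ℤ, unitDir n (-(x + 2 * l)) = unitDir n (-x) * unitDir n (2 * (-l : ℤ)) := by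
    intro l
    rw [← unitDir_add]; congr 1; push_cast; ring
  rw [along, along, h3, h3, h2]

theorem starShape_vertex_injective (hn : 3 ≤ n) (hc : n.Coprime k) (hρ : ρ ≠ 0) :
    Function.Injective (starShape n k c ρ).vertex := by
  intro i j h
  simp only [starShape] at h
  have h1 : (Real.cos (Real.pi / n) : ℂ) ≠ 0 := by exact_mod_cast (cos_pi_div_pos hn).ne'
  have h2 : unitDir n 1 ≠ 0 := Complex.exp_ne_zero _
  have := mul_left_cancel₀ h2 (mul_left_cancel₀ h1 (mul_left_cancel₀ hρ (add_left_cancel h)))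
  exact natCast_mul_injective hc (ZMod.injective_stdAddChar this)

theorem starShape_dist_vertex (hn : 3 ≤ n) (i : ZMod n) :
    dist ((starShape n k c ρ).vertex i) c = ‖ρ‖ * Real.cos (Real.pi / n) := by
  obtain ⟨m, rfl⟩ := ZMod.intCast_surjective i
  rw [starShape_vertex, dist_eq_norm, add_sub_cancel_left, norm_mul, norm_mul, norm_unitDir,
    Complex.norm_real, Real.norm_eq_abs, abs_of_pos (cos_pi_div_pos hn), mul_one]

/-- The vertices lie on a circle, and a chord without its ends lies in the open disc. -/
theorem starShape_core_regular (hn : 3 ≤ n) (hc : n.Coprime k) (hρ : ρ ≠ 0) (i j : ZMod n)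
    (h1 : i ≠ j) (h2 : i ≠ j + 1) : (starShape n k c ρ).vertex i ∉
      segment ℝ ((starShape n k c ρ).vertex j) ((starShape n k c ρ).vertex (j + 1)) := by
  intro h
  have inj := starShape_vertex_injective (c := c) hn hc hρ
  have hb : ∀ i, (starShape n k c ρ).vertex i ∈
      Metric.closedBall c (‖ρ‖ * Real.cos (Real.pi / n)) := fun i =>
    (starShape_dist_vertex hn i).le
  have hopen := mem_openSegment_of_ne_left_right (inj.ne h1.symm) (inj.ne h2.symm) h
  have := openSegment_subset_ball_of_ne (hb j) (hb (j + 1))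
    (inj.ne (add_one_ne (by omega) j).symm) hopen
  rw [Metric.mem_ball, starShape_dist_vertex hn] at this
  exact lt_irrefl _ this

theorem starShape_fold_ne (hk : 0 < k) (hn : 2 * k < n) (hρ : ρ ≠ 0) (i : ZMod n) :
    (starShape n k c ρ).foldNormal i ≠ 0 := by
  obtain ⟨m, rfl⟩ := ZMod.intCast_surjective i
  rw [starShape_foldNormal hk hn hρ]
  have h1 : ((-(2 * Real.sin (Real.pi * k / n)) : ℝ) : ℂ) ≠ 0 := by
    have := sin_half_pos hk hn
    exact_mod_cast (by linarith : -(2 * Real.sin (Real.pi * k / n)) < 0).ne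
  have h2 : (‖ρ‖ : ℂ) ≠ 0 := by exact_mod_cast norm_ne_zero_iff.2 hρ
  exact mul_ne_zero h1 (mul_ne_zero (div_ne_zero hρ h2) (Complex.exp_ne_zero _))

/-- For `2 ≤ k` and `2 * k < n` consecutive folds are on non-adjacent sides: even the nearer end of
one side stays short of the line of the other. -/
theorem starShape_crease_disjoint (hk : 2 ≤ k) (hn : 2 * k < n) (hρ : ρ ≠ 0) (i : ZMod n) :
    Disjoint ((starShape n k c ρ).crease i) ((starShape n k c ρ).crease (i + 1)) := by
  obtain ⟨m, rfl⟩ := ZMod.intCast_surjective i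
  have hnp : (0 : ℝ) < n := by exact_mod_cast NeZero.pos n
  have hk' : (2 : ℝ) ≤ k := by exact_mod_cast hk
  have hn' : 2 * (k : ℝ) < n := by exact_mod_cast hn
  have hpi := Real.pi_pos
  refine Set.disjoint_left.2 fun z h1 h2 => ?_
  have h3 : ((m : ZMod n) + 1) = ((m + 1 : ℤ) : ZMod n) := by push_cast; rfl
  rw [h3] at h2
  rw [mem_crease_iff (by omega) hn hρ] at h1 h2
  have h4 := h2.1
  push_cast at h4
  rw [show (2 * (k * (m + 1)) + 1 : ℝ) = 2 * (k * m) + 1 + 2 * k by ring, along_add, h1.1] at h4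
  set y := across n (2 * (k * m) + 1) ((z - c) / ρ)
  have hy := le_of_abs_le h1.2
  have hsin : 0 ≤ Real.sin (Real.pi * (2 * k) / n) := by
    apply Real.sin_nonneg_of_nonneg_of_le_pi (by positivity)
    rw [div_le_iff₀ hnp]; nlinarith
  have hlt : Real.cos (Real.pi * (2 * k) / n - Real.pi / n) < Real.cos (Real.pi / n) := by
    apply Real.cos_lt_cos_of_nonneg_of_le_pi (by positivity)
    · rw [← sub_div, div_le_iff₀ hnp]; nlinarith
    · rw [← sub_div]; gcongr; nlinarith
  rw [Real.cos_sub] at hlt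
  nlinarith [mul_le_mul_of_nonneg_right hy hsin]

/-- Points in the interior of a piece lie in the interior of the polygon. -/
theorem along_lt_of_mem_openStrip (hk : 0 < k) (hn : 2 * k < n) (hρ : ρ ≠ 0) {z : ℂ} {i : ZMod n}
    (hz : z ∈ (starShape n k c ρ).openStrip i) (l : ℤ) :
    along n (2 * l + 1) ((z - c) / ρ) < Real.cos (Real.pi / n) := by
  obtain ⟨m, rfl⟩ := ZMod.intCast_surjective i
  obtain ⟨δ, hδ, hball⟩ := Metric.isOpen_iff.1 (isOpen_openStrip (starShape n k c ρ) m) z hz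
  have hr : 0 < ‖ρ‖ := norm_pos_iff.2 hρ
  have hε : 0 < δ / (2 * ‖ρ‖) := by positivity
  -- A small outward shift remains in the piece, hence in the polygon, so the inequality at `z` is
  -- strict.
  have hmem : z + ρ * ((δ / (2 * ‖ρ‖) : ℝ) * unitDir n (2 * l + 1)) ∈ Metric.ball z δ := by
    rw [mem_ball_iff_norm, add_sub_cancel_left, norm_mul, norm_mul, norm_unitDir,
      Complex.norm_real, Real.norm_eq_abs, abs_of_pos hε, mul_one]
    rw [show ‖ρ‖ * (δ / (2 * ‖ρ‖)) = δ / 2 by field_simp]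
    linarith
  have h1 := along_le_of_mem_regularPolygon hρ
    (strip_subset hk hn hρ m (openStrip_subset_strip _ _ (hball hmem))) l
  rw [show (z + ρ * ((δ / (2 * ‖ρ‖) : ℝ) * unitDir n (2 * l + 1)) - c) / ρ =
    (z - c) / ρ + (δ / (2 * ‖ρ‖) : ℝ) * unitDir n (2 * l + 1) by field_simp; ring,
    along_add_left, along_smul, along_unitDir, sub_self] at h1
  simp only [mul_zero, zero_div, Real.cos_zero, mul_one] at h1
  linarith

/-- Folds lie on the boundary of the polygon, open pieces in its interior. This makes the condition
`fold_strip` vacuous. -/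
theorem openCrease_openStrip (hk : 0 < k) (hn : 2 * k < n) (hρ : ρ ≠ 0) {z : ℂ} {i j : ZMod n}
    (h1 : z ∈ (starShape n k c ρ).openCrease i) (h2 : z ∈ (starShape n k c ρ).openStrip j) :
    False := by
  obtain ⟨m, rfl⟩ := ZMod.intCast_surjective i
  have h3 := along_lt_of_mem_openStrip hk hn hρ h2 (k * m)
  rw [mem_openCrease_iff hk hn hρ] at h1
  push_cast at h3
  exact h3.ne h1.1

/-- A relative interior point of a side is a proper convex combination of its ends. If it lies on
another side, both ends lie on that side's line, and the two sides coincide. This makes `fold_fold`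
vacuous. -/
theorem openCrease_inj (hk : 0 < k) (hn : 2 * k < n) (hn3 : 3 ≤ n) (hc : n.Coprime k) (hρ : ρ ≠ 0)
    {z : ℂ} {i j : ZMod n} (h1 : z ∈ (starShape n k c ρ).openCrease i)
    (h2 : z ∈ (starShape n k c ρ).openCrease j) : i = j := by
  obtain ⟨m, rfl⟩ := ZMod.intCast_surjective i
  obtain ⟨l, rfl⟩ := ZMod.intCast_surjective j
  have hs := sin_pi_div_pos (n := n) (by omega)
  rw [mem_openCrease_iff hk hn hρ] at h1 h2
  have h3 := h2.1
  rw [show (2 * (k * l) + 1 : ℝ) = 2 * (k * m) + 1 + 2 * (k * (l - m)) by ring, along_add,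
    h1.1] at h3
  obtain ⟨y1, y2⟩ := abs_lt.1 h1.2
  set y := across n (2 * (k * m) + 1) ((z - c) / ρ)
  obtain ⟨a1, a2⟩ := cos_odd_le (n := n) (k * (l - m))
  obtain ⟨b1, b2⟩ := cos_odd_le (n := n) (k * (l - m) + 1)
  push_cast at a1 a2 b1 b2
  have e1 : Real.pi * (2 * (k * (l - m)) - 1) / n =
      Real.pi * (2 * (k * (l - m))) / n - Real.pi / n := by ring
  have e2 : Real.pi * (2 * (k * (l - m) + 1) - 1) / n =
      Real.pi * (2 * (k * (l - m))) / n + Real.pi / n := by ring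
  rw [e1] at a1 a2
  rw [e2] at b1 b2
  -- `A` and `B` are the components of the two ends of side `k * m` along the normal of side `k *
  -- l`.
  set A := Real.cos (Real.pi * (2 * (k * (l - m))) / n - Real.pi / n)
  set B := Real.cos (Real.pi * (2 * (k * (l - m))) / n + Real.pi / n)
  have hsum : (Real.sin (Real.pi / n) + y) * (Real.cos (Real.pi / n) - A) +
      (Real.sin (Real.pi / n) - y) * (Real.cos (Real.pi / n) - B) = 0 := by
    simp only [A, B]
    rw [Real.cos_sub, Real.cos_add]
    linear_combination (-2 * Real.sin (Real.pi / n)) * h3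
  have p1 := mul_nonneg (by linarith : 0 ≤ Real.sin (Real.pi / n) + y) (sub_nonneg.2 a1)
  have p2 := mul_nonneg (by linarith : 0 ≤ Real.sin (Real.pi / n) - y) (sub_nonneg.2 b1)
  have q1 : Real.cos (Real.pi / n) - A = 0 :=
    (mul_eq_zero.1 (by linarith : (Real.sin (Real.pi / n) + y) *
      (Real.cos (Real.pi / n) - A) = 0)).resolve_left (by linarith)
  have q2 : Real.cos (Real.pi / n) - B = 0 :=
    (mul_eq_zero.1 (by linarith : (Real.sin (Real.pi / n) - y) *
      (Real.cos (Real.pi / n) - B) = 0)).resolve_left (by linarith)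
  have hd : (n : ℤ) ∣ k * (l - m) := by
    rcases a2 (by linarith) with h | h
    · exact h
    · rcases b2 (by linarith) with h' | h'
      · have h5 := dvd_sub h' h
        rw [show (k * (l - m) + 1 - (k * (l - m) - 1) : ℤ) = 2 by ring] at h5
        have := Int.le_of_dvd (by norm_num) h5
        omega
      · simpa using h'
  have := (Nat.isCoprime_iff_coprime.2 hc).dvd_of_dvd_mul_left hd
  exact (ZMod.intCast_eq_intCast_iff_dvd_sub m l n).2 this

/-- The ribbon along a star polygon with given layers. -/
def starRibbon (hk : 2 ≤ k) (hn : 2 * k < n) (hc : n.Coprime k) (hρ : ρ ≠ 0)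
    (above : ZMod n → ZMod n → Prop) (irrefl : ∀ i, ¬ above i i)
    (trans : ∀ z i j l, z ∈ (starShape n k c ρ).openStrip i → z ∈ (starShape n k c ρ).openStrip j →
      z ∈ (starShape n k c ρ).openStrip l → above i j → above j l → above i l)
    (total : ∀ z i j, z ∈ (starShape n k c ρ).openStrip i → z ∈ (starShape n k c ρ).openStrip j →
      i ≠ j → above i j ∨ above j i) : FoldedRibbon n where
  toRibbonShape := starShape n k c ρ
  three_le := by omega
  width_pos := by
    have := sin_half_pos (by omega) hn
    have := sin_pi_div_pos (n := n) (by omega)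
    have : 0 < ‖ρ‖ := norm_pos_iff.2 hρ
    simp only [starShape]
    positivity
  edge_ne i := (starShape_vertex_injective (by omega) hc hρ).ne (add_one_ne (by omega) i)
  core_regular := starShape_core_regular (by omega) hc hρ
  fold_ne := starShape_fold_ne (by omega) hn hρ
  crease_disjoint := starShape_crease_disjoint hk hn hρ
  above := above
  above_irrefl _ i _ := irrefl i
  above_trans := trans
  above_total := total
  fold_strip _ _ _ h1 h2 := (openCrease_openStrip (by omega) hn hρ h1 h2).elim
  fold_fold _ _ _ hij h1 h2 _ :=
    absurd (openCrease_inj (by omega) hn (by omega) hc hρ h1 h2) hij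

theorem starShape_shadow_subset (hk : 0 < k) (hn : 2 * k < n) (hρ : ρ ≠ 0) :
    (starShape n k c ρ).shadow ⊆ regularPolygon n c ρ := by
  refine Set.iUnion_subset fun i => ?_
  obtain ⟨m, rfl⟩ := ZMod.intCast_surjective i
  exact strip_subset hk hn hρ m

theorem forms_of_toRibbonShape (hk : 0 < k) (hn : 2 * k < n) (hc : n.Coprime k) (hρ : ρ ≠ 0)
    {R : FoldedRibbon n} (hR : R.toRibbonShape = starShape n k c ρ) : R.Forms c ρ := by
  rw [FoldedRibbon.Forms, hR]
  refine ⟨starShape_shadow_subset hk hn hρ, Units.mulLeft (ZMod.unitOfCoprime k hc.symm), ?_⟩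
  intro i
  obtain ⟨m, rfl⟩ := ZMod.intCast_surjective i
  rw [starShape_crease hk hn hρ, polygonSide_eq _ (k * m) (by simp)]
  push_cast; rfl

/-! ### Layers with rotational symmetry -/

/-- For `2 * k + 2 ≤ n` the bound is nonnegative: an open piece stays strictly on its own side of
the centre. -/
theorem along_gt_of_mem_openStrip (hk : 0 < k) (hn : 2 * k < n) (hρ : ρ ≠ 0) {z : ℂ} {m : ℤ}
    (hz : z ∈ (starShape n k c ρ).openStrip m) :
    Real.cos (Real.pi * (k + 1) / n) < along n (2 * (k * m) + 1 + k) ((z - c) / ρ) := by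
  rw [mem_openStrip_iff hk hn hρ] at hz
  have := (abs_lt.1 hz.1).1
  rw [show Real.pi * (k + 1) / n = Real.pi / n + Real.pi * k / n by ring, Real.cos_add]
  linarith

/-- Suppose the first sides were `d` apart with `k + 1 ≤ d ≤ n - k - 1`. The components along the
two normals add up to twice a component of size at most `1` times `cos (π * d / n)`, hence to at
most `2 * cos (π * (k + 1) / n)`. But each of them exceeds half of that. -/
theorem openStrip_overlap (hk : 0 < k) (hn : 2 * k + 2 ≤ n) (hρ : ρ ≠ 0) {z : ℂ} {i j : ZMod n}
    (h1 : z ∈ (starShape n k c ρ).openStrip i) (h2 : z ∈ (starShape n k c ρ).openStrip j) :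
    ∃ e : ℤ, -k ≤ e ∧ e ≤ k ∧ (e : ZMod n) = k * (i - j) := by
  obtain ⟨m, rfl⟩ := ZMod.intCast_surjective i
  obtain ⟨l, rfl⟩ := ZMod.intCast_surjective j
  have hn' : (0 : ℤ) < n := by exact_mod_cast NeZero.pos n
  have hnp : (0 : ℝ) < n := by exact_mod_cast NeZero.pos n
  have hpi := Real.pi_pos
  have d0 := Int.emod_nonneg (k * (m - l) : ℤ) hn'.ne'
  have d1 := Int.emod_lt_of_pos (k * (m - l) : ℤ) hn'
  have d2 : (((k * (m - l) % n : ℤ)) : ZMod n) = (k * (m - l) : ℤ) := ZMod.intCast_mod _ _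
  set d := (k * (m - l) : ℤ) % n
  rcases (show d ≤ k ∨ n - k ≤ d ∨ (k + 1 ≤ d ∧ d + k + 1 ≤ n) by omega) with h | h | ⟨h, h'⟩
  · exact ⟨d, by omega, h, by rw [d2]; push_cast; rfl⟩
  · exact ⟨d - n, by omega, by omega, by push_cast at d2 ⊢; rw [d2]; simp⟩
  · exfalso
    have hw := norm_le_of_mem_regularPolygon (strip_subset hk (by omega) hρ m
      (openStrip_subset_strip _ _ h1))
    have a1 := along_gt_of_mem_openStrip hk (by omega) hρ h1
    have a2 := along_gt_of_mem_openStrip hk (by omega) hρ h2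
    have e1 := along_congr d2 (2 * (k * l) + 1 + k) ((z - c) / ρ)
    push_cast at e1
    rw [show (2 * (k * l) + 1 + k + 2 * (k * (m - l)) : ℝ) = 2 * (k * m) + 1 + k by ring] at e1
    rw [← e1] at a1
    have e2 := along_add_across (n := n) (2 * (k * l) + 1 + k + d) d ((z - c) / ρ)
    rw [add_sub_cancel_right, show (2 * (k * l) + 1 + k + d + d : ℝ) =
      2 * (k * l) + 1 + k + 2 * d by ring] at e2
    have b1 := (along_le_norm (n := n) (2 * (k * l) + 1 + k + d) ((z - c) / ρ)).trans hw
    have hkd : (k : ℝ) + 1 ≤ d := by exact_mod_cast h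
    have hkd' : (d : ℝ) + k + 1 ≤ n := by exact_mod_cast h'
    have c1 : |Real.cos (Real.pi * d / n)| ≤ Real.cos (Real.pi * (k + 1) / n) := by
      rw [abs_le]
      constructor
      · rw [neg_le, ← Real.cos_pi_sub]
        have e : Real.pi - Real.pi * d / n = Real.pi * (n - d) / n := by field_simp
        rw [e]
        apply Real.cos_le_cos_of_nonneg_of_le_pi (by positivity)
        · rw [div_le_iff₀ hnp]; nlinarith
        · gcongr; linarith
      · apply Real.cos_le_cos_of_nonneg_of_le_pi (by positivity)
        · rw [div_le_iff₀ hnp]; nlinarith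
        · gcongr
    have b2 := mul_le_mul b1 c1 (abs_nonneg _) zero_le_one
    rw [← abs_mul, one_mul] at b2
    have := (le_abs_self _).trans b2
    linarith

theorem Ahead.total (hk : 0 < k) (hn : 2 * k + 2 ≤ n) (hc : n.Coprime k) (hρ : ρ ≠ 0) {z : ℂ}
    {i j : ZMod n} (h1 : z ∈ (starShape n k c ρ).openStrip i)
    (h2 : z ∈ (starShape n k c ρ).openStrip j) (hij : i ≠ j) : Ahead n k i j ∨ Ahead n k j i := by
  obtain ⟨e, a, b, h⟩ := openStrip_overlap hk hn hρ h1 h2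
  rcases lt_trichotomy e 0 with h0 | h0 | h0
  · exact .inr ⟨-e, by omega, by omega, by push_cast; rw [h]; ring⟩
  · rw [h0, Int.cast_zero] at h
    have h3 : (k : ZMod n) * i = k * j := by linear_combination -h
    exact absurd (natCast_mul_injective hc h3) hij
  · exact .inl ⟨e, by omega, b, h⟩

/-- Failure would produce three overlapping pieces in a cycle, each ahead of the next, with total
advance `n`. Their normals would satisfy a linear relation with positive coefficients, although the
point has a positive component along each of them. -/
theorem Ahead.trans (hk : 0 < k) (hn : 2 * k + 2 ≤ n) (hρ : ρ ≠ 0) {z : ℂ}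
    {i j l : ZMod n} (hi : z ∈ (starShape n k c ρ).openStrip i)
    (hj : z ∈ (starShape n k c ρ).openStrip j) (hl : z ∈ (starShape n k c ρ).openStrip l)
    (h1 : Ahead n k i j) (h2 : Ahead n k j l) : Ahead n k i l := by
  obtain ⟨e, a, b, h⟩ := openStrip_overlap hk hn hρ hi hl
  obtain ⟨e₁, a₁, b₁, h1⟩ := h1
  obtain ⟨e₂, a₂, b₂, h2⟩ := h2
  by_cases hle : e₁ + e₂ ≤ k
  · exact ⟨e₁ + e₂, by omega, hle, by push_cast; rw [h1, h2]; ring⟩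
  exfalso
  have h3 : ((e₁ + e₂ : ℤ) : ZMod n) = e := by push_cast; rw [h, h1, h2]; ring
  obtain ⟨q, hq⟩ := (ZMod.intCast_eq_intCast_iff_dvd_sub e (e₁ + e₂) n).1 h3.symm
  have hq1 : q = 1 := by
    have q0 : 0 < q := by
      by_contra! hcon
      have : (n : ℤ) * q ≤ 0 := mul_nonpos_of_nonneg_of_nonpos (by omega) hcon
      omega
    have q2 : q < 2 := by
      by_contra! hcon
      have : (n : ℤ) * 2 ≤ n * q := mul_le_mul_of_nonneg_left hcon (by omega)
      omega
    omega
  rw [hq1, mul_one] at hq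
  have he : e₁ + e₂ = n + e := by omega
  obtain ⟨x, rfl⟩ := ZMod.intCast_surjective i
  obtain ⟨y, rfl⟩ := ZMod.intCast_surjective j
  obtain ⟨t, rfl⟩ := ZMod.intCast_surjective l
  have hnp : (0 : ℝ) < n := by exact_mod_cast NeZero.pos n
  have hpi := Real.pi_pos
  have hk2 : 2 * (k : ℝ) + 2 ≤ n := by exact_mod_cast hn
  have hcos : 0 ≤ Real.cos (Real.pi * (k + 1) / n) := by
    apply Real.cos_nonneg_of_neg_pi_div_two_le_of_le
    · have : 0 < Real.pi * (k + 1) / n := by positivity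
      linarith
    · rw [div_le_div_iff₀ hnp two_pos]; nlinarith
  have u1 := hcos.trans_lt (along_gt_of_mem_openStrip hk (by omega) hρ hi)
  have u2 := hcos.trans_lt (along_gt_of_mem_openStrip hk (by omega) hρ hj)
  have u3 := hcos.trans_lt (along_gt_of_mem_openStrip hk (by omega) hρ hl)
  have f1 : (e₁ : ZMod n) = (k * (x - y) : ℤ) := by rw [h1]; push_cast; rfl
  have f2 : ((-e₂ : ℤ) : ZMod n) = (k * (t - y) : ℤ) := by push_cast; rw [h2]; ring
  have g1 := along_congr f1 (2 * (k * y) + 1 + k) ((z - c) / ρ)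
  have g2 := along_congr f2 (2 * (k * y) + 1 + k) ((z - c) / ρ)
  push_cast at g1 g2
  rw [show (2 * (k * y) + 1 + k + 2 * (k * (x - y)) : ℝ) = 2 * (k * x) + 1 + k by ring] at g1
  rw [show (2 * (k * y) + 1 + k + 2 * (k * (t - y)) : ℝ) = 2 * (k * t) + 1 + k by ring] at g2
  rw [← g1, along_add] at u1
  rw [← g2, along_add, show Real.pi * (2 * -e₂) / n = -(Real.pi * (2 * e₂) / n) by ring,
    Real.cos_neg, Real.sin_neg] at u3
  -- The coefficient of each normal is the sine of the angle between the other two.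
  have sinpos : ∀ e : ℤ, 1 ≤ e → e ≤ k → 0 < Real.sin (Real.pi * (2 * e) / n) := by
    intro e h1 h2
    have h1' : (1 : ℝ) ≤ e := by exact_mod_cast h1
    have h2' : (e : ℝ) ≤ k := by exact_mod_cast h2
    apply Real.sin_pos_of_pos_of_lt_pi (by positivity)
    rw [div_lt_iff₀ hnp]; nlinarith
  have s1 := sinpos e₁ a₁ b₁
  have s2 := sinpos e₂ a₂ b₂
  have s3 := sinpos (-e) (by omega) (by omega)
  have s12 : Real.sin (Real.pi * (2 * e₁) / n + Real.pi * (2 * e₂) / n) =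
      -Real.sin (Real.pi * (2 * (-e : ℤ)) / n) := by
    have he' : (e₁ : ℝ) + e₂ = n + e := by exact_mod_cast he
    rw [← Real.sin_neg, ← Real.sin_add_two_pi (-(Real.pi * (2 * (-e : ℤ)) / n))]
    congr 1
    push_cast
    field_simp
    linarith
  rw [Real.sin_add] at s12
  have p1 := mul_pos s2 u1
  have p3 := mul_pos s1 u3
  have p2 := mul_pos s3 u2
  set C := along n (2 * (k * y) + 1 + k) ((z - c) / ρ)
  have : C * (Real.sin (Real.pi * (2 * e₁) / n) * Real.cos (Real.pi * (2 * e₂) / n) +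
      Real.cos (Real.pi * (2 * e₁) / n) * Real.sin (Real.pi * (2 * e₂) / n)) =
      -(Real.sin (Real.pi * (2 * (-e : ℤ)) / n) * C) := by rw [s12]; ring
  linarith

/-- The ribbon along a star polygon whose layers have the symmetry of the polygon. -/
def symmetricRibbon (hk : 2 ≤ k) (hn : 2 * k + 2 ≤ n) (hc : n.Coprime k) (hρ : ρ ≠ 0) (c : ℂ) :
    FoldedRibbon n :=
  starRibbon (c := c) hk (by omega) hc hρ (Ahead n k) (Ahead.irrefl (by omega))
    (fun _ _ _ _ => Ahead.trans (by omega) hn hρ) (fun _ _ _ => Ahead.total (by omega) hn hc hρ)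

/-! ### Layers ranked around a cut -/

def edgeRank (n k : ℕ) (i : ZMod n) : ℕ := (k * i - 1 : ZMod n).val

theorem edgeRank_injective (hc : n.Coprime k) : Function.Injective (edgeRank n k) := fun _ _ h =>
  natCast_mul_injective hc (sub_left_injective (ZMod.val_injective n h))

theorem edgeRank_intCast (m : ℤ) : (edgeRank n k m : ℤ) = cutRank n k m := by
  have := ZMod.val_intCast (n := n) (k * m - 1)
  push_cast at this
  rw [edgeRank, this, cutRank]

/-- The ribbon along a star polygon whose pieces are stacked in the order of their first sides. -/
def rankedRibbon (hk : 2 ≤ k) (hn : 2 * k < n) (hc : n.Coprime k) (hρ : ρ ≠ 0) (c : ℂ) :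
    FoldedRibbon n :=
  starRibbon (c := c) hk hn hc hρ (fun i j => edgeRank n k j < edgeRank n k i)
    (fun _ => lt_irrefl _) (fun _ _ _ _ _ _ _ h1 h2 => h2.trans h1)
    (fun _ _ _ _ _ h => ((edgeRank_injective hc).ne h).lt_or_gt.symm)

/-! ### The hole -/

/-- Here `π * (k + 1) / n` exceeds a right angle, so the inner boundary of each piece lies beyond
the centre. -/
theorem center_mem_shadow (hk : 0 < k) (hn : n = 2 * k + 1) (hρ : ρ ≠ 0) :
    c ∈ (starShape n k c ρ).shadow := by
  refine Set.mem_iUnion.2 ⟨((0 : ℤ) : ZMod n), (mem_strip_iff hk (by omega) hρ 0 c).2 ?_⟩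
  have hnp : (0 : ℝ) < n := by exact_mod_cast NeZero.pos n
  have hn' : (n : ℝ) = 2 * k + 1 := by exact_mod_cast hn
  have hkp : (0 : ℝ) < k := by exact_mod_cast hk
  have hpi := Real.pi_pos
  have ha : ∀ x, along n x ((c - c) / ρ) = 0 := by intro x; simp [along]
  have hc := (cos_pi_div_pos (n := n) (by omega)).le
  rw [ha, ha, ha]
  refine ⟨?_, hc, hc⟩
  rw [zero_sub, abs_neg, abs_of_nonneg (mul_nonneg hc (cos_half_pos hk (by omega)).le)]
  have : Real.cos (Real.pi / n + Real.pi * k / n) ≤ 0 := by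
    apply Real.cos_nonpos_of_pi_div_two_le_of_le
    · rw [← add_div, div_le_div_iff₀ two_pos hnp, hn']; nlinarith
    · rw [← add_div, div_le_iff₀ hnp, hn']; nlinarith
  rw [Real.cos_add] at this
  linarith

/-- Here `π * (k + 1) / n` is less than a right angle, so even the closed pieces miss the centre. -/
theorem center_notMem_shadow (hk : 0 < k) (hn : 2 * k + 2 < n) (hρ : ρ ≠ 0) :
    c ∉ (starShape n k c ρ).shadow := by
  intro h
  obtain ⟨i, hi⟩ := Set.mem_iUnion.1 h
  obtain ⟨m, rfl⟩ := ZMod.intCast_surjective i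
  rw [mem_strip_iff hk (by omega) hρ] at hi
  have hnp : (0 : ℝ) < n := by exact_mod_cast NeZero.pos n
  have hn' : 2 * (k : ℝ) + 2 < n := by exact_mod_cast hn
  have hpi := Real.pi_pos
  have ha : ∀ x, along n x ((c - c) / ρ) = 0 := by intro x; simp [along]
  have h1 := hi.1
  rw [ha, zero_sub, abs_neg] at h1
  have h2 := (le_abs_self _).trans h1
  have : 0 < Real.cos (Real.pi / n + Real.pi * k / n) := by
    apply Real.cos_pos_of_mem_Ioo ⟨?_, ?_⟩
    · have : 0 < Real.pi / n + Real.pi * k / n := by positivity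
      linarith
    · rw [← add_div, div_lt_div_iff₀ hnp two_pos]; nlinarith
  rw [Real.cos_add] at this
  linarith

theorem corner_mem_shadow (hk : 0 < k) (hn : 2 * k < n) (hc : n.Coprime k) (hρ : ρ ≠ 0)
    (j : ZMod n) : c + ρ * ZMod.stdAddChar j ∈ (starShape n k c ρ).shadow := by
  obtain ⟨i, rfl⟩ := (Units.mulLeft (ZMod.unitOfCoprime k hc.symm)).surjective j
  obtain ⟨m, rfl⟩ := ZMod.intCast_surjective i
  refine Set.mem_iUnion.2 ⟨(m : ZMod n), (mem_strip_iff hk hn hρ m _).2 ?_⟩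
  have h1 := stdAddChar_intCast (n := n) (k * m)
  push_cast at h1
  rw [Units.mulLeft_apply, ZMod.coe_unitOfCoprime, h1, add_sub_cancel_left,
    mul_div_cancel_left₀ _ hρ, along_unitDir, along_unitDir, along_unitDir]
  refine ⟨?_, ?_, ?_⟩
  · rw [show Real.pi * (2 * (k * m) - (2 * (k * m) + 1 + k)) / n =
      -(Real.pi / n + Real.pi * k / n) by ring, Real.cos_neg, Real.cos_add, sub_sub_cancel_left,
      abs_neg, abs_of_pos]
    exact mul_pos (sin_pi_div_pos (by omega)) (sin_half_pos hk hn)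
  · rw [show Real.pi * (2 * (k * m) - (2 * (k * m) + 1)) / n = -(Real.pi / n) by ring,
      Real.cos_neg]
  · have := (cos_odd_le (n := n) (-k)).1
    have e : Real.pi * (2 * (k * m) - (2 * (k * m) + 1 + k + k)) / n =
      Real.pi * (2 * ((-k : ℤ) : ℝ) - 1) / n := by push_cast; ring
    rw [e]
    exact this

/-- The smallest disc that contains a regular polygon is its circumscribed disc. -/
theorem eq_center_of_dist_le (hn : 2 ≤ n) {c' : ℂ}
    (h : ∀ j : ZMod n, dist (c + ρ * ZMod.stdAddChar j) c' ≤ ‖ρ‖) : c' = c := by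
  have hsum : ∑ j : ZMod n, (ZMod.stdAddChar j : ℂ) = 0 := by
    apply AddChar.sum_eq_zero_of_ne_one
    intro h1
    have h2 : (ZMod.stdAddChar (1 : ZMod n) : ℂ) = ZMod.stdAddChar (0 : ZMod n) := by rw [h1]; simp
    have h3 := ZMod.injective_stdAddChar h2
    have : Fact (1 < n) := ⟨hn⟩
    exact one_ne_zero h3
  -- This is the squared distance bound, expanded. Summation over `j` removes the right-hand side,
  -- since the roots of unity sum to zero.
  have hineq : ∀ j : ZMod n, ‖c' - c‖ ^ 2 ≤
      2 * ((starRingEnd ℂ) (c' - c) * (ρ * ZMod.stdAddChar j)).re := by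
    intro j
    have h1 := h j
    rw [dist_eq_norm] at h1
    have h2 : ‖ρ * (ZMod.stdAddChar j : ℂ)‖ = ‖ρ‖ := by
      rw [norm_mul, ZMod.stdAddChar_apply, Circle.norm_coe, mul_one]
    have h3 := norm_sub_sq_real (ρ * (ZMod.stdAddChar j : ℂ)) (c' - c)
    rw [h2, real_inner_comm, Complex.inner, mul_comm (ρ * _)] at h3
    have h4 : ‖ρ * (ZMod.stdAddChar j : ℂ) - (c' - c)‖ ≤ ‖ρ‖ := by
      rwa [show ρ * (ZMod.stdAddChar j : ℂ) - (c' - c) = c + ρ * ZMod.stdAddChar j - c' by ring]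
    have h5 := pow_le_pow_left₀ (norm_nonneg _) h4 2
    linarith
  have h1 := Finset.sum_le_sum fun j (_ : j ∈ Finset.univ) => hineq j
  rw [← Finset.mul_sum, ← Complex.re_sum, ← Finset.mul_sum, ← Finset.mul_sum, hsum, mul_zero,
    mul_zero, Complex.zero_re, mul_zero, Finset.sum_const, Finset.card_univ, ZMod.card,
    nsmul_eq_mul] at h1
  have hnp : (0 : ℝ) < n := by exact_mod_cast NeZero.pos n
  have h2 : ‖c' - c‖ ^ 2 ≤ 0 := by
    by_contra! h3
    have := mul_pos hnp h3
    linarith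
  have h3 : ‖c' - c‖ = 0 := by
    have := sq_nonneg ‖c' - c‖
    exact pow_eq_zero_iff two_ne_zero |>.1 (le_antisymm h2 this)
  exact sub_eq_zero.1 (norm_eq_zero.1 h3)

/-- The corners belong to the second region and all points of the first are within `‖ρ‖` of `c`. So
`g c` is within `‖ρ‖` of every corner, which forces `g c = c`; but only the first region contains
`c`. -/
theorem shadow_not_congruent {l : ℕ} (hk : 0 < k) (hn : n = 2 * k + 1) (hl : 0 < l)
    (hl' : 2 * l + 2 < n) (hc : n.Coprime l) (hρ : ρ ≠ 0) (g : ℂ ≃ᵢ ℂ) :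
    g '' (starShape n k c ρ).shadow ≠ (starShape n l c ρ).shadow := by
  intro h
  have hg : g c = c := by
    refine eq_center_of_dist_le (n := n) (ρ := ρ) (by omega) fun j => ?_
    have hj := corner_mem_shadow (c := c) hl (by omega) hc hρ j
    rw [← h] at hj
    obtain ⟨s, hs, hsj⟩ := hj
    rw [← hsj, g.isometry.dist_eq, dist_eq_norm]
    have := norm_le_of_mem_regularPolygon (starShape_shadow_subset hk (by omega) hρ hs)
    rwa [norm_div, div_le_one (norm_pos_iff.2 hρ)] at this
  apply center_notMem_shadow (c := c) hl hl' hρ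
  rw [← h]
  exact ⟨c, center_mem_shadow hk hn hρ, hg⟩

end

/-! ### The centre line of a star polygon as a knot -/

section

variable {n k : ℕ} {c ρ : ℂ} {κ : ℝ}

/-- Position along an edge of a star polygon of the point at phase `y`. -/
def edgeParam (κ y : ℝ) : ℝ := 1 / 2 + Real.tan (κ * (2 * slow 1 y - 1)) / (2 * Real.tan κ)

theorem edgeParam_zero (h0 : 0 < κ) (h1 : κ < Real.pi / 2) : edgeParam κ 0 = 0 := by
  have := (Real.tan_pos_of_pos_of_lt_pi_div_two h0 h1).ne'
  rw [edgeParam, slow_zero, show κ * (2 * 0 - 1) = -κ by ring, Real.tan_neg]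
  field_simp
  ring

theorem edgeParam_one (h0 : 0 < κ) (h1 : κ < Real.pi / 2) : edgeParam κ 1 = 1 := by
  have := (Real.tan_pos_of_pos_of_lt_pi_div_two h0 h1).ne'
  rw [edgeParam, slow_one, show κ * (2 * 1 - 1) = κ by ring]
  field_simp
  ring

theorem edgeAngle_mem (h0 : 0 < κ) (h1 : κ < Real.pi / 2) {y : ℝ} (hy : y ∈ Set.Icc (0 : ℝ) 1) :
    κ * (2 * slow 1 y - 1) ∈ Set.Ioo (-(Real.pi / 2)) (Real.pi / 2) := by
  obtain ⟨a, b⟩ := slow_mem_Icc zero_le_one le_rfl hy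
  constructor <;> nlinarith

theorem edgeParam_strictMonoOn (h0 : 0 < κ) (h1 : κ < Real.pi / 2) :
    StrictMonoOn (edgeParam κ) (Set.Icc 0 1) := by
  intro x hx y hy hxy
  have ht := Real.tan_pos_of_pos_of_lt_pi_div_two h0 h1
  have hs := slow_strictMono zero_le_one le_rfl hxy
  have := Real.strictMonoOn_tan (edgeAngle_mem h0 h1 hx) (edgeAngle_mem h0 h1 hy)
    (by nlinarith)
  unfold edgeParam
  gcongr

theorem edgeParam_continuousOn (h0 : 0 < κ) (h1 : κ < Real.pi / 2) :
    ContinuousOn (edgeParam κ) (Set.Icc 0 1) := by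
  have hc := (slow_contDiff 1).continuous
  refine continuousOn_const.add (ContinuousOn.div_const ?_ _)
  exact Real.continuousOn_tan_Ioo.comp (by fun_prop) fun y hy => edgeAngle_mem h0 h1 hy

theorem edgeParam_fract_mem (h0 : 0 < κ) (h1 : κ < Real.pi / 2) (v : ℝ) :
    edgeParam κ (Int.fract v) ∈ Set.Ico (0 : ℝ) 1 := by
  have f0 := Int.fract_nonneg v
  have f1 := Int.fract_lt_one v
  have hm := edgeParam_strictMonoOn h0 h1
  have a := hm.monotoneOn (Set.left_mem_Icc.2 zero_le_one) ⟨f0, f1.le⟩ f0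
  have b := hm ⟨f0, f1.le⟩ (Set.right_mem_Icc.2 zero_le_one) f1
  rw [edgeParam_zero h0 h1] at a
  rw [edgeParam_one h0 h1] at b
  exact ⟨a, b⟩

/-- Parameter of the centre line at phase `v`. -/
def coreParam (κ v : ℝ) : ℝ := ⌊v⌋ + edgeParam κ (Int.fract v)

theorem coreParam_continuous (h0 : 0 < κ) (h1 : κ < Real.pi / 2) : Continuous (coreParam κ) := by
  refine continuous_glue (F := fun m y => m + edgeParam κ y)
    (fun m => continuousOn_const.add (edgeParam_continuousOn h0 h1)) fun m => ?_
  rw [edgeParam_zero h0 h1, edgeParam_one h0 h1]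
  push_cast; ring

theorem floor_coreParam (h0 : 0 < κ) (h1 : κ < Real.pi / 2) (v : ℝ) :
    ⌊coreParam κ v⌋ = ⌊v⌋ := by
  obtain ⟨a, b⟩ := edgeParam_fract_mem h0 h1 v
  rw [Int.floor_eq_iff, coreParam]
  constructor <;> linarith

theorem fract_coreParam (h0 : 0 < κ) (h1 : κ < Real.pi / 2) (v : ℝ) :
    Int.fract (coreParam κ v) = edgeParam κ (Int.fract v) := by
  rw [Int.fract, floor_coreParam h0 h1, coreParam, add_sub_cancel_left]

theorem coreParam_monotone (h0 : 0 < κ) (h1 : κ < Real.pi / 2) : Monotone (coreParam κ) := by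
  intro v w hvw
  obtain ⟨-, a⟩ := edgeParam_fract_mem h0 h1 v
  obtain ⟨b, -⟩ := edgeParam_fract_mem h0 h1 w
  unfold coreParam
  rcases (Int.floor_mono hvw).lt_or_eq with h | h
  · have : (⌊v⌋ : ℝ) + 1 ≤ ⌊w⌋ := by exact_mod_cast h
    linarith
  · have hm := (edgeParam_strictMonoOn h0 h1).monotoneOn
      ⟨Int.fract_nonneg v, (Int.fract_lt_one v).le⟩ ⟨Int.fract_nonneg w, (Int.fract_lt_one w).le⟩
      (by rw [Int.fract, Int.fract, h]; linarith)
    rw [h]; linarith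

theorem coreParam_add_natCast (v : ℝ) (m : ℕ) : coreParam κ (v + m) = coreParam κ v + m := by
  rw [coreParam, Int.fract_add_natCast, Int.floor_add_natCast, coreParam]
  push_cast; ring

variable [NeZero n]

/-- Seen from the centre, the point of an edge at angle `ψ` from the foot of the perpendicular has
position proportional to `tan ψ`; `coreParam` is made to match this. -/
theorem starShape_core (hk : 0 < k) (hn : 2 * k < n) (s : ℝ) :
    (starShape n k c ρ).core (coreParam (halfAngle n k) (n * s)) =
      c + ρ * (Real.cos (Real.pi / n) * unitDir n 1) *
        (starRadius (halfAngle n k) (Int.fract (n * s)) *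
          Complex.exp (((2 * Real.pi * (k * starAngle n s) : ℝ) : ℂ) * Complex.I)) := by
  have h0 := halfAngle_pos hk hn
  have h1 := halfAngle_lt hn
  have hn0 : (n : ℝ) ≠ 0 := by exact_mod_cast NeZero.ne n
  set m := ⌊n * s⌋ with hm
  set y := Int.fract (n * s) with hy
  have hcψ := (starRadius_cos_pos h0 h1 (x := y)
    ⟨Int.fract_nonneg _, (Int.fract_lt_one _).le⟩).ne'
  set ψ := halfAngle n k * (2 * slow 1 y - 1) with hψ
  have hsκ : Real.sin (Real.pi * k / n) ≠ 0 := (sin_half_pos hk hn).ne'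
  have hcκ : Real.cos (Real.pi * k / n) ≠ 0 := (cos_half_pos hk hn).ne'
  have hang : 2 * Real.pi * (k * starAngle n s) = Real.pi * (2 * (k * m) + k) / n + ψ := by
    have : slow 1 (n * s) = slow 1 y + m := by rw [← slow_add_int, hy, hm, Int.fract_add_floor]
    rw [starAngle, this, hψ, halfAngle]
    field_simp
    ring
  have hT : Real.sin (Real.pi * k / n) * (2 * edgeParam (halfAngle n k) y - 1) =
      Real.cos (Real.pi * k / n) * (Real.sin ψ / Real.cos ψ) := by
    rw [edgeParam, Real.tan_eq_sin_div_cos, Real.tan_eq_sin_div_cos, ← hψ, halfAngle]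
    field_simp
    ring
  have hT' : (Real.sin (Real.pi * k / n) : ℂ) * (2 * (edgeParam (halfAngle n k) y : ℂ) - 1) =
      Real.cos (Real.pi * k / n) * (Real.sin ψ / Real.cos ψ) := by exact_mod_cast hT
  have hexp : Complex.exp (((2 * Real.pi * (k * starAngle n s) : ℝ) : ℂ) * Complex.I) =
      unitDir n (2 * (k * m) + k) * (Real.cos ψ + Real.sin ψ * Complex.I) := by
    rw [hang, Complex.ofReal_cos, Complex.ofReal_sin, ← Complex.exp_mul_I, unitDir,
      ← Complex.exp_add]
    congr 1; push_cast; ring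
  have hcψ' : (Real.cos ψ : ℂ) ≠ 0 := by exact_mod_cast hcψ
  have v1 := starShape_vertex (n := n) (k := k) (c := c) (ρ := ρ) m
  have v2 := starShape_vertex (n := n) (k := k) (c := c) (ρ := ρ) (m + 1)
  rw [Int.cast_add, Int.cast_one, Int.cast_add, Int.cast_one] at v2
  have e1 : unitDir n (2 * (k * m) + 1) = unitDir n 1 * unitDir n (2 * (k * m) + k) *
      (Real.cos (Real.pi * k / n) - Real.sin (Real.pi * k / n) * Complex.I) := by
    have : (Real.cos (Real.pi * k / n) - Real.sin (Real.pi * k / n) * Complex.I : ℂ) =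
        unitDir n (-k) := by
      rw [unitDir_eq, show Real.pi * -k / n = -(Real.pi * k / n) by ring, Real.cos_neg,
        Real.sin_neg]
      push_cast; ring
    rw [this, ← unitDir_add, ← unitDir_add]; congr 1; ring
  have e2 : unitDir n (2 * (k * (m + 1)) + 1) = unitDir n 1 * unitDir n (2 * (k * m) + k) *
      (Real.cos (Real.pi * k / n) + Real.sin (Real.pi * k / n) * Complex.I) := by
    rw [← unitDir_eq, ← unitDir_add, ← unitDir_add]; congr 1; ring
  rw [RibbonShape.core, floor_coreParam h0 h1, fract_coreParam h0 h1, ← hm, ← hy, v1, v2,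
    AffineMap.lineMap_apply, vsub_eq_sub, vadd_eq_add, Complex.real_smul, hexp, e1, e2,
    starRadius, ← hψ]
  have e3 : (Real.cos (Real.pi * k / n) / Real.cos ψ : ℂ) *
      (unitDir n (2 * (k * m) + k) * (Real.cos ψ + Real.sin ψ * Complex.I)) =
      unitDir n (2 * (k * m) + k) * (Real.cos (Real.pi * k / n) +
        Real.cos (Real.pi * k / n) * (Real.sin ψ / Real.cos ψ) * Complex.I) := by
    field_simp
  rw [Complex.ofReal_div, halfAngle, e3, ← hT', halfAngle]
  ring

/-- The similarity carries the star polygon of circumradius `1` to the centre line. Coincidences of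
equal parameters modulo `1` are excluded by irreflexivity, so only mirror phases remain to be
compared. -/
theorem isCoreKnot_starKnot (hk : 0 < k) (hn : 2 * k < n) (hc : n.Coprime k) {h : ℝ → ℝ}
    (H : IsStarHeight n k h) {R : FoldedRibbon n} (hR : R.toRibbonShape = starShape n k c ρ)
    (ha : ρ * (Real.cos (Real.pi / n) * unitDir n 1) ≠ 0) (irrefl : ∀ i, ¬ R.above i i)
    (habove : ∀ (s t : ℝ) (b : ℤ), k * (slow 1 (n * t) / n - slow 1 (n * s) / n) = b →
      Int.fract (n * t) = 1 - Int.fract (n * s) →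
      1 ≤ 2 * k * Int.fract (n * s) → 1 ≤ 2 * k * (1 - Int.fract (n * s)) →
      R.above (⌊n * s⌋ : ℤ) (⌊n * t⌋ : ℤ) → h t < h s) :
    R.IsCoreKnot ((starKnot hk hn hc H).similar c _ ha) := by
  have h0 := halfAngle_pos hk hn
  have h1 := halfAngle_lt hn
  refine ⟨fun s => coreParam (halfAngle n k) (n * s),
    (coreParam_continuous h0 h1).comp (by fun_prop),
    fun s t hst => coreParam_monotone h0 h1 (by gcongr),
    fun s => by simp only [mul_add, mul_one, coreParam_add_natCast], fun s => ?_,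
    fun s t hst hab => ?_⟩
  · rw [hR, starShape_core hk hn]
    rfl
  · rw [hR, starShape_core hk hn, starShape_core hk hn] at hst
    simp only [floor_coreParam h0 h1] at hab
    change h t < h s
    have fs : Int.fract (n * s) ∈ Set.Icc (0 : ℝ) 1 :=
      ⟨Int.fract_nonneg _, (Int.fract_lt_one _).le⟩
    have ft : Int.fract (n * t) ∈ Set.Icc (0 : ℝ) 1 :=
      ⟨Int.fract_nonneg _, (Int.fract_lt_one _).le⟩
    obtain ⟨hr, b, hb⟩ := polar_eq (starRadius_pos h0 h1 fs) (starRadius_pos h0 h1 ft)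
      (mul_left_cancel₀ ha (add_left_cancel hst))
    have hb' : k * (slow 1 (n * t) / n - slow 1 (n * s) / n) = ((-b : ℤ) : ℝ) := by
      push_cast
      rw [← hb, starAngle, starAngle]; ring
    have hx := eq_or_eq_one_sub_of_strictAntiOn (starRadius_strictAntiOn h0 h1)
      starRadius_one_sub fs ft hr
    rcases crossing_or_eq hk hn hc zero_le_one le_rfl hb' hx with ⟨m, hm⟩ | ⟨a1, -, -, a4, a5⟩
    · have e : n * s = n * t + (n * m : ℤ) := by
        push_cast
        rw [← hm]; ring
      rw [e, Int.floor_add_intCast] at hab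
      push_cast at hab
      rw [ZMod.natCast_self, zero_mul, add_zero] at hab
      exact absurd hab (irrefl _)
    · exact habove s t _ hb' a1 a4 a5 hab

/-- If the edge through `s` begins `e` sides ahead, the integer in `crossing_phase` is `k - e`. As
`1 ≤ e`, the phase of `s` is below `1 / 2`, where the sine is positive, and `t` has the opposite
height. -/
theorem symmetricRibbon_isTorusKnot (hk : 2 ≤ k) (hn : 2 * k + 2 ≤ n) (hc : n.Coprime k)
    (hρ : ρ ≠ 0) : (symmetricRibbon hk hn hc hρ c).IsTorusKnot n k := by
  have hk0 : 0 < k := by omega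
  have hn0 : 2 * k < n := by omega
  have ha : ρ * (Real.cos (Real.pi / n) * unitDir n 1) ≠ 0 := by
    have : (Real.cos (Real.pi / n) : ℂ) ≠ 0 := by
      exact_mod_cast (cos_pi_div_pos (by omega)).ne'
    exact mul_ne_zero hρ (mul_ne_zero this (Complex.exp_ne_zero _))
  refine ⟨hc, _, isCoreKnot_starKnot hk0 hn0 hc (isStarHeight_sin hk0 hn0) rfl ha
    (Ahead.irrefl hn0) ?_,
    (Knot.similar_isotopic _ _ _ _).trans (starKnot_isotopic_torusKnot hk0 hn0 hc)⟩
  intro s t b hb hx h1 h2 hab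
  have hp := crossing_phase hk0 hn0 hb hx
  obtain ⟨e, e1, e2, he⟩ := hab
  rw [← sin_two_pi_fract, ← sin_two_pi_fract (n * s), hx, sin_two_pi_one_sub]
  have hkp : (0 : ℝ) < k := by exact_mod_cast hk0
  have hpi := Real.pi_pos
  have f0 := Int.fract_nonneg (n * s)
  have f1 := Int.fract_lt_one (n * s)
  have f2 := Int.fract_lt_one (n * t)
  set x := Int.fract (n * s)
  have hx0 : 0 < x := by linarith
  have mono := slow_strictMono zero_le_one (le_refl (1 : ℝ))
  have y0 := mono hx0
  have y1 := mono f1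
  rw [slow_zero] at y0
  rw [slow_one] at y1
  set N : ℤ := k * (⌊n * t⌋ - ⌊n * s⌋ + 1) - n * b with hN
  have N0 : 0 < N := by
    have : (0 : ℝ) < N := by rw [← hp]; positivity
    exact_mod_cast this
  have N1 : N < 2 * k := by
    have : (N : ℝ) < 2 * k := by rw [← hp]; nlinarith
    exact_mod_cast this
  have hd : (n : ℤ) ∣ (k - N) - e := by
    rw [← ZMod.intCast_eq_intCast_iff_dvd_sub, he, hN]
    push_cast
    rw [ZMod.natCast_self]
    ring
  have hNe : N = k - e := by
    have := Int.eq_zero_of_abs_lt_dvd hd (abs_lt.2 ⟨by omega, by omega⟩)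
    omega
  have hxh : x < 1 / 2 := by
    apply mono.lt_iff_lt.1
    rw [slow_half]
    have : (N : ℝ) < k := by exact_mod_cast (by omega : N < k)
    rw [← hp] at this
    nlinarith
  have := Real.sin_pos_of_pos_of_lt_pi (x := 2 * Real.pi * x) (by positivity) (by nlinarith)
  linarith

/-- The layers of the ribbon and `cutHeight` use the same ranks, so the crossings agree by
`cutHeight_lt`. -/
theorem rankedRibbon_isTorusKnot (hk : 2 ≤ k) (hn : n = 2 * k + 1) (hc : n.Coprime k)
    (hρ : ρ ≠ 0) : (rankedRibbon hk (by omega) hc hρ c).IsTorusKnot (k + 1) k := by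
  subst hn
  have hk0 : 0 < k := by omega
  have hn0 : 2 * k < 2 * k + 1 := by omega
  have ha : ρ * (Real.cos (Real.pi / (2 * k + 1 : ℕ)) * unitDir (2 * k + 1) 1) ≠ 0 := by
    have : (Real.cos (Real.pi / (2 * k + 1 : ℕ)) : ℂ) ≠ 0 := by
      exact_mod_cast (cos_pi_div_pos (by omega)).ne'
    exact mul_ne_zero hρ (mul_ne_zero this (Complex.exp_ne_zero _))
  have hcop : (k + 1).Coprime k := by simp
  refine ⟨hcop, _, isCoreKnot_starKnot hk0 hn0 hc (cutHeight_odd_isStarHeight hk0) rfl ha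
    (fun _ => lt_irrefl _) ?_,
    (Knot.similar_isotopic _ _ _ _).trans (starKnot_cutHeight_isotopic hk0 hn0 hc hcop)⟩
  intro s t b hb hx h1 h2 hab
  refine cutHeight_lt hk0 hx h1 h2 ?_
  rw [← edgeRank_intCast, ← edgeRank_intCast]
  exact Int.ofNat_lt.2 hab

end

/-! ### The four families and the two ribbons for odd polygons -/

theorem torusKnotRealises_symmetric {n k : ℕ} (hk : 2 ≤ k) (hn : 2 * k + 2 ≤ n)
    (hc : n.Coprime k) : TorusKnotRealises n k n := by
  intro c ρ hρ
  have : NeZero n := ⟨by omega⟩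
  exact ⟨symmetricRibbon hk hn hc hρ c, symmetricRibbon_isTorusKnot hk hn hc hρ,
    forms_of_toRibbonShape (by omega) (by omega) hc hρ rfl⟩

theorem two_mul_add_one_coprime (q : ℕ) : (2 * q + 1).Coprime q := by simp

theorem torusKnotRealises_succ {q : ℕ} (hq : 2 ≤ q) : TorusKnotRealises (q + 1) q (2 * q + 1) :=
  fun c _ hρ => ⟨rankedRibbon hq (by omega) (two_mul_add_one_coprime q) hρ c,
    rankedRibbon_isTorusKnot hq rfl (two_mul_add_one_coprime q) hρ,
    forms_of_toRibbonShape (by omega) (by omega) (two_mul_add_one_coprime q) hρ rfl⟩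

theorem torusKnotRealises_two {p : ℕ} (hp : 7 ≤ p) (h : Odd p) : TorusKnotRealises p 2 p :=
  torusKnotRealises_symmetric le_rfl (by omega) (Nat.coprime_two_right.2 h)

theorem torusKnotRealises_add_two {q : ℕ} (hq : 1 < q) (h : Odd q) :
    TorusKnotRealises (2 * q + 2) q (2 * q + 2) :=
  torusKnotRealises_symmetric hq le_rfl (by simpa using Nat.coprime_two_left.2 h)

theorem torusKnotRealises_add_four {q : ℕ} (hq : 1 < q) (h : Odd q) :
    TorusKnotRealises (2 * q + 4) q (2 * q + 4) := by
  refine torusKnotRealises_symmetric hq (by omega) ?_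
  -- Modulo `q`, the number `2 * q + 4` is `2 ^ 2`.
  have : Nat.Coprime (2 ^ 2) q := (Nat.coprime_two_left.2 h).pow_left 2
  simpa using this

theorem mainTheorem5 :
    (∀ q : ℕ, 2 ≤ q → TorusKnotRealises (q + 1) q (2 * q + 1)) ∧
    (∀ p : ℕ, 7 ≤ p → Odd p → TorusKnotRealises p 2 p) ∧
    (∀ q : ℕ, 1 < q → Odd q → TorusKnotRealises (2 * q + 2) q (2 * q + 2)) ∧
    (∀ q : ℕ, 1 < q → Odd q → TorusKnotRealises (2 * q + 4) q (2 * q + 4)) ∧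
    (∀ n : ℕ, 7 ≤ n ∨ n = 5 → ∃ p q : ℕ, InTorusFamilies p q ∧ TorusKnotRealises p q n) ∧
    (∀ n : ℕ, 7 ≤ n → Odd n → ∃ q : ℕ, 3 ≤ q ∧ n = 2 * q + 1 ∧
      ∀ c ρ : ℂ, ρ ≠ 0 → ∃ R₁ R₂ : FoldedRibbon n,
        R₁.IsTorusKnot (q + 1) q ∧ R₁.Forms c ρ ∧
        R₂.IsTorusKnot n 2 ∧ R₂.Forms c ρ ∧
        ∀ g : ℂ ≃ᵢ ℂ, g '' R₁.shadow ≠ R₂.shadow) := by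
  refine ⟨fun q => torusKnotRealises_succ, fun p => torusKnotRealises_two,
    fun q => torusKnotRealises_add_two, fun q => torusKnotRealises_add_four, fun n hn => ?_,
    fun n hn hodd => ?_⟩
  · rcases Nat.even_or_odd n with he | ho
    · obtain ⟨m, hm⟩ := he
      rcases Nat.even_or_odd m with he' | ho'
      · obtain ⟨l, hl⟩ := he'
        -- For `n = 4 * l` the odd number `2 * l - 1` serves in the third family.
        have hq : Odd (m - 1) := ⟨l - 1, by omega⟩
        have h1 : 1 < m - 1 := by omega
        refine ⟨2 * (m - 1) + 2, m - 1, .inr (.inr (.inl ⟨h1, hq, rfl⟩)), ?_⟩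
        have := torusKnotRealises_add_two h1 hq
        rwa [show n = 2 * (m - 1) + 2 by omega]
      · obtain ⟨l, hl⟩ := ho'
        -- For `n = 4 * l + 2` the odd number `2 * l - 1` serves in the fourth family; the hexagon
        -- would need the excluded value `1`.
        have hq : Odd (m - 2) := ⟨l - 1, by omega⟩
        have h1 : 1 < m - 2 := by omega
        refine ⟨2 * (m - 2) + 4, m - 2, .inr (.inr (.inr ⟨h1, hq, rfl⟩)), ?_⟩
        have := torusKnotRealises_add_four h1 hq
        rwa [show n = 2 * (m - 2) + 4 by omega]
    · obtain ⟨q, hq⟩ := ho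
      have h2 : 2 ≤ q := by omega
      refine ⟨q + 1, q, .inl ⟨h2, rfl⟩, ?_⟩
      rw [hq]
      exact torusKnotRealises_succ h2
  · obtain ⟨q, hq⟩ := id hodd
    refine ⟨q, by omega, hq, fun c ρ hρ => ?_⟩
    have : NeZero n := ⟨by omega⟩
    have hc : n.Coprime q := hq ▸ two_mul_add_one_coprime q
    have hc2 : n.Coprime 2 := Nat.coprime_two_right.2 hodd
    -- The star `{n / 2}` leaves a hole because `2 * 2 + 2 < n`, whereas `{n / q}` with `n = 2 * q +
    -- 1` covers the centre.
    exact ⟨rankedRibbon (by omega) (by omega) hc hρ c, symmetricRibbon le_rfl (by omega) hc2 hρ c,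
      rankedRibbon_isTorusKnot (by omega) hq hc hρ,
      forms_of_toRibbonShape (by omega) (by omega) hc hρ rfl,
      symmetricRibbon_isTorusKnot le_rfl (by omega) hc2 hρ,
      forms_of_toRibbonShape (by omega) (by omega) hc2 hρ rfl,
      shadow_not_congruent (by omega) hq two_pos (by omega) hc2 hρ⟩

end
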